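/- A shalgebra is a set $G$ with two binary operations $\cdot$ (written as juxtaposition) and $\lhd$ such that, for all $a,b,c\in G$, $(ab)c=a(bc)$, $(ab)\lhd c=(a\lhd c)(b\lhd c)$, $(a\lhd b)\lhd c=a\lhd(bc)$ and $(a\lhd b)\lhd c=(a\lhd c)\lhd(b\lhd c)$. For an ordered partition $\overline k=(k_1,\dots,k_\ell)$ of $n\ge 0$ into parts $k_j\ge 1$, put $\Delta^{\overline k}=\Delta^{k_1}\times\cdots\times\Delta^{k_\ell}$ and $G^{\overline k}=G^{k_1}\times\cdots\times G^{k_\ell}$; let $\overline k-1_j$ be $\overline k$ with the part $k_j$ decreased by one, the part being dropped if $k_j=1$. Write an element of $G^{\overline k}$ as $\overline g=(g_{1,1},\dots,g_{1,k_1})|\cdots|(g_{\ell,1},\dots,g_{\ell,k_\ell})$. Number the vertices of $\Delta^m$ by $0,\dots,m$. The good labeling of the edges of $\Delta^{\overline k}$ determined by $\overline g\in G^{\overline k}$ gives the edge $\{p_1\}\times\cdots\times(p_q\to p_q')\times\cdots\times\{p_\ell\}$, $p_q<p_q'$, the label $$(g_{q,p_q+1}\cdots g_{q,p_q'})\lhd(g_{q+1,1}\cdots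 g_{q+1,p_{q+1}}\;\cdots\; g_{\ell,1}\cdots g_{\ell,p_\ell}),$$ where an empty product does not act. For $1\le j\le\ell$ and $0\le i\le k_j$ the map $d_{j;i}:G^{\overline k}\to G^{\overline k-1_j}$ replaces block $j$ as follows: for $i=0$ it removes $g_{j,1}$ and moreover replaces every entry $x$ of the blocks $1,\dots,j-1$ by $x\lhd g_{j,1}$; for $0<i<k_j$ it replaces $g_{j,i},g_{j,i+1}$ by their product; for $i=k_j\geq 1$ it removes $g_{j,k_j}$. Let $C_0=0$, $C_n=\bigoplus_{\overline k}\mathbb Z[G^{\overline k}]$ for $n\ge1$ (sum over the ordered partitions of $n$), let $\partial_n:C_n\to C_{n-1}$ be given on $G^{\overline k}$ by $\sum_{j,i}(-1)^{k_1+\cdots+k_{j-1}+i}d_{j;i}$ (and by $0$ for $n\le 1$), and let $H_n^{\rm P}(G)=\operatorname{Ker}\partial_n/\operatorname{Im}\partial_{n+1}$. Theorem. Let $G$ be a shalgebra. (1) Let $\overline k$ be an ordered partition of $n$ and $\overline g\in G^{\overline k}$. The boundary of $\Delta^{\overline k}$ is the union of the facets $\Delta^{k_1}\times\cdots\times\Delta^{k_j;\hat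 i}\times\cdots\times\Delta^{k_\ell}$, $1\le j\le\ell$, $0\le i\le k_j$, where $\Delta^{k_j;\hat i}$ is the face of $\Delta^{k_j}$ opposite to the vertex $i$. The boundary orientation of the facet $(j,i)$ (outward vector first, for the product orientation of $\Delta^{\overline k}$) is $(-1)^{k_1+\cdots+k_{j-1}+i}$ times its standard orientation as the prism $\Delta^{\overline k-1_j}$ (with the vertices renumbered in order). The labeling of its edges induced by the good labeling determined by $\overline g$ is the good labeling of $\Delta^{\overline k-1_j}$ determined by $d_{j;i}(\overline g)$. (2) Let $BG$ be the quotient space of $\coprod_{n\ge0}\coprod_{\overline k}G^{\overline k}\times\Delta^{\overline k}$ ($G$ discrete) by the equivalence relation generated by identifying each facet of each labeled prism $(\overline g,\Delta^{\overline k})$ with the labeled prism $(\overline g',\Delta^{\overline k-1_j})$ whose good labeling is the induced labeling of the facet. This gluing is well defined: $\overline g'$ exists and is unique, and each point of $BG$ is represented by exactly one pair consisting of a labeled prism and a point of it not on its boundary. (3) $\partial_n\circ\partial_{n+1}=0$ for all $n\geq 0$, and $H_n^{\rm P}(G)\cong H_n(BG)$ (singular homology with integer coefficients) for all $n\ge1$.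 In degree $0$, $H_0^{\rm P}(G)=0$ and $H_0(BG)\cong\mathbb Z$; so $H^{\rm P}_n(G)\cong\widetilde H_n(BG)$ (reduced homology) for all $n\ge0$. -/

import Mathlib

universe u

/-- A shalgebra: an associative multiplication together with a binary operation `act a b = a ⊲ b`
satisfying distributivity, the exponential law and self-distributivity. -/
class Shalgebra (G : Type u) extends Semigroup G where
  act : G → G → G
  mul_act : ∀ a b c : G, act (a * b) c = act a c * act b c
  act_act_eq_act_mul : ∀ a b c : G, act (act a b) c = act a (b * c)
  self_distrib : ∀ a b c : G, act (act a b) c = act (act a c) (act b c)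

infixl:75 " ⊲ " => Shalgebra.act

namespace Prismatic

/-! ### Shapes

An ordered partition `(k₁, …, k_ℓ)` into parts `k_j ≥ 1` is encoded by the list
`[k₁ - 1, …, k_ℓ - 1]` of arbitrary natural numbers: the entry `m` stands for the part `m + 1`.
So `[]` is the partition of `0`. -/

/-- The number `n = k₁ + ⋯ + k_ℓ` partitioned by a shape. -/
def dim : List ℕ → ℕ
  | [] => 0
  | m :: ms => (m + 1) + dim ms

/-- Bracketed tuples, that is, the set `G^{k₁} × ⋯ × G^{k_ℓ}`. -/
def Label (G : Type u) : List ℕ → Type u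
  | [] => PUnit
  | m :: ms => (Fin (m + 1) → G) × Label G ms

/-- The generalized prism `Δ^{k₁} × ⋯ × Δ^{k_ℓ}`. -/
def Prism : List ℕ → Type
  | [] => Unit
  | m :: ms => stdSimplex ℝ (Fin (m + 2)) × Prism ms

instance Prism.instTopologicalSpace : (ks : List ℕ) → TopologicalSpace (Prism ks)
  | [] => inferInstanceAs (TopologicalSpace Unit)
  | m :: ms =>
    letI := Prism.instTopologicalSpace ms
    inferInstanceAs (TopologicalSpace (stdSimplex ℝ (Fin (m + 2)) × Prism ms))

/-- The vertices `{p₁} × ⋯ × {p_ℓ}`, `0 ≤ p_j ≤ k_j`, of a prism. -/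
def Vertex : List ℕ → Type
  | [] => Unit
  | m :: ms => Fin (m + 2) × Vertex ms

/-- The oriented edges
`{p₁} × ⋯ × {p_{q-1}} × (p_q → p'_q) × {p_{q+1}} × ⋯ × {p_ℓ}`, `p_q < p'_q`, of a prism:
either the moving coordinate is the first one, or it is one of the others. -/
def Edge : List ℕ → Type
  | [] => Empty
  | m :: ms => ({e : Fin (m + 2) × Fin (m + 2) // e.1 < e.2} × Vertex ms) ⊕ (Fin (m + 2) × Edge ms)

/-- The facets of a prism, indexed by the pairs `(j, i)` with `1 ≤ j ≤ ℓ` and `0 ≤ i ≤ k_j`: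
the vertex `i` of the factor `Δ^{k_j}` is removed. `Sum.inl i` is the pair `(1, i)`, and `Sum.inr`
shifts `j` by one. -/
def Facet : List ℕ → Type
  | [] => Empty
  | m :: ms => Fin (m + 2) ⊕ Facet ms

instance Facet.instFintype : (ks : List ℕ) → Fintype (Facet ks)
  | [] => inferInstanceAs (Fintype Empty)
  | m :: ms =>
    letI := Facet.instFintype ms
    inferInstanceAs (Fintype (Fin (m + 2) ⊕ Facet ms))

/-- The shape obtained from `(k₁, k₂, …, k_ℓ)` (where `k₁ = m + 1` and `ms` encodes `(k₂, …, k_ℓ)`)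
by decreasing the part `k₁` by one, or dropping it if `k₁ = 1`. -/
def decreaseHead : ℕ → List ℕ → List ℕ
  | 0, ms => ms
  | m + 1, ms => m :: ms

/-- The shape `k̄ - 1_j` of the facet `(j, i)`: the part `k_j` is decreased by one, and it is
dropped if `k_j = 1`. -/
def facetShape : (ks : List ℕ) → Facet ks → List ℕ
  | m :: ms, Sum.inl _ => decreaseHead m ms
  | m :: ms, Sum.inr f => m :: facetShape ms f

/-- The number `k₁ + ⋯ + k_{j-1} + i` for the facet `(j, i)`. -/
def facetExponent : (ks : List ℕ) → Facet ks → ℕ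
  | _ :: _, Sum.inl i => i
  | m :: ms, Sum.inr f => (m + 1) + facetExponent ms f

theorem dim_facetShape_add_one : (ks : List ℕ) → (f : Facet ks) →
    dim (facetShape ks f) + 1 = dim ks
  | 0 :: ms, Sum.inl _ => by simp [facetShape, decreaseHead, dim]; omega
  | (m + 1) :: ms, Sum.inl _ => by simp [facetShape, decreaseHead, dim]; omega
  | m :: ms, Sum.inr f => by
    have := dim_facetShape_add_one ms f
    simp [facetShape, dim]; omega

/-! ### Inclusions of facets -/

/-- The inclusion of the facet `(1, i)` on vertices: the vertices of `Δ^{k₁}` other than `i` are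
renamed in the order-preserving way; if `k₁ = 1` the only remaining vertex of `Δ^{k₁}` is
inserted. -/
def headFacetVertex :
    (m : ℕ) → (ms : List ℕ) → Fin (m + 2) → Vertex (decreaseHead m ms) → Vertex (m :: ms)
  | 0, _, i, v => (i.succAbove 0, v)
  | _ + 1, _, i, (p, v) => (i.succAbove p, v)

/-- The inclusion of the facet `(j, i)` on vertices. -/
def facetVertex : (ks : List ℕ) → (f : Facet ks) → Vertex (facetShape ks f) → Vertex ks
  | m :: ms, Sum.inl i, v => headFacetVertex m ms i v
  | _ :: ms, Sum.inr f, (p, v) => (p, facetVertex ms f v)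

/-- The inclusion of the facet `(1, i)` on edges. -/
def headFacetEdge :
    (m : ℕ) → (ms : List ℕ) → Fin (m + 2) → Edge (decreaseHead m ms) → Edge (m :: ms)
  | 0, _, i, e => Sum.inr (i.succAbove 0, e)
  | _ + 1, _, i, Sum.inl (e, v) =>
    Sum.inl (⟨(i.succAbove e.1.1, i.succAbove e.1.2), i.strictMono_succAbove e.2⟩, v)
  | _ + 1, _, i, Sum.inr (p, e) => Sum.inr (i.succAbove p, e)

/-- The inclusion of the facet `(j, i)` on edges. -/
def facetEdge : (ks : List ℕ) → (f : Facet ks) → Edge (facetShape ks f) → Edge ks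
  | m :: ms, Sum.inl i, e => headFacetEdge m ms i e
  | _ :: ms, Sum.inr f, Sum.inl (e, v) => Sum.inl (e, facetVertex ms f v)
  | _ :: ms, Sum.inr f, Sum.inr (p, e) => Sum.inr (p, facetEdge ms f e)

/-- The inclusion of the facet `(1, i)` on points: a zero is inserted as the `i`-th barycentric
coordinate of the first factor (of the only point of `Δ⁰`, if `k₁ = 1`). -/
noncomputable def headFacetPoint :
    (m : ℕ) → (ms : List ℕ) → Fin (m + 2) → Prism (decreaseHead m ms) → Prism (m :: ms)
  | 0, _, i, x => (stdSimplex.map i.succAbove (stdSimplex.vertex (S := ℝ) (0 : Fin 1)), x)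
  | _ + 1, _, i, (x, y) => (stdSimplex.map i.succAbove x, y)

/-- The inclusion of the facet `(j, i)` on points: a zero is inserted as the `i`-th barycentric
coordinate of the `j`-th factor. -/
noncomputable def facetPoint :
    (ks : List ℕ) → (f : Facet ks) → Prism (facetShape ks f) → Prism ks
  | m :: ms, Sum.inl i, x => headFacetPoint m ms i x
  | _ :: ms, Sum.inr f, (x, y) => (x, facetPoint ms f y)

/-! ### Boundary and orientation of prisms -/

/-- Coordinates on the prism: the barycentric coordinates `x₁, …, x_k` (omitting `x₀`) of all the
factors, in order. This identifies the prism with a convex body in `ℝⁿ`; the standard orientation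
of the prism (product orientation, with `Δ^k` oriented by the order of its vertices) is the one
induced by the standard orientation of `ℝⁿ`. -/
noncomputable def chart : (ks : List ℕ) → Prism ks → Fin (dim ks) → ℝ
  | [], _ => Fin.elim0
  | _ :: ms, (x, y) => Fin.append (fun i => x i.succ) (chart ms y)

/-- The points of the prism lying on its boundary. -/
def boundary (ks : List ℕ) : Set (Prism ks) :=
  {x | chart ks x ∈ frontier (Set.range (chart ks))}

/-- The vertices of a prism, as points. -/
noncomputable def vertexPoint : (ks : List ℕ) → Vertex ks → Prism ks
  | [], v => v
  | _ :: ms, (p, v) => (stdSimplex.vertex (S := ℝ) p, vertexPoint ms v)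

/-- The vertex `{0} × ⋯ × {0}`. -/
def baseVertex : (ks : List ℕ) → Vertex ks
  | [] => ()
  | _ :: ms => (0, baseVertex ms)

/-- The vertices `{0} × ⋯ × {0} × {p} × {0} × ⋯ × {0}`, `p ≥ 1`, in order. The vectors from the base
vertex to these `n` vertices form the positive standard frame of the prism. -/
def frameVertex : (ks : List ℕ) → Fin (dim ks) → Vertex ks
  | [] => Fin.elim0
  | m :: ms => Fin.append (m := m + 1) (fun i => (i.succ, baseVertex ms))
      (fun i => (0, frameVertex ms i))

/-- The product of the barycenters of the factors. -/
noncomputable def center : (ks : List ℕ) → Prism ks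
  | [] => ()
  | _ :: ms => (stdSimplex.barycenter, center ms)

/-- The sign comparing the orientation of the facet `(j, i)` as a part of the boundary of the
oriented prism (outward pointing vector first) with its own standard orientation as the prism
`Δ^{k̄ - 1_j}`. The outward pointing vector is the one from the center of the prism to the center
of the facet. -/
noncomputable def facetSign (ks : List ℕ) (f : Facet ks) : SignType :=
  SignType.sign (Matrix.det (Matrix.of
    (fun (row col : Fin (dim (facetShape ks f) + 1)) =>
      (Fin.cons (α := fun _ => Fin (dim ks) → ℝ)
        (chart ks (facetPoint ks f (center (facetShape ks f))) - chart ks (center ks))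
        (fun c : Fin (dim (facetShape ks f)) =>
          chart ks (facetPoint ks f (vertexPoint _ (frameVertex (facetShape ks f) c)))
            - chart ks (facetPoint ks f (vertexPoint _ (baseVertex (facetShape ks f)))))
        col) (Fin.cast (dim_facetShape_add_one ks f) row))))

/-! ### Good labelings -/

section Labels

variable {G : Type u} [Shalgebra G]

/-- `a ⊲ (b₁ ⋯ b_r)` for the list `[b₁, …, b_r]`; an empty product does not act. -/
def actWord (a : G) : List G → G
  | [] => a
  | b :: bs => a ⊲ bs.foldl (· * ·) b

/-- For a tuple `(g₁, …, g_k)` and `0 ≤ p < p' ≤ k`, the product `g_{p+1} ⋯ g_{p'}`. -/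
def edgeProd {m : ℕ} (g : Fin (m + 1) → G) (e : {e : Fin (m + 2) × Fin (m + 2) // e.1 < e.2}) : G :=
  (((List.ofFn g).take e.1.2).drop (e.1.1 + 1)).foldl (· * ·)
    (g ⟨e.1.1, by have := e.2; have := e.1.2.2; omega⟩)

/-- The word `g_{1;p₁} ⋯ g_{ℓ;p_ℓ}`, where `g_{u;p}` is the word of the first `p` entries of the
`u`-th block. -/
def vertexWord : (ks : List ℕ) → Label G ks → Vertex ks → List G
  | [], _, _ => []
  | _ :: ms, (g, gs), (p, v) => (List.ofFn g).take p ++ vertexWord ms gs v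

/-- The good labeling determined by a bracketed tuple: the edge
`{p₁} × ⋯ × (p_q → p'_q) × ⋯ × {p_ℓ}` gets
`(g_{p_q+1} ⋯ g_{p'_q}) ⊲ (g_{q+1;p_{q+1}} ⋯ g_{ℓ;p_ℓ})`, with indices taken in block `q`. -/
def goodLabeling : (ks : List ℕ) → Label G ks → Edge ks → G
  | _ :: ms, (g, gs), Sum.inl (e, v) => actWord (edgeProd g e) (vertexWord ms gs v)
  | _ :: ms, (_, gs), Sum.inr (_, e) => goodLabeling ms gs e

/-- The effect of `d_i` on one block `(g₁, …, g_k)`: for `i = 0` drop `g₁`; for `0 < i < k` replace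
`g_i, g_{i+1}` by their product; for `i = k` drop `g_k`. -/
def blockFace {m : ℕ} (i : Fin (m + 2)) (g : Fin (m + 1) → G) : Fin m → G :=
  Fin.cases (Fin.tail g) (fun i' => Fin.contractNth i' (· * ·) g) i

/-- The element by which `d_{j;i}` acts on everything to the left of block `j`: the first entry of
block `j` if `i = 0`, and nothing otherwise. -/
def faceActor : (ks : List ℕ) → (f : Facet ks) → Label G ks → Option G
  | _ :: _, Sum.inl i, (g, _) => if i = 0 then some (g 0) else none
  | _ :: ms, Sum.inr f, (_, gs) => faceActor ms f gs

/-- The diagonal action of (at most) one element on a tuple. -/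
def actTuple {m : ℕ} (g : Fin m → G) : Option G → Fin m → G
  | none => g
  | some a => fun t => g t ⊲ a

/-- The map `d_{1;i}`, affecting only the first block (which is dropped if `k₁ = 1`). -/
def headFace : (m : ℕ) → (ms : List ℕ) → Fin (m + 2) → Label G (m :: ms) →
    Label G (decreaseHead m ms)
  | 0, _, _, (_, gs) => gs
  | _ + 1, _, i, (g, gs) => (blockFace i g, gs)

/-- The maps `d_{j;i} : G^{k̄} → G^{k̄ - 1_j}`. -/
def face : (ks : List ℕ) → (f : Facet ks) → Label G ks → Label G (facetShape ks f)
  | m :: ms, Sum.inl i, g => headFace m ms i g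
  | _ :: ms, Sum.inr f, (g, gs) => (actTuple g (faceActor ms f gs), face ms f gs)

end Labels

/-! ### Prismatic homology -/

/-- All pairs (shape, bracketed tuple of that shape). -/
def Cell (G : Type u) : Type u := Σ ks : List ℕ, Label G ks

/-- The generators of the prismatic chain group `C_n`: bracketed `n`-tuples with at least one
block. In particular there are none for `n = 0`. -/
def Generator (G : Type u) (n : ℕ) : Type u := {c : Cell G // c.1 ≠ [] ∧ dim c.1 = n}

/-- The prismatic chain group `C_n`, with `C_0 = 0`. -/
abbrev ChainGroup (G : Type u) (n : ℕ) : Type u := Generator G n →₀ ℤ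

variable (G : Type u) [Shalgebra G]

/-- The prismatic differential `∂_n : C_n → C_{n-1}`, given on `G^{k̄}` by
`∑_{j,i} (-1)^{k₁ + ⋯ + k_{j-1} + i} d_{j;i}`. The `dite` only discards the terms landing in degree
`0`, where the chain group is zero. -/
noncomputable def differential (n : ℕ) : ChainGroup G n →ₗ[ℤ] ChainGroup G (n - 1) :=
  Finsupp.linearCombination ℤ (fun c : Generator G n =>
    ∑ f : Facet c.1.1,
      if h : facetShape c.1.1 f ≠ [] then
        Finsupp.single
          (⟨⟨facetShape c.1.1 f, face c.1.1 f c.1.2⟩, h, by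
            have h₁ := dim_facetShape_add_one c.1.1 f
            have h₂ := c.2.2
            change dim (facetShape c.1.1 f) = n - 1
            omega⟩ : Generator G (n - 1))
          ((-1 : ℤ) ^ facetExponent c.1.1 f)
      else 0)

/-- The prismatic homology `H_n^P(G) = Ker ∂_n / Im ∂_{n+1}`. -/
abbrev Homology (n : ℕ) : Type u :=
  LinearMap.ker (differential G n) ⧸
    (LinearMap.range (differential G (n + 1))).submoduleOf (LinearMap.ker (differential G n))

/-! ### The classifying space -/

/-- The disjoint union of all labeled prisms, the labels being discrete. -/
abbrev PrismSpace : Type u := Σ c : Cell G, Prism c.1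

/-- The gluing: a facet of the labeled prism `(ḡ, Δ^{k̄})` is identified with the labeled prism
`(ḡ', Δ^{k̄ - 1_j})` whenever the labeling of the edges of the facet induced by the good labeling of
`(ḡ, Δ^{k̄})` is the good labeling of `(ḡ', Δ^{k̄ - 1_j})`. -/
inductive Glue : PrismSpace G → PrismSpace G → Prop
  | facet (ks : List ℕ) (f : Facet ks) (g : Label G ks) (g' : Label G (facetShape ks f))
      (h : goodLabeling ks g ∘ facetEdge ks f = goodLabeling (facetShape ks f) g')
      (x : Prism (facetShape ks f)) :
      Glue ⟨⟨ks, g⟩, facetPoint ks f x⟩ ⟨⟨facetShape ks f, g'⟩, x⟩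

/-- The classifying space `BG`, with the quotient topology (by the equivalence relation generated
by the gluing). -/
def BG : Type u := Quot (Glue G)

instance : TopologicalSpace (BG G) := inferInstanceAs (TopologicalSpace (Quot (Glue G)))

/-- Singular homology of a topological space with integer coefficients. -/
noncomputable abbrev singularHomology (n : ℕ) (X : Type u) [TopologicalSpace X] :
    ModuleCat.{u} ℤ :=
  ((AlgebraicTopology.singularHomologyFunctor (ModuleCat.{u} ℤ) n).obj
    (ModuleCat.of ℤ (ULift.{u} ℤ))).obj (TopCat.of X)

end Prismatic

/-!
An edge of a facet is an edge of the prism, and its label is rewritten by the axioms of a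
shalgebra: associativity handles the products along the edge (`prodFrom_seqFace`),
`(a ⊲ b) ⊲ c = a ⊲ (b * c)` the words that act on it (`actPrefix_skip`), and the two
distributivity laws show that a dropped first entry may be moved through the blocks before it
(`edgeProd_actTuple`, `actWord_vertexWord_facetVertex`). The orientation of a facet is the sign of
a determinant, which is computed by means of the linear form that defines the facet
(`mul_det_of_form`, `facetSign_eq`).

A good labeling determines its tuple (`goodLabeling_injective`), hence labels restrict uniquely to
faces of any codimension. A point of a prism lies in the interior of exactly one such face, and
this labeled face, the carrier of the point, is not changed by the gluing; so every point of the
classifying space lies in exactly one open cell (`existsUnique_interior_rep`).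

Consequently the classifying space is a cell complex: a skeleton arises from the preceding one by
attaching prisms along their boundaries (`nonempty_attachment_skel`), and compact sets lie in
skeleta (`exists_subset_skel`). Its homology is computed by cellular chains. The singular chains
used for this are augmented, with the empty simplex as generator in the lowest degree; this makes
the vertex an ordinary cell and the homology reduced. Three ingredients are built from scratch:

* The cross product of chains with a simplex, which yields the homotopy invariance of singular
  homology and the fundamental chain of a prism. The product formula gives the boundary of this
  chain as the sum of the fundamental chains of the facets, with exactly the signs of the
  prismatic differential (`sBdry_fundChain`).
* Excision for attaching a space along a subset with a collar, by barycentric subdivision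
  (`Attachment.exists_relCycle`, `Attachment.exists_relBoundary`).
* The homology of a prism relative to its boundary, which is freely generated by the fundamental
  chain (`relHomology_prism`).

It follows that relative cycles of consecutive skeleta are homologous to unique combinations of
cells, and the usual induction over the skeleta compares cycles (`exists_cellular_cycle`) and
boundaries (`exists_cellBdry_eq`). The cellular complex differs from the prismatic one only by the
vertex, and this matters in degree zero only, since the two ends of each edge cancel
(`cellBdry_eq_zero`). The prismatic differential squares to zero because the singular one does
(`cellBdry_cellBdry`). Finally, the singular chains used here are identified with Mathlib's
singular chain complex (`toSing`, `ofSing`), which gives `nonempty_homology_equiv`.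
-/

namespace Prismatic

open Finsupp

/-! ### Ordered tuples and singular chains -/

section FaceSystems

/-- The free abelian group on the elements of a graded set. -/
abbrev Chains (X : ℕ → Type*) := (Σ n, X n) →₀ ℤ

/-- The alternating sum of the faces of an element. Degrees count vertices, so that degree `0` is
the augmentation degree. -/
noncomputable def bdryGen {X : ℕ → Type*} (δ : ∀ n, Fin (n + 1) → X (n + 1) → X n) :
    (Σ n, X n) → Chains X
  | ⟨0, _⟩ => 0
  | ⟨n + 1, x⟩ => ∑ i : Fin (n + 1), (-1 : ℤ) ^ (i : ℕ) • single ⟨n, δ n i x⟩ 1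

/-- The boundary operator of a graded set with face maps. -/
noncomputable def bdryOf {X : ℕ → Type*} (δ : ∀ n, Fin (n + 1) → X (n + 1) → X n) :
    Chains X →ₗ[ℤ] Chains X :=
  linearCombination ℤ (bdryGen δ)

/-- The map of chains induced by a graded map. -/
noncomputable def chainMap {X : ℕ → Type*} {Y : ℕ → Type*} (f : ∀ n, X n → Y n) :
    Chains X →ₗ[ℤ] Chains Y :=
  lmapDomain ℤ ℤ (fun x => ⟨x.1, f x.1 x.2⟩)

@[simp] theorem chainMap_single {X : ℕ → Type*} {Y : ℕ → Type*} (f : ∀ n, X n → Y n)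
    (n : ℕ) (x : X n) (c : ℤ) : chainMap f (single ⟨n, x⟩ c) = single ⟨n, f n x⟩ c := by
  simp [chainMap]

theorem bdryOf_single_zero {X : ℕ → Type*} (δ : ∀ n, Fin (n + 1) → X (n + 1) → X n) (x : X 0) :
    bdryOf δ (single ⟨0, x⟩ 1) = 0 := by
  simp [bdryOf, bdryGen]

theorem bdryOf_single_succ {X : ℕ → Type*} (δ : ∀ n, Fin (n + 1) → X (n + 1) → X n) (n : ℕ)
    (x : X (n + 1)) :
    bdryOf δ (single ⟨n + 1, x⟩ 1)
      = ∑ i : Fin (n + 1), (-1 : ℤ) ^ (i : ℕ) • single ⟨n, δ n i x⟩ 1 := by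
  simp [bdryOf, bdryGen]

/-- Linear maps out of a chain group agree as soon as they agree on generators. -/
theorem chains_ext {X : ℕ → Type*} {M : Type*} [AddCommGroup M] {f g : Chains X →ₗ[ℤ] M}
    (h : ∀ n x, f (single ⟨n, x⟩ 1) = g (single ⟨n, x⟩ 1)) : f = g := by
  ext ⟨n, x⟩
  simpa using h n x

theorem bdryOf_chainMap {X : ℕ → Type*} {Y : ℕ → Type*} (δ : ∀ n, Fin (n + 1) → X (n + 1) → X n)
    (δ' : ∀ n, Fin (n + 1) → Y (n + 1) → Y n) (f : ∀ n, X n → Y n)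
    (hf : ∀ n i x, f n (δ n i x) = δ' n i (f (n + 1) x)) (a : Chains X) :
    bdryOf δ' (chainMap f a) = chainMap f (bdryOf δ a) := by
  have : bdryOf δ' ∘ₗ chainMap f = chainMap f ∘ₗ bdryOf δ := by
    refine chains_ext fun n x => ?_
    cases n with
    | zero => simp [bdryOf_single_zero]
    | succ n => simp [bdryOf_single_succ, hf, map_sum]
  exact LinearMap.congr_fun this a

theorem chainMap_comp {X : ℕ → Type*} {Y : ℕ → Type*} {Z : ℕ → Type*} (f : ∀ n, X n → Y n)
    (g : ∀ n, Y n → Z n) (a : Chains X) :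
    chainMap g (chainMap f a) = chainMap (fun n x => g n (f n x)) a := by
  have : chainMap g ∘ₗ chainMap f = chainMap (fun n x => g n (f n x)) :=
    chains_ext fun n x => by simp
  exact LinearMap.congr_fun this a

theorem chainMap_id {X : ℕ → Type*} (a : Chains X) : chainMap (fun _ x => x) a = a := by
  have : chainMap (X := X) (fun _ x => x) = LinearMap.id := chains_ext fun n x => by simp
  exact LinearMap.congr_fun this a

/-- Induction principle for statements about chains that are compatible with sums and multiples. -/
theorem mem_supported_induction {α : Type*} {M : Type*} [AddCommGroup M] {s : Set α}
    (f : (α →₀ ℤ) →ₗ[ℤ] M) (N : Submodule ℤ M) (h : ∀ x ∈ s, f (single x 1) ∈ N)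
    {a : α →₀ ℤ} (ha : a ∈ supported ℤ ℤ s) : f a ∈ N := by
  have : supported ℤ ℤ s ≤ N.comap f := by
    rw [supported_eq_span_single, Submodule.span_le]
    rintro _ ⟨x, hx, rfl⟩
    exact h x hx
  exact this ha

end FaceSystems

section Tuples

/-- Chains of ordered tuples of elements of `W`: the chains of the full simplex on the set `W`. -/
abbrev Tuples (W : Type*) := Chains (fun n => Fin n → W)

/-- The boundary of a tuple chain. -/
noncomputable abbrev tBdry {W : Type*} : Tuples W →ₗ[ℤ] Tuples W :=
  bdryOf (fun _ i w => w ∘ i.succAbove)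

/-- The effect of a map of sets on tuple chains. -/
noncomputable abbrev tMap {W W' : Type*} (f : W → W') : Tuples W →ₗ[ℤ] Tuples W' :=
  chainMap (fun _ w => f ∘ w)

/-- The cone operator: it puts `v` in front of every tuple. -/
noncomputable def cone {W : Type*} (v : W) : Tuples W →ₗ[ℤ] Tuples W :=
  lmapDomain ℤ ℤ (fun x => ⟨x.1 + 1, Fin.cons v x.2⟩)

@[simp] theorem cone_single {W : Type*} (v : W) (n : ℕ) (w : Fin n → W) (c : ℤ) :
    cone v (single ⟨n, w⟩ c) = single ⟨n + 1, Fin.cons v w⟩ c := by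
  simp [cone]

theorem tBdry_tMap {W W' : Type*} (f : W → W') (a : Tuples W) :
    tBdry (tMap f a) = tMap f (tBdry a) :=
  bdryOf_chainMap (X := fun n => Fin n → W) (Y := fun n => Fin n → W')
    (fun _ i w => w ∘ i.succAbove) (fun _ i w => w ∘ i.succAbove) (fun _ w => f ∘ w)
    (fun _ _ _ => rfl) a

theorem tMap_cone {W W' : Type*} (f : W → W') (v : W) (a : Tuples W) :
    tMap f (cone v a) = cone (f v) (tMap f a) := by
  have : tMap f ∘ₗ cone v = cone (f v) ∘ₗ tMap f := by
    refine chains_ext fun n x => ?_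
    simp only [LinearMap.comp_apply, cone_single, chainMap_single]
    congr 2
    funext i
    refine Fin.cases ?_ (fun j => ?_) i <;> simp
  exact LinearMap.congr_fun this a

theorem cons_comp_succ_succAbove {W : Type*} {n : ℕ} (v : W) (w : Fin (n + 1) → W)
    (i : Fin (n + 1)) :
    (Fin.cons v w : Fin (n + 2) → W) ∘ i.succ.succAbove = Fin.cons v (w ∘ i.succAbove) := by
  funext j
  refine Fin.cases ?_ (fun j => ?_) j <;> simp

/-- The cone operator is a contraction of the augmented tuple complex. -/
theorem tBdry_cone {W : Type*} (v : W) (a : Tuples W) :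
    tBdry (cone v a) = a - cone v (tBdry a) := by
  have : tBdry ∘ₗ cone v = LinearMap.id - cone v ∘ₗ tBdry := by
    refine chains_ext fun n x => ?_
    cases n with
    | zero =>
      simp only [LinearMap.comp_apply, LinearMap.sub_apply, cone_single, bdryOf_single_zero,
        bdryOf_single_succ]
      simp only [Nat.reduceAdd, Finset.univ_unique, Fin.default_eq_zero, Fin.isValue,
        Finset.sum_singleton, Fin.val_zero, pow_zero, one_smul, map_zero, LinearMap.id_apply,
        sub_zero]
      congr 2
    | succ n =>
      simp only [LinearMap.comp_apply, LinearMap.sub_apply, cone_single, bdryOf_single_succ,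
        map_sum, map_smul, LinearMap.id_apply]
      rw [Fin.sum_univ_succ, sub_eq_add_neg, ← Finset.sum_neg_distrib]
      congr 1
      · simp only [Fin.val_zero, pow_zero, one_smul]
        rfl
      · refine Finset.sum_congr rfl fun i _ => ?_
        rw [cons_comp_succ_succAbove, Fin.val_succ, pow_succ]
        simp
  exact LinearMap.congr_fun this a

theorem tBdry_tBdry {W : Type*} (a : Tuples W) : tBdry (tBdry a) = 0 := by
  have : (tBdry : Tuples W →ₗ[ℤ] Tuples W) ∘ₗ tBdry = 0 := by
    refine chains_ext fun n x => ?_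
    induction n with
    | zero => simp [bdryOf_single_zero]
    | succ n ih =>
      have h : (single ⟨n + 1, x⟩ 1 : Tuples W) = cone (x 0) (single ⟨n, Fin.tail x⟩ 1) := by
        rw [cone_single, Fin.cons_self_tail]
      have ih' := ih (Fin.tail x)
      simp only [LinearMap.comp_apply, LinearMap.zero_apply] at ih' ⊢
      rw [h, tBdry_cone, map_sub, tBdry_cone, ih', map_zero, sub_zero, sub_self]
  exact LinearMap.congr_fun this a

end Tuples

section Singular

/-- The topological simplex with `n` vertices. It is empty for `n = 0`. -/
abbrev Simp (n : ℕ) : Type := stdSimplex ℝ (Fin n)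

/-- The affine map of simplices given by a map of vertices, as a continuous map. -/
noncomputable def simpMap {m n : ℕ} (f : Fin m → Fin n) : C(Simp m, Simp n) :=
  ⟨stdSimplex.map f, stdSimplex.continuous_map f⟩

theorem simpMap_comp {l m n : ℕ} (f : Fin l → Fin m) (g : Fin m → Fin n) :
    (simpMap g).comp (simpMap f) = simpMap (g ∘ f) := by
  ext1 x
  exact stdSimplex.map_comp_apply f g x

theorem simpMap_id (n : ℕ) : simpMap (id : Fin n → Fin n) = ContinuousMap.id _ := by
  ext1 x
  exact stdSimplex.map_id_apply x

instance : IsEmpty (Simp 0) := ⟨fun x => by simpa using x.2.2⟩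

/-- Augmented singular chains: the generator with `n` vertices are the continuous maps from the
simplex with `n` vertices, including the empty simplex for `n = 0`. -/
abbrev SChains (X : Type*) [TopologicalSpace X] := Chains (fun n => C(Simp n, X))

variable {X Y Z : Type*} [TopologicalSpace X] [TopologicalSpace Y] [TopologicalSpace Z]

/-- The boundary of a singular chain. -/
noncomputable abbrev sBdry : SChains X →ₗ[ℤ] SChains X :=
  bdryOf (fun _ i σ => σ.comp (simpMap i.succAbove))

/-- The effect of a continuous map on singular chains. -/
noncomputable abbrev sMap (f : C(X, Y)) : SChains X →ₗ[ℤ] SChains Y :=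
  chainMap (fun _ σ => f.comp σ)

theorem sBdry_sMap (f : C(X, Y)) (a : SChains X) : sBdry (sMap f a) = sMap f (sBdry a) :=
  bdryOf_chainMap (X := fun n => C(Simp n, X)) (Y := fun n => C(Simp n, Y))
    (fun _ i σ => σ.comp (simpMap i.succAbove)) (fun _ i σ => σ.comp (simpMap i.succAbove))
    (fun _ σ => f.comp σ) (fun _ _ _ => rfl) a

theorem sMap_sMap (g : C(Y, Z)) (f : C(X, Y)) (a : SChains X) :
    sMap g (sMap f a) = sMap (g.comp f) a :=
  chainMap_comp _ _ a

theorem sMap_id (a : SChains X) : sMap (ContinuousMap.id X) a = a :=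
  chainMap_id a

/-- The singular chains given by a chain of tuples of vertices of a singular simplex. -/
noncomputable def pushVertices {n : ℕ} (σ : C(Simp n, X)) : Tuples (Fin n) →ₗ[ℤ] SChains X :=
  chainMap (fun _ w => σ.comp (simpMap w))

theorem sBdry_pushVertices {n : ℕ} (σ : C(Simp n, X)) (a : Tuples (Fin n)) :
    sBdry (pushVertices σ a) = pushVertices σ (tBdry a) :=
  bdryOf_chainMap _ _ _ (fun _ _ _ => by
    rw [ContinuousMap.comp_assoc, simpMap_comp]) a

theorem sBdry_sBdry (a : SChains X) : sBdry (sBdry a) = 0 := by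
  have : (sBdry : SChains X →ₗ[ℤ] SChains X) ∘ₗ sBdry = 0 := by
    refine chains_ext fun n σ => ?_
    have h : (single ⟨n, σ⟩ 1 : SChains X) = pushVertices σ (single ⟨n, id⟩ 1) := by
      simp [pushVertices, simpMap_id]
    rw [LinearMap.comp_apply, h, sBdry_pushVertices, sBdry_pushVertices, tBdry_tBdry, map_zero,
      LinearMap.zero_apply]
  exact LinearMap.congr_fun this a

/-! ### Chains in a subset -/

/-- The singular chains of `X` whose simplices lie in the subset `A`. -/
def SIn (A : Set X) : Submodule ℤ (SChains X) :=
  supported ℤ ℤ {x | ∀ t, x.2 t ∈ A}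

theorem single_mem_SIn {A : Set X} {n : ℕ} {σ : C(Simp n, X)} (h : ∀ t, σ t ∈ A) (c : ℤ) :
    single ⟨n, σ⟩ c ∈ SIn A :=
  single_mem_supported ℤ c h

theorem SIn_mono {A B : Set X} (h : A ⊆ B) : SIn A ≤ SIn B :=
  supported_mono fun _ hx t => h (hx t)

theorem SIn_univ (a : SChains X) : a ∈ SIn (Set.univ : Set X) := by
  simp [SIn]

/-- A linear map sends chains in `A` to a submodule if it does so for single simplices. -/
theorem SIn_induction {M : Type*} [AddCommGroup M] {A : Set X} (f : SChains X →ₗ[ℤ] M)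
    (N : Submodule ℤ M)
    (h : ∀ (n : ℕ) (σ : C(Simp n, X)), (∀ t, σ t ∈ A) → f (single ⟨n, σ⟩ 1) ∈ N)
    {a : SChains X} (ha : a ∈ SIn A) : f a ∈ N :=
  mem_supported_induction f N (fun x hx => h x.1 x.2 hx) ha

theorem sBdry_mem_SIn {A : Set X} {a : SChains X} (ha : a ∈ SIn A) : sBdry a ∈ SIn A := by
  refine SIn_induction sBdry _ (fun n σ hσ => ?_) ha
  cases n with
  | zero => rw [bdryOf_single_zero]; exact zero_mem _
  | succ n =>
    rw [bdryOf_single_succ]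
    exact sum_mem fun i _ => Submodule.smul_mem _ _ (single_mem_SIn (fun t => hσ (simpMap _ t)) _)

theorem sMap_mem_SIn {A : Set X} {B : Set Y} {f : C(X, Y)} (hf : ∀ x ∈ A, f x ∈ B)
    {a : SChains X} (ha : a ∈ SIn A) : sMap f a ∈ SIn B := by
  refine SIn_induction (sMap f) _ (fun n σ hσ => ?_) ha
  rw [chainMap_single]
  exact single_mem_SIn (fun t => hf _ (hσ t)) _

/-- Chains lying in the image of an embedding lift along it. -/
theorem exists_sMap_eq_of_isEmbedding {f : C(X, Y)} (hf : Topology.IsEmbedding f) {B : Set Y}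
    (hB : B ⊆ Set.range f) {b : SChains Y} (hb : b ∈ SIn B) :
    ∃ a ∈ SIn (f ⁻¹' B), sMap f a = b := by
  have : b ∈ (SIn (f ⁻¹' B)).map (sMap f) := by
    refine SIn_induction LinearMap.id _ (fun n σ hσ => ?_) hb
    choose τ hτ using fun t => hB (hσ t)
    have hτc : Continuous τ := hf.continuous_iff.2 (by
      have : f ∘ τ = σ := funext hτ
      rw [this]; exact σ.continuous)
    refine ⟨single ⟨n, ⟨τ, hτc⟩⟩ 1, single_mem_SIn (fun t => ?_) _, ?_⟩
    · simp [hτ, hσ]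
    · simp only [chainMap_single, LinearMap.id_apply]
      congr 2
      ext t
      exact hτ t
  exact this

theorem sMap_injective {f : C(X, Y)} (hf : Function.Injective f) :
    Function.Injective (sMap f) := by
  refine Finsupp.mapDomain_injective ?_
  rintro ⟨n, σ⟩ ⟨m, τ⟩ h
  obtain rfl : n = m := congrArg Sigma.fst h
  simp only [Sigma.mk.injEq, heq_eq_eq, true_and] at h
  congr 1
  ext t
  exact hf (DFunLike.congr_fun h t)

/-- Every simplex occurring in the image of a chain under an injective map lies in the image. -/
theorem mem_SIn_of_sMap {f : C(X, Y)} (hf : Function.Injective f) {B : Set Y} {a : SChains X}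
    (ha : sMap f a ∈ SIn B) : a ∈ SIn (f ⁻¹' B) := by
  rw [SIn, mem_supported] at ha ⊢
  intro x hx t
  have hinj : Function.Injective
      (fun x : Σ n, C(Simp n, X) => (⟨x.1, f.comp x.2⟩ : Σ n, C(Simp n, Y))) := by
    rintro ⟨n, σ⟩ ⟨m, τ⟩ h
    obtain rfl : n = m := congrArg Sigma.fst h
    simp only [Sigma.mk.injEq, heq_eq_eq, true_and] at h
    congr 1
    ext t
    exact hf (DFunLike.congr_fun h t)
  have : (⟨x.1, f.comp x.2⟩ : Σ n, C(Simp n, Y)) ∈ (sMap f a).support := by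
    rw [Finsupp.mem_support_iff]
    change mapDomain _ a _ ≠ 0
    rw [mapDomain_apply hinj a x]
    exact Finsupp.mem_support_iff.1 hx
  exact ha this t

end Singular

end Prismatic

namespace Prismatic

open Finsupp

/-! ### The cross product with a simplex -/

section Cross

/-- The universal chains triangulating the product of a `p`-simplex with a simplex with `n`
vertices, constructed by coning off the required boundary. -/
noncomputable def crossKer : (p n : ℕ) → Tuples (Fin (p + 1) × Fin n)
  | 0, n => single ⟨n, fun i => (0, i)⟩ 1
  | _ + 1, 0 => 0
  | p + 1, n + 1 => cone (0, 0)
      (∑ i : Fin (p + 2), (-1 : ℤ) ^ (i : ℕ) • tMap (Prod.map i.succAbove id) (crossKer p (n + 1))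
        + (-1 : ℤ) ^ (p + 1) • ∑ j : Fin (n + 1), (-1 : ℤ) ^ (j : ℕ) •
            tMap (Prod.map id j.succAbove) (crossKer (p + 1) n))

/-- The cross product of a `p`-simplex with a tuple chain. -/
noncomputable def tCross {W : Type*} (p : ℕ) : Tuples W →ₗ[ℤ] Tuples (Fin (p + 1) × W) :=
  linearCombination ℤ fun x => tMap (Prod.map id x.2) (crossKer p x.1)

variable {W W' : Type*}

theorem tCross_single (p n : ℕ) (w : Fin n → W) :
    tCross p (single ⟨n, w⟩ 1) = tMap (Prod.map id w) (crossKer p n) := by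
  simp [tCross]

theorem tMap_tMap {W'' : Type*} (g : W' → W'') (f : W → W') (a : Tuples W) :
    tMap g (tMap f a) = tMap (g ∘ f) a :=
  chainMap_comp (X := fun n => Fin n → W) (Y := fun n => Fin n → W') (Z := fun n => Fin n → W'')
    _ _ a

theorem tMap_id (a : Tuples W) : tMap id a = a :=
  chainMap_id (X := fun n => Fin n → W) a

theorem tMap_tCross (p : ℕ) (f : W → W') (a : Tuples W) :
    tMap (Prod.map id f) (tCross p a) = tCross p (tMap f a) := by
  have : tMap (Prod.map id f) ∘ₗ tCross p = tCross p ∘ₗ tMap f := by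
    refine chains_ext fun n w => ?_
    simp only [LinearMap.comp_apply, chainMap_single, tCross_single, tMap_tMap]
    rfl
  exact LinearMap.congr_fun this a

theorem crossKer_succ_succ (p n : ℕ) :
    crossKer (p + 1) (n + 1) = cone (0, 0)
      (∑ i : Fin (p + 2), (-1 : ℤ) ^ (i : ℕ) • tMap (Prod.map i.succAbove id) (crossKer p (n + 1))
        + (-1 : ℤ) ^ (p + 1) • tCross (p + 1) (tBdry (single ⟨n + 1, id⟩ 1))) := by
  rw [crossKer, bdryOf_single_succ, map_sum]
  congr 3
  refine Finset.sum_congr rfl fun j _ => ?_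
  rw [map_smul, tCross_single]
  rfl

theorem tBdry_tCross_zero (a : Tuples W) : tBdry (tCross 0 a) = tCross 0 (tBdry a) := by
  have : tCross (W := W) 0 = tMap (fun w => ((0 : Fin 1), w)) := by
    refine chains_ext fun n w => ?_
    rw [tCross_single, crossKer, chainMap_single, chainMap_single]
    rfl
  rw [this, tBdry_tMap]

/-- Alternating double sums of faces of a simplex vanish on any family of chains parametrized
by the maps into the vertices of the simplex. -/
theorem sum_sum_faces_eq_zero {M : Type*} [AddCommGroup M] (p : ℕ)
    (F : (Fin (p + 1) → Fin (p + 3)) → M) :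
    ∑ i : Fin (p + 3), (-1 : ℤ) ^ (i : ℕ) • ∑ k : Fin (p + 2), (-1 : ℤ) ^ (k : ℕ) •
      F (i.succAbove ∘ k.succAbove) = 0 := by
  let L : Tuples (Fin (p + 3)) →ₗ[ℤ] M := linearCombination ℤ fun x =>
    if h : x.1 = p + 1 then F (x.2 ∘ Fin.cast h.symm) else 0
  have hL : ∀ w : Fin (p + 1) → Fin (p + 3), L (single ⟨p + 1, w⟩ 1) = F w := by
    intro w
    simp only [L, linearCombination_single, one_smul, dite_true]
    rfl
  have := congrArg L (tBdry_tBdry (single ⟨p + 3, id⟩ 1 : Tuples (Fin (p + 3))))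
  simpa only [bdryOf_single_succ, map_sum, map_smul, hL, map_zero, Function.id_comp] using this

/-- The alternating sum of the inclusions of the faces of the first factor. -/
noncomputable def tFaces (W : Type*) (p : ℕ) :
    Tuples (Fin (p + 1) × W) →ₗ[ℤ] Tuples (Fin (p + 2) × W) :=
  ∑ i : Fin (p + 2), (-1 : ℤ) ^ (i : ℕ) • tMap (Prod.map i.succAbove id)

theorem tFaces_apply (p : ℕ) (a : Tuples (Fin (p + 1) × W)) :
    tFaces W p a = ∑ i : Fin (p + 2), (-1 : ℤ) ^ (i : ℕ) • tMap (Prod.map i.succAbove id) a := by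
  simp [tFaces, LinearMap.sum_apply]

theorem tFaces_tFaces (p : ℕ) (a : Tuples (Fin (p + 1) × W)) :
    tFaces W (p + 1) (tFaces W p a) = 0 := by
  rw [tFaces_apply, tFaces_apply]
  simp only [map_sum, map_smul, tMap_tMap]
  exact sum_sum_faces_eq_zero p fun f => tMap (Prod.map f id) a

theorem tMap_tFaces (p : ℕ) (f : W → W') (a : Tuples (Fin (p + 1) × W)) :
    tMap (Prod.map id f) (tFaces W p a) = tFaces W' p (tMap (Prod.map id f) a) := by
  simp only [tFaces_apply, map_sum, map_smul, tMap_tMap]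
  rfl

theorem tBdry_tFaces (p : ℕ) (a : Tuples (Fin (p + 1) × W)) :
    tBdry (tFaces W p a) = tFaces W p (tBdry a) := by
  simp only [tFaces_apply, map_sum, map_smul, tBdry_tMap]

/-- The boundary formula extends from the universal chains in one degree to all tuples. -/
theorem tBdry_tCross_of_ker {p n : ℕ}
    (h : tBdry (crossKer (p + 1) n) = tFaces _ p (crossKer p n)
        + (-1 : ℤ) ^ (p + 1) • tCross (p + 1) (tBdry (single ⟨n, id⟩ 1))) (w : Fin n → W) :
    tBdry (tCross (p + 1) (single ⟨n, w⟩ 1)) = tFaces W p (tCross p (single ⟨n, w⟩ 1))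
        + (-1 : ℤ) ^ (p + 1) • tCross (p + 1) (tBdry (single ⟨n, w⟩ 1)) := by
  have hw : (single ⟨n, w⟩ 1 : Tuples W) = tMap w (single ⟨n, id⟩ 1) := by
    rw [chainMap_single]; rfl
  rw [tCross_single, tCross_single, tBdry_tMap, h, map_add, map_smul, tMap_tCross, ← tBdry_tMap,
    ← hw, tMap_tFaces]

/-- The inductive step of the boundary formula: the chain that is coned off is a cycle. -/
theorem tBdry_crossKer_step {p n : ℕ}
    (h₁ : tBdry (crossKer (p + 1) n) = tFaces _ p (crossKer p n)
        + (-1 : ℤ) ^ (p + 1) • tCross (p + 1) (tBdry (single ⟨n, id⟩ 1)))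
    (h₂ : tFaces _ p (tBdry (crossKer p (n + 1)))
      = (-1 : ℤ) ^ p • tFaces _ p (tCross p (tBdry (single ⟨n + 1, id⟩ 1)))) :
    tBdry (crossKer (p + 1) (n + 1)) = tFaces _ p (crossKer p (n + 1))
        + (-1 : ℤ) ^ (p + 1) • tCross (p + 1) (tBdry (single ⟨n + 1, id⟩ 1)) := by
  have h₃ : tBdry (tCross (p + 1) (tBdry (single ⟨n + 1, id⟩ 1 : Tuples (Fin (n + 1)))))
      = tFaces _ p (tCross p (tBdry (single ⟨n + 1, id⟩ 1))) := by
    have key : tBdry (single ⟨n + 1, id⟩ 1 : Tuples (Fin (n + 1))) ∈ LinearMap.eqLocus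
        (tBdry ∘ₗ tCross (p + 1))
        (tFaces _ p ∘ₗ tCross p + (-1 : ℤ) ^ (p + 1) • (tCross (p + 1) ∘ₗ tBdry)) := by
      rw [bdryOf_single_succ]
      exact sum_mem fun i _ => Submodule.smul_mem _ _ (tBdry_tCross_of_ker h₁ _)
    have := LinearMap.mem_eqLocus.1 key
    simp only [LinearMap.comp_apply, LinearMap.add_apply, LinearMap.smul_apply] at this
    rw [this, tBdry_tBdry, map_zero, smul_zero, add_zero]
  rw [crossKer_succ_succ, ← tFaces_apply, tBdry_cone, sub_eq_self]
  refine (congrArg (cone (0, 0)) ?_).trans (map_zero _)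
  rw [map_add, map_smul, h₃, tBdry_tFaces, h₂, ← add_smul, pow_succ]
  simp

/-- The product formula for the boundary of the universal chains. -/
theorem tBdry_crossKer (p n : ℕ) :
    tBdry (crossKer (p + 1) n) = tFaces _ p (crossKer p n)
        + (-1 : ℤ) ^ (p + 1) • tCross (p + 1) (tBdry (single ⟨n, id⟩ 1)) := by
  induction p generalizing n with
  | zero =>
    induction n with
    | zero =>
      simp only [crossKer, bdryOf_single_zero, map_zero, smul_zero, add_zero, tFaces_apply,
        chainMap_single]
      rw [Fin.sum_univ_two]
      simp only [Fin.val_zero, Fin.val_one, pow_zero, pow_one, one_smul, neg_smul]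
      rw [eq_comm, add_neg_eq_zero]
      congr 2
      exact funext fun i => i.elim0
    | succ n ih =>
      refine tBdry_crossKer_step ih ?_
      have h : crossKer 0 (n + 1) = tCross 0 (single ⟨n + 1, id⟩ 1) := by
        rw [tCross_single, Prod.map_id, tMap_id]
      rw [h, tBdry_tCross_zero, pow_zero, one_smul]
  | succ p ihp =>
    induction n with
    | zero =>
      simp only [crossKer, bdryOf_single_zero, map_zero, smul_zero, add_zero]
    | succ n ih =>
      refine tBdry_crossKer_step ih ?_
      rw [ihp, map_add, tFaces_tFaces, zero_add, map_smul]

variable {X Y Z : Type*} [TopologicalSpace X] [TopologicalSpace Y] [TopologicalSpace Z]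

/-- The singular chains on a product given by a simplex of one factor and chains of tuples of
vertices. -/
noncomputable def crossPush (p : ℕ) {n : ℕ} (σ : C(Simp n, Y)) :
    Tuples (Fin (p + 1) × Fin n) →ₗ[ℤ] SChains (Simp (p + 1) × Y) :=
  chainMap fun _ w => (simpMap (Prod.fst ∘ w)).prodMk (σ.comp (simpMap (Prod.snd ∘ w)))

/-- The cross product of the standard `p`-simplex with a singular chain. -/
noncomputable def sCross (p : ℕ) : SChains Y →ₗ[ℤ] SChains (Simp (p + 1) × Y) :=
  linearCombination ℤ fun x => crossPush p x.2 (crossKer p x.1)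

theorem sCross_single (p n : ℕ) (σ : C(Simp n, Y)) :
    sCross p (single ⟨n, σ⟩ 1) = crossPush p σ (crossKer p n) := by
  simp [sCross]

theorem sBdry_crossPush (p : ℕ) {n : ℕ} (σ : C(Simp n, Y)) (a : Tuples (Fin (p + 1) × Fin n)) :
    sBdry (crossPush p σ a) = crossPush p σ (tBdry a) :=
  bdryOf_chainMap (X := fun m => Fin m → Fin (p + 1) × Fin n)
    (Y := fun m => C(Simp m, Simp (p + 1) × Y))
    (fun _ i w => w ∘ i.succAbove) (fun _ i σ => σ.comp (simpMap i.succAbove))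
    (fun _ w => (simpMap (Prod.fst ∘ w)).prodMk (σ.comp (simpMap (Prod.snd ∘ w))))
    (fun m i w => by
      rw [← Function.comp_assoc, ← Function.comp_assoc, ← simpMap_comp, ← simpMap_comp]
      rfl) a

theorem crossPush_tMap (p : ℕ) {n q : ℕ} (σ : C(Simp n, Y)) (f : Fin (p + 1) → Fin (q + 1))
    (a : Tuples (Fin (p + 1) × Fin n)) :
    crossPush q σ (tMap (Prod.map f id) a)
      = sMap ((simpMap f).prodMap (ContinuousMap.id Y)) (crossPush p σ a) := by
  have : crossPush q σ ∘ₗ tMap (Prod.map f id)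
      = sMap ((simpMap f).prodMap (ContinuousMap.id Y)) ∘ₗ crossPush p σ := by
    refine chains_ext fun m w => ?_
    simp only [LinearMap.comp_apply, crossPush, chainMap_single]
    congr 2
    have : Prod.fst ∘ (Prod.map f id) ∘ w = f ∘ (Prod.fst ∘ w) := rfl
    rw [this, ← simpMap_comp]
    rfl
  exact LinearMap.congr_fun this a

theorem crossPush_tCross (p : ℕ) {n : ℕ} (σ : C(Simp n, Y)) (a : Tuples (Fin n)) :
    crossPush p σ (tCross p a) = sCross p (pushVertices σ a) := by
  have : crossPush p σ ∘ₗ tCross p = sCross p ∘ₗ pushVertices σ := by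
    refine chains_ext fun m w => ?_
    simp only [LinearMap.comp_apply, tCross_single, pushVertices, chainMap_single, sCross_single]
    rw [crossPush, crossPush, chainMap_comp]
    congr 1
    congr 1
    funext l v
    rw [ContinuousMap.comp_assoc, simpMap_comp]
    rfl
  exact LinearMap.congr_fun this a

/-- The product formula for the boundary of the cross product with a simplex. -/
theorem sBdry_sCross (p : ℕ) (a : SChains Y) :
    sBdry (sCross (p + 1) a)
      = ∑ i : Fin (p + 2), (-1 : ℤ) ^ (i : ℕ) •
          sMap ((simpMap i.succAbove).prodMap (ContinuousMap.id Y)) (sCross p a)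
        + (-1 : ℤ) ^ (p + 1) • sCross (p + 1) (sBdry a) := by
  have : sBdry ∘ₗ sCross (Y := Y) (p + 1)
      = ∑ i : Fin (p + 2), (-1 : ℤ) ^ (i : ℕ) •
          (sMap ((simpMap i.succAbove).prodMap (ContinuousMap.id Y)) ∘ₗ sCross p)
        + (-1 : ℤ) ^ (p + 1) • (sCross (p + 1) ∘ₗ sBdry) := by
    refine chains_ext fun n σ => ?_
    have h : (single ⟨n, σ⟩ 1 : SChains Y) = pushVertices σ (single ⟨n, id⟩ 1) := by
      simp [pushVertices, simpMap_id]
    simp only [LinearMap.comp_apply, LinearMap.add_apply, LinearMap.sum_apply,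
      LinearMap.smul_apply, sCross_single]
    rw [sBdry_crossPush, tBdry_crossKer, map_add, map_smul, crossPush_tCross, h,
      ← sBdry_pushVertices, tFaces_apply, map_sum]
    simp only [map_smul, crossPush_tMap]
  simpa [LinearMap.sum_apply] using LinearMap.congr_fun this a

theorem sMap_sCross (p : ℕ) (f : C(X, Y)) (a : SChains X) :
    sMap ((ContinuousMap.id _).prodMap f) (sCross p a) = sCross p (sMap f a) := by
  have : sMap ((ContinuousMap.id _).prodMap f) ∘ₗ sCross p = sCross p ∘ₗ sMap f := by
    refine chains_ext fun n σ => ?_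
    simp only [LinearMap.comp_apply, chainMap_single, sCross_single, crossPush]
    rw [chainMap_comp]
    rfl
  exact LinearMap.congr_fun this a

theorem sCross_mem_SIn (p : ℕ) {A : Set Y} {a : SChains Y} (ha : a ∈ SIn A) :
    sCross p a ∈ SIn (Prod.snd ⁻¹' A : Set (Simp (p + 1) × Y)) := by
  refine SIn_induction (sCross p) _ (fun n σ hσ => ?_) ha
  rw [sCross_single]
  refine mem_supported_induction (s := Set.univ) (crossPush p σ) _ (fun x _ => ?_) (by simp)
  rw [crossPush, chainMap_single]
  exact single_mem_SIn (fun t => hσ (simpMap _ t)) _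

theorem sCross_zero (a : SChains Y) :
    sCross 0 a = sMap ((ContinuousMap.const Y (stdSimplex.vertex (S := ℝ) (0 : Fin 1))).prodMk
      (ContinuousMap.id Y)) a := by
  have : sCross (Y := Y) 0 = sMap ((ContinuousMap.const Y
      (stdSimplex.vertex (S := ℝ) (0 : Fin 1))).prodMk (ContinuousMap.id Y)) := by
    refine chains_ext fun n σ => ?_
    rw [sCross_single, crossKer, crossPush, chainMap_single, chainMap_single]
    congr 2
    ext1 t
    refine Prod.ext (Subsingleton.elim _ _) ?_
    exact congrArg σ (stdSimplex.map_id_apply t)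
  rw [this]

theorem sCross_single_zero (p : ℕ) (σ : C(Simp 0, Y)) : sCross (p + 1) (single ⟨0, σ⟩ 1) = 0 := by
  rw [sCross_single, crossKer, map_zero]

/-- The chain homotopy induced by a homotopy, parametrized by the simplex with two vertices. -/
noncomputable def prismOp (H : C(Simp 2 × X, Y)) : SChains X →ₗ[ℤ] SChains Y :=
  sMap H ∘ₗ sCross 1

/-- The start and end maps of a homotopy. -/
noncomputable def homotopyEnd (H : C(Simp 2 × X, Y)) (i : Fin 2) : C(X, Y) :=
  H.comp ((ContinuousMap.const X (stdSimplex.vertex (S := ℝ) i)).prodMk (ContinuousMap.id X))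

theorem sBdry_prismOp (H : C(Simp 2 × X, Y)) (a : SChains X) :
    sBdry (prismOp H a)
      = sMap (homotopyEnd H 1) a - sMap (homotopyEnd H 0) a - prismOp H (sBdry a) := by
  have key : ∀ i : Fin 2, sMap H (sMap ((simpMap i.succAbove).prodMap (ContinuousMap.id X))
      (sCross 0 a)) = sMap (homotopyEnd H (i.succAbove 0)) a := by
    intro i
    rw [sCross_zero, sMap_sMap, sMap_sMap]
    refine congrArg (fun f : C(X, Y) => sMap f a) (ContinuousMap.ext fun x => ?_)
    change H (stdSimplex.map _ (stdSimplex.vertex 0), x) = H (stdSimplex.vertex _, x)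
    rw [stdSimplex.map_vertex]
  rw [prismOp, LinearMap.comp_apply, LinearMap.comp_apply, sBdry_sMap, sBdry_sCross,
    Fin.sum_univ_two, map_add, map_add, map_smul, map_smul, map_smul, key, key]
  simp only [Fin.val_zero, Fin.val_one, pow_zero, pow_one, one_smul, neg_smul, zero_add,
    Fin.succAbove_zero, Fin.succ_zero_eq_one]
  have : (1 : Fin 2).succAbove 0 = 0 := rfl
  rw [this]
  abel

theorem prismOp_mem_SIn {H : C(Simp 2 × X, Y)} {A : Set X} {B : Set Y}
    (hH : ∀ τ, ∀ x ∈ A, H (τ, x) ∈ B) {a : SChains X} (ha : a ∈ SIn A) : prismOp H a ∈ SIn B :=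
  sMap_mem_SIn (fun x hx => hH x.1 x.2 hx) (sCross_mem_SIn 1 ha)

end Cross

/-! ### Homogeneous chains -/

section Degree

/-- The chains concentrated in one degree, counted by vertices. -/
def homog {X : ℕ → Type*} (n : ℕ) : Submodule ℤ (Chains X) := supported ℤ ℤ {x | x.1 = n}

theorem single_mem_homog {X : ℕ → Type*} (n : ℕ) (x : X n) (c : ℤ) :
    (single ⟨n, x⟩ c : Chains X) ∈ homog n := single_mem_supported ℤ c rfl

theorem homog_induction {X : ℕ → Type*} {M : Type*} [AddCommGroup M] {n : ℕ}
    (f : Chains X →ₗ[ℤ] M) (N : Submodule ℤ M) (h : ∀ x : X n, f (single ⟨n, x⟩ 1) ∈ N)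
    {a : Chains X} (ha : a ∈ homog n) : f a ∈ N := by
  refine mem_supported_induction f N ?_ ha
  rintro ⟨m, x⟩ rfl
  exact h x

theorem chainMap_mem_homog {X : ℕ → Type*} {Y : ℕ → Type*} (f : ∀ n, X n → Y n) {n : ℕ}
    {a : Chains X} (ha : a ∈ homog n) : chainMap f a ∈ homog n :=
  homog_induction (chainMap f) _ (fun x => by
    rw [chainMap_single]; exact single_mem_homog _ _ _) ha

theorem crossKer_mem_homog (p n : ℕ) : crossKer p (n + 1) ∈ homog (p + n + 1) := by
  induction p generalizing n with
  | zero =>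
    rw [crossKer]
    exact (show n + 1 = 0 + n + 1 by omega) ▸ single_mem_homog (n + 1) _ _
  | succ p ihp =>
    have hcone : ∀ {W : Type} (v : W) (m : ℕ) (a : Tuples W), a ∈ homog m →
        cone v a ∈ homog (m + 1) := fun v m a ha =>
      homog_induction (cone v) _ (fun x => by
        rw [cone_single]; exact single_mem_homog _ _ _) ha
    induction n with
    | zero =>
      rw [crossKer]
      refine hcone _ _ _ (add_mem (sum_mem fun i _ => Submodule.smul_mem _ _
        (chainMap_mem_homog _ (ihp 0))) (Submodule.smul_mem _ _ (sum_mem fun j _ =>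
          Submodule.smul_mem _ _ ?_)))
      rw [crossKer, map_zero]
      exact zero_mem _
    | succ n ihn =>
      rw [crossKer]
      refine hcone _ _ _ (add_mem (sum_mem fun i _ => Submodule.smul_mem _ _
        (chainMap_mem_homog _ ?_)) (Submodule.smul_mem _ _ (sum_mem fun j _ =>
          Submodule.smul_mem _ _ (chainMap_mem_homog _ ?_))))
      · have := ihp (n + 1); rwa [show p + (n + 1) + 1 = p + 1 + (n + 1) by omega] at this
      · exact ihn

theorem sCross_mem_homog {Y : Type*} [TopologicalSpace Y] (p n : ℕ) {a : SChains Y}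
    (ha : a ∈ homog (n + 1)) : sCross p a ∈ homog (p + n + 1) :=
  homog_induction (sCross p) _ (fun x => by
    rw [sCross_single]
    exact chainMap_mem_homog _ (crossKer_mem_homog p n)) ha

end Degree

end Prismatic

namespace Prismatic

open Finsupp

/-! ### Barycentric subdivision -/

section TupleSubdivision

variable {W W' : Type*}

/-- The barycentric subdivision of a tuple, with respect to a choice `b` of barycenters. -/
noncomputable def sdGen (b : ∀ m, (Fin (m + 1) → W) → W) : (m : ℕ) → (Fin m → W) → Tuples W
  | 0, w => single ⟨0, w⟩ 1
  | m + 1, w => cone (b m w)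
      (∑ i : Fin (m + 1), (-1 : ℤ) ^ (i : ℕ) • sdGen b m (w ∘ i.succAbove))

/-- Barycentric subdivision of tuple chains. -/
noncomputable def tSd (b : ∀ m, (Fin (m + 1) → W) → W) : Tuples W →ₗ[ℤ] Tuples W :=
  linearCombination ℤ fun x => sdGen b x.1 x.2

/-- The value on a tuple of the chain homotopy from the identity to the subdivision. -/
noncomputable def sdHGen (b : ∀ m, (Fin (m + 1) → W) → W) : (m : ℕ) → (Fin m → W) → Tuples W
  | 0, _ => 0
  | m + 1, w => cone (b m w) (single ⟨m + 1, w⟩ 1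
      - ∑ i : Fin (m + 1), (-1 : ℤ) ^ (i : ℕ) • sdHGen b m (w ∘ i.succAbove))

/-- The chain homotopy from the identity to barycentric subdivision. -/
noncomputable def tSdH (b : ∀ m, (Fin (m + 1) → W) → W) : Tuples W →ₗ[ℤ] Tuples W :=
  linearCombination ℤ fun x => sdHGen b x.1 x.2

variable (b : ∀ m, (Fin (m + 1) → W) → W)

theorem tSd_single (m : ℕ) (w : Fin m → W) : tSd b (single ⟨m, w⟩ 1) = sdGen b m w := by
  simp [tSd]

theorem tSdH_single (m : ℕ) (w : Fin m → W) : tSdH b (single ⟨m, w⟩ 1) = sdHGen b m w := by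
  simp [tSdH]

theorem tSd_single_succ (m : ℕ) (w : Fin (m + 1) → W) :
    tSd b (single ⟨m + 1, w⟩ 1) = cone (b m w) (tSd b (tBdry (single ⟨m + 1, w⟩ 1))) := by
  rw [tSd_single, sdGen, bdryOf_single_succ, map_sum (tSd b)]
  simp only [map_smul, tSd_single]

theorem tSdH_single_succ (m : ℕ) (w : Fin (m + 1) → W) :
    tSdH b (single ⟨m + 1, w⟩ 1)
      = cone (b m w) (single ⟨m + 1, w⟩ 1 - tSdH b (tBdry (single ⟨m + 1, w⟩ 1))) := by
  rw [tSdH_single, sdHGen, bdryOf_single_succ, map_sum (tSdH b)]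
  simp only [map_smul, tSdH_single]

theorem tBdry_tSd (a : Tuples W) : tBdry (tSd b a) = tSd b (tBdry a) := by
  have : tBdry ∘ₗ tSd b = tSd b ∘ₗ tBdry := by
    refine chains_ext fun n w => ?_
    induction n with
    | zero => simp [tSd_single, sdGen, bdryOf_single_zero]
    | succ n ih =>
      have key : tBdry (single ⟨n + 1, w⟩ 1 : Tuples W) ∈ LinearMap.eqLocus
          (tBdry ∘ₗ tSd b) (tSd b ∘ₗ tBdry) := by
        rw [bdryOf_single_succ]
        exact sum_mem fun i _ => Submodule.smul_mem _ _ (ih _)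
      have key' := LinearMap.mem_eqLocus.1 key
      simp only [LinearMap.comp_apply] at key' ⊢
      rw [tSd_single_succ, tBdry_cone, key', tBdry_tBdry, map_zero, map_zero, sub_zero]
  exact LinearMap.congr_fun this a

theorem tBdry_tSdH (a : Tuples W) : tBdry (tSdH b a) = a - tSd b a - tSdH b (tBdry a) := by
  have : tBdry ∘ₗ tSdH b = LinearMap.id - tSd b - tSdH b ∘ₗ tBdry := by
    refine chains_ext fun n w => ?_
    induction n with
    | zero => simp [tSd_single, tSdH_single, sdGen, sdHGen, bdryOf_single_zero]
    | succ n ih =>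
      have key : tBdry (single ⟨n + 1, w⟩ 1 : Tuples W) ∈ LinearMap.eqLocus
          (tBdry ∘ₗ tSdH b) (LinearMap.id - tSd b - tSdH b ∘ₗ tBdry) := by
        rw [bdryOf_single_succ]
        exact sum_mem fun i _ => Submodule.smul_mem _ _ (ih _)
      have key' := LinearMap.mem_eqLocus.1 key
      simp only [LinearMap.comp_apply, LinearMap.sub_apply, LinearMap.id_apply] at key' ⊢
      rw [tSdH_single_succ, tBdry_cone, map_sub, key', tBdry_tBdry, map_zero, sub_zero,
        sub_sub_cancel, tSd_single_succ]
      abel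
  exact LinearMap.congr_fun this a

variable {b} {b' : ∀ m, (Fin (m + 1) → W') → W'}

theorem tMap_tSd {f : W → W'} (hf : ∀ m w, f (b m w) = b' m (f ∘ w)) (a : Tuples W) :
    tMap f (tSd b a) = tSd b' (tMap f a) := by
  have : tMap f ∘ₗ tSd b = tSd b' ∘ₗ tMap f := by
    refine chains_ext fun n w => ?_
    simp only [LinearMap.comp_apply, chainMap_single, tSd_single]
    induction n with
    | zero => rw [sdGen, sdGen, chainMap_single]
    | succ n ih =>
      rw [sdGen, sdGen, tMap_cone, hf, map_sum]
      simp only [map_smul, ih]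
      rfl
  exact LinearMap.congr_fun this a

theorem tMap_tSdH {f : W → W'} (hf : ∀ m w, f (b m w) = b' m (f ∘ w)) (a : Tuples W) :
    tMap f (tSdH b a) = tSdH b' (tMap f a) := by
  have : tMap f ∘ₗ tSdH b = tSdH b' ∘ₗ tMap f := by
    refine chains_ext fun n w => ?_
    simp only [LinearMap.comp_apply, chainMap_single, tSdH_single]
    induction n with
    | zero => rw [sdHGen, sdHGen, map_zero]
    | succ n ih =>
      rw [sdHGen, sdHGen, tMap_cone, hf, map_sub, map_sum, chainMap_single]
      simp only [map_smul, ih]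
      rfl
  exact LinearMap.congr_fun this a

end TupleSubdivision

section AffineSimplices

/-- The affine simplex in a standard simplex with given vertices. -/
noncomputable def affSimp {m N : ℕ} (w : Fin m → Simp N) : C(Simp m, Simp N) where
  toFun t := ⟨fun j => ∑ i, t i * w i j, fun j => Finset.sum_nonneg fun i _ =>
      mul_nonneg (t.2.1 i) ((w i).2.1 j), by
    rw [Finset.sum_comm]
    simp only [← Finset.mul_sum]
    have : ∀ i, ∑ j, w i j = 1 := fun i => (w i).2.2
    simp only [this, mul_one]
    exact t.2.2⟩
  continuous_toFun := by
    refine Continuous.subtype_mk (continuous_pi fun j => continuous_finsetSum _ fun i _ => ?_) _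
    exact ((continuous_apply i).comp continuous_subtype_val).mul continuous_const

theorem affSimp_apply {m N : ℕ} (w : Fin m → Simp N) (t : Simp m) (j : Fin N) :
    affSimp w t j = ∑ i, t i * w i j := rfl

theorem affSimp_vertex {m N : ℕ} (w : Fin m → Simp N) (i : Fin m) :
    affSimp w (stdSimplex.vertex i) = w i := by
  ext j
  rw [affSimp_apply]
  simp [Pi.single_apply]

theorem affSimp_affSimp {l m N : ℕ} (v : Fin m → Simp N) (w : Fin l → Simp m) (t : Simp l) :
    affSimp v (affSimp w t) = affSimp (affSimp v ∘ w) t := by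
  ext j
  simp only [affSimp_apply, Function.comp_apply, Finset.sum_mul, Finset.mul_sum]
  rw [Finset.sum_comm]
  simp only [mul_assoc]

theorem affSimp_vertices (N : ℕ) (t : Simp N) : affSimp (fun i => stdSimplex.vertex i) t = t := by
  ext j
  rw [affSimp_apply]
  simp [Pi.single_apply]

theorem simpMap_eq_affSimp {m N : ℕ} (f : Fin m → Fin N) :
    simpMap f = affSimp (fun i => stdSimplex.vertex (f i)) := by
  ext t j
  change FunOnFinite.linearMap ℝ ℝ f t j = affSimp _ t j
  rw [FunOnFinite.linearMap_apply_apply, affSimp_apply]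
  simp only [stdSimplex.vertex_coe, Pi.single_apply, mul_ite, mul_one, mul_zero,
    Finset.sum_filter, eq_comm]

theorem affSimp_comp_simpMap {l m N : ℕ} (w : Fin m → Simp N) (f : Fin l → Fin m) :
    (affSimp w).comp (simpMap f) = affSimp (w ∘ f) := by
  ext1 t
  rw [simpMap_eq_affSimp, ContinuousMap.comp_apply, affSimp_affSimp]
  congr 2
  funext i
  exact affSimp_vertex w (f i)

/-- The barycenter of a tuple of points of a simplex. -/
noncomputable def bary (N m : ℕ) (w : Fin (m + 1) → Simp N) : Simp N :=
  affSimp w stdSimplex.barycenter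

theorem affSimp_bary {N M : ℕ} (v : Fin N → Simp M) (m : ℕ) (w : Fin (m + 1) → Simp N) :
    affSimp v (bary N m w) = bary M m (affSimp v ∘ w) :=
  affSimp_affSimp v w _

theorem dist_simp_le_iff {N : ℕ} {p q : Simp N} {r : ℝ} (hr : 0 ≤ r) :
    dist p q ≤ r ↔ ∀ j, |p j - q j| ≤ r := by
  rw [Subtype.dist_eq, dist_pi_le_iff hr]
  rfl

theorem dist_affSimp_le {m N : ℕ} {p : Simp N} {w : Fin m → Simp N} {r : ℝ} (hr : 0 ≤ r)
    (h : ∀ i, dist p (w i) ≤ r) (t : Simp m) : dist p (affSimp w t) ≤ r := by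
  rw [dist_simp_le_iff hr]
  intro j
  have ht : ∑ i, t i = 1 := t.2.2
  have : p j - affSimp w t j = ∑ i, t i * (p j - w i j) := by
    simp only [mul_sub, Finset.sum_sub_distrib, ← Finset.sum_mul, ht, one_mul, affSimp_apply]
  rw [this]
  calc |∑ i, t i * (p j - w i j)| ≤ ∑ i, |t i * (p j - w i j)| := Finset.abs_sum_le_sum_abs _ _
    _ ≤ ∑ i, t i * r := Finset.sum_le_sum fun i _ => by
        rw [abs_mul, abs_of_nonneg (show 0 ≤ t i from t.2.1 i)]
        exact mul_le_mul_of_nonneg_left ((dist_simp_le_iff hr).1 (h i) j) (t.2.1 i)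
    _ = r := by rw [← Finset.sum_mul, ht, one_mul]

/-- The distance from the barycenter to a vertex is at most `m / (m + 1)` times the diameter. -/
theorem dist_bary_le {m N : ℕ} {w : Fin (m + 1) → Simp N} {r : ℝ} (hr : 0 ≤ r)
    (h : ∀ i j, dist (w i) (w j) ≤ r) (k : Fin (m + 1)) :
    dist (bary N m w) (w k) ≤ m / (m + 1) * r := by
  rw [dist_simp_le_iff (by positivity)]
  intro j
  have hm : (0 : ℝ) < m + 1 := by positivity
  have h₀ : bary N m w j = ∑ i, ((m : ℝ) + 1)⁻¹ * w i j := by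
    rw [bary, affSimp_apply]
    refine Finset.sum_congr rfl fun i _ => ?_
    congr 1
    change (stdSimplex.barycenter (𝕜 := ℝ) (X := Fin (m + 1))).val i = _
    rw [stdSimplex.barycenter_apply, Fintype.card_fin]
    push_cast
    rfl
  have h₁ : bary N m w j - w k j = ((m : ℝ) + 1)⁻¹ * ∑ i, (w i j - w k j) := by
    rw [h₀, ← Finset.mul_sum, Finset.sum_sub_distrib, mul_sub]
    simp only [Finset.sum_const, Finset.card_univ, Fintype.card_fin, nsmul_eq_mul]
    push_cast
    rw [inv_mul_cancel_left₀ hm.ne']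
  have h₂ : |∑ i, (w i j - w k j)| ≤ m * r := by
    rw [← Finset.add_sum_erase _ _ (Finset.mem_univ k), sub_self, zero_add]
    refine (Finset.abs_sum_le_sum_abs _ _).trans
      ((Finset.sum_le_card_nsmul _ _ r fun i _ => (dist_simp_le_iff hr).1 (h i k) j).trans ?_)
    rw [Finset.card_erase_of_mem (Finset.mem_univ k), Finset.card_univ, Fintype.card_fin,
      nsmul_eq_mul, Nat.add_sub_cancel]
  rw [h₁, abs_mul, abs_of_pos (inv_pos.2 hm), div_eq_inv_mul, mul_assoc]
  exact mul_le_mul_of_nonneg_left h₂ (inv_pos.2 hm).le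

theorem div_add_one_mono {m n : ℝ} (hm : 0 ≤ m) (h : m ≤ n) : m / (m + 1) ≤ n / (n + 1) := by
  rw [div_le_div_iff₀ (by linarith) (by linarith)]
  nlinarith

/-- The tuples in the subdivision of a tuple of diameter `r` stay in its hull, and their diameter
is smaller by the usual factor. -/
theorem sdGen_mem_supported {N : ℕ} {r : ℝ} (hr : 0 ≤ r) (m : ℕ) (w : Fin m → Simp N)
    (h : ∀ i j, dist (w i) (w j) ≤ r) :
    sdGen (bary N) m w ∈ supported ℤ ℤ {x : Σ n, Fin n → Simp N | x.1 = m ∧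
      (∀ i j, dist (x.2 i) (x.2 j) ≤ (m - 1) / m * r) ∧
      ∀ (p : Simp N) (R : ℝ), 0 ≤ R → (∀ i, dist p (w i) ≤ R) → ∀ i, dist p (x.2 i) ≤ R} := by
  induction m with
  | zero =>
    rw [sdGen]
    exact single_mem_supported ℤ _ ⟨rfl, fun i => i.elim0, fun _ _ _ _ i => i.elim0⟩
  | succ m ih =>
    rw [sdGen, map_sum]
    refine sum_mem fun k _ => ?_
    rw [map_smul]
    refine Submodule.smul_mem _ _ ?_
    refine mem_supported_induction (cone (bary N m w)) _ ?_
      (ih (w ∘ k.succAbove) fun i j => h _ _)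
    rintro ⟨n, x⟩ ⟨rfl, hx₁, hx₂⟩
    rw [cone_single]
    have hb := dist_bary_le hr h
    have hpos : (0 : ℝ) ≤ n / (n + 1) * r := by positivity
    refine single_mem_supported ℤ _ ⟨rfl, ?_, ?_⟩
    · push_cast
      rw [add_sub_cancel_right]
      have hbx : ∀ i, dist (bary N n w) (x i) ≤ n / (n + 1) * r :=
        hx₂ _ _ hpos fun i => hb _
      intro i j
      refine Fin.cases ?_ (fun i => ?_) i <;> refine Fin.cases ?_ (fun j => ?_) j
      · simpa using hpos
      · simpa using hbx j
      · simpa [dist_comm] using hbx i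
      · simp only [Fin.cons_succ]
        refine (hx₁ i j).trans (mul_le_mul_of_nonneg_right ?_ hr)
        have hn : (1 : ℝ) ≤ n := by exact_mod_cast i.pos
        have := div_add_one_mono (m := (n : ℝ) - 1) (n := n) (by linarith) (by linarith)
        rwa [sub_add_cancel] at this
    · intro p R hR hp i
      refine Fin.cases ?_ (fun i => ?_) i
      · exact dist_affSimp_le hR hp _
      · exact hx₂ p R hR (fun i => hp _) i

/-- The tuples with at most `n + 1` entries and diameter at most `r`. -/
def thinTuples (N n : ℕ) (r : ℝ) : Set (Σ n, Fin n → Simp N) :=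
  {x | x.1 ≤ n + 1 ∧ ∀ i j, dist (x.2 i) (x.2 j) ≤ r}

theorem tSd_mem_thinTuples {N n : ℕ} {r : ℝ} (hr : 0 ≤ r) {a : Tuples (Simp N)}
    (ha : a ∈ supported ℤ ℤ (thinTuples N n r)) :
    tSd (bary N) a ∈ supported ℤ ℤ (thinTuples N n (n / (n + 1) * r)) := by
  refine mem_supported_induction _ _ ?_ ha
  rintro ⟨m, w⟩ ⟨hm, hw⟩
  rw [tSd_single]
  refine supported_mono ?_ (sdGen_mem_supported hr m w hw)
  rintro ⟨l, x⟩ ⟨rfl, hx, -⟩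
  refine ⟨hm, fun i j => (hx i j).trans (mul_le_mul_of_nonneg_right ?_ hr)⟩
  have hl : (1 : ℝ) ≤ l := by exact_mod_cast i.pos
  have hm' : (l : ℝ) ≤ n + 1 := by exact_mod_cast hm
  have := div_add_one_mono (m := (l : ℝ) - 1) (n := n) (by linarith) (by linarith)
  rwa [sub_add_cancel] at this

theorem tSd_pow_mem_thinTuples {N n : ℕ} {a : Tuples (Simp N)}
    (ha : a ∈ supported ℤ ℤ (thinTuples N n 1)) (k : ℕ) :
    (tSd (bary N) ^ k) a ∈ supported ℤ ℤ (thinTuples N n ((n / (n + 1) : ℝ) ^ k)) := by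
  induction k with
  | zero => simpa using ha
  | succ k ih =>
    rw [pow_succ', pow_succ', Module.End.mul_apply]
    exact tSd_mem_thinTuples (by positivity) ih

end AffineSimplices

section SingularSubdivision

variable {X Y : Type*} [TopologicalSpace X] [TopologicalSpace Y]

/-- The singular chains given by affine simplices in the domain of a singular simplex. -/
noncomputable def pushPoints {N : ℕ} (σ : C(Simp N, X)) : Tuples (Simp N) →ₗ[ℤ] SChains X :=
  chainMap fun _ w => σ.comp (affSimp w)

theorem single_eq_pushPoints {N : ℕ} (σ : C(Simp N, X)) :
    (single ⟨N, σ⟩ 1 : SChains X) = pushPoints σ (single ⟨N, fun i => stdSimplex.vertex i⟩ 1) := by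
  rw [pushPoints, chainMap_single]
  congr 2
  ext1 t
  exact congrArg σ (affSimp_vertices N t).symm

theorem sBdry_pushPoints {N : ℕ} (σ : C(Simp N, X)) (a : Tuples (Simp N)) :
    sBdry (pushPoints σ a) = pushPoints σ (tBdry a) :=
  bdryOf_chainMap (X := fun m => Fin m → Simp N) (Y := fun m => C(Simp m, X))
    (fun _ i w => w ∘ i.succAbove) (fun _ i σ => σ.comp (simpMap i.succAbove))
    (fun _ w => σ.comp (affSimp w))
    (fun m i w => by rw [ContinuousMap.comp_assoc, affSimp_comp_simpMap]) a

theorem pushPoints_mem_SIn {N : ℕ} {σ : C(Simp N, X)} {A : Set X} (h : ∀ t, σ t ∈ A)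
    (a : Tuples (Simp N)) : pushPoints σ a ∈ SIn A := by
  refine mem_supported_induction (s := Set.univ) (pushPoints σ) _ (fun x _ => ?_) (by simp)
  rw [pushPoints, chainMap_single]
  exact single_mem_SIn (fun t => h (affSimp _ t)) _

theorem pushPoints_tMap {N M : ℕ} (σ : C(Simp M, X)) (v : Fin N → Simp M) (a : Tuples (Simp N)) :
    pushPoints σ (tMap (affSimp v) a) = pushPoints (σ.comp (affSimp v)) a := by
  rw [pushPoints, pushPoints, chainMap_comp]
  congr 2
  funext m w
  ext1 t
  exact congrArg σ (affSimp_affSimp v w t).symm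

/-- Barycentric subdivision of singular chains. -/
noncomputable def sSd : SChains X →ₗ[ℤ] SChains X :=
  linearCombination ℤ fun x =>
    pushPoints x.2 (tSd (bary x.1) (single ⟨x.1, fun i => stdSimplex.vertex i⟩ 1))

/-- The chain homotopy from the identity to barycentric subdivision of singular chains. -/
noncomputable def sSdH : SChains X →ₗ[ℤ] SChains X :=
  linearCombination ℤ fun x =>
    pushPoints x.2 (tSdH (bary x.1) (single ⟨x.1, fun i => stdSimplex.vertex i⟩ 1))

theorem sSd_single {N : ℕ} (σ : C(Simp N, X)) : sSd (single ⟨N, σ⟩ 1)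
    = pushPoints σ (tSd (bary N) (single ⟨N, fun i => stdSimplex.vertex i⟩ 1)) := by
  simp [sSd]

theorem sSdH_single {N : ℕ} (σ : C(Simp N, X)) : sSdH (single ⟨N, σ⟩ 1)
    = pushPoints σ (tSdH (bary N) (single ⟨N, fun i => stdSimplex.vertex i⟩ 1)) := by
  simp [sSdH]

theorem tMap_affSimp_vertices {N m : ℕ} (w : Fin m → Simp N) :
    tMap (affSimp w) (single ⟨m, fun i => stdSimplex.vertex i⟩ 1) = single ⟨m, w⟩ 1 := by
  rw [chainMap_single]
  congr 2
  funext i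
  exact affSimp_vertex w i

theorem sSd_pushPoints {N : ℕ} (σ : C(Simp N, X)) (a : Tuples (Simp N)) :
    sSd (pushPoints σ a) = pushPoints σ (tSd (bary N) a) := by
  have : sSd ∘ₗ pushPoints σ = pushPoints σ ∘ₗ tSd (bary N) := by
    refine chains_ext fun m w => ?_
    simp only [LinearMap.comp_apply]
    rw [pushPoints, chainMap_single, sSd_single, ← pushPoints, ← pushPoints_tMap,
      tMap_tSd (affSimp_bary w), tMap_affSimp_vertices]
  exact LinearMap.congr_fun this a

theorem sSdH_pushPoints {N : ℕ} (σ : C(Simp N, X)) (a : Tuples (Simp N)) :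
    sSdH (pushPoints σ a) = pushPoints σ (tSdH (bary N) a) := by
  have : sSdH ∘ₗ pushPoints σ = pushPoints σ ∘ₗ tSdH (bary N) := by
    refine chains_ext fun m w => ?_
    simp only [LinearMap.comp_apply]
    rw [pushPoints, chainMap_single, sSdH_single, ← pushPoints, ← pushPoints_tMap,
      tMap_tSdH (affSimp_bary w), tMap_affSimp_vertices]
  exact LinearMap.congr_fun this a

theorem sBdry_sSd (a : SChains X) : sBdry (sSd a) = sSd (sBdry a) := by
  have : (sBdry : SChains X →ₗ[ℤ] SChains X) ∘ₗ sSd = sSd ∘ₗ sBdry := by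
    refine chains_ext fun n σ => ?_
    simp only [LinearMap.comp_apply]
    rw [single_eq_pushPoints, sSd_pushPoints, sBdry_pushPoints, sBdry_pushPoints, sSd_pushPoints,
      tBdry_tSd]
  exact LinearMap.congr_fun this a

theorem sBdry_sSdH (a : SChains X) : sBdry (sSdH a) = a - sSd a - sSdH (sBdry a) := by
  have : (sBdry : SChains X →ₗ[ℤ] SChains X) ∘ₗ sSdH
      = LinearMap.id - sSd - sSdH ∘ₗ sBdry := by
    refine chains_ext fun n σ => ?_
    simp only [LinearMap.comp_apply, LinearMap.sub_apply, LinearMap.id_apply]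
    rw [single_eq_pushPoints, sSdH_pushPoints, sBdry_pushPoints, sBdry_pushPoints,
      sSdH_pushPoints, sSd_pushPoints, tBdry_tSdH, map_sub, map_sub]
  exact LinearMap.congr_fun this a

theorem sSd_mem_SIn {A : Set X} {a : SChains X} (ha : a ∈ SIn A) : sSd a ∈ SIn A :=
  SIn_induction sSd _ (fun _ σ hσ => by rw [sSd_single]; exact pushPoints_mem_SIn hσ _) ha

theorem sSdH_mem_SIn {A : Set X} {a : SChains X} (ha : a ∈ SIn A) : sSdH a ∈ SIn A :=
  SIn_induction sSdH _ (fun _ σ hσ => by rw [sSdH_single]; exact pushPoints_mem_SIn hσ _) ha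

theorem sMap_sSd (f : C(X, Y)) (a : SChains X) : sMap f (sSd a) = sSd (sMap f a) := by
  have : sMap f ∘ₗ sSd = sSd ∘ₗ sMap f := by
    refine chains_ext fun n σ => ?_
    simp only [LinearMap.comp_apply]
    rw [chainMap_single, sSd_single, sSd_single, pushPoints, chainMap_comp]
    rfl
  exact LinearMap.congr_fun this a

/-- The chain homotopy from the identity to the iterated subdivision. -/
noncomputable def sSdHIter : ℕ → SChains X →ₗ[ℤ] SChains X
  | 0 => 0
  | k + 1 => sSdHIter k + sSdH ∘ₗ (sSd ^ k)

theorem sBdry_sSd_pow (k : ℕ) (a : SChains X) : sBdry ((sSd ^ k) a) = (sSd ^ k) (sBdry a) := by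
  induction k with
  | zero => simp
  | succ k ih => rw [pow_succ', Module.End.mul_apply, Module.End.mul_apply, sBdry_sSd, ih]

theorem sSd_pow_mem_SIn {A : Set X} {a : SChains X} (ha : a ∈ SIn A) (k : ℕ) :
    (sSd ^ k) a ∈ SIn A := by
  induction k with
  | zero => simpa
  | succ k ih => rw [pow_succ', Module.End.mul_apply]; exact sSd_mem_SIn ih

theorem sMap_sSd_pow (f : C(X, Y)) (k : ℕ) (a : SChains X) :
    sMap f ((sSd ^ k) a) = (sSd ^ k) (sMap f a) := by
  induction k with
  | zero => simp
  | succ k ih => rw [pow_succ', pow_succ', Module.End.mul_apply, Module.End.mul_apply, sMap_sSd, ih]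

theorem sBdry_sSdHIter (k : ℕ) (a : SChains X) :
    sBdry (sSdHIter k a) = a - (sSd ^ k) a - sSdHIter k (sBdry a) := by
  induction k with
  | zero => simp [sSdHIter]
  | succ k ih =>
    simp only [sSdHIter, LinearMap.add_apply, LinearMap.comp_apply, map_add]
    rw [ih, sBdry_sSdH, sBdry_sSd_pow, pow_succ', Module.End.mul_apply]
    abel

theorem sSdHIter_mem_SIn {A : Set X} {a : SChains X} (ha : a ∈ SIn A) (k : ℕ) :
    sSdHIter k a ∈ SIn A := by
  induction k with
  | zero => simp [sSdHIter]
  | succ k ih => exact add_mem ih (sSdH_mem_SIn (sSd_pow_mem_SIn ha k))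

theorem sSd_pow_pushPoints (k : ℕ) {N : ℕ} (σ : C(Simp N, X)) (a : Tuples (Simp N)) :
    (sSd ^ k) (pushPoints σ a) = pushPoints σ ((tSd (bary N) ^ k) a) := by
  induction k with
  | zero => simp
  | succ k ih =>
    rw [pow_succ', pow_succ', Module.End.mul_apply, Module.End.mul_apply, ih, sSd_pushPoints]

/-- The theorem on small chains: after sufficiently many subdivisions, every simplex of a chain
lies in one of the two members of an open cover. -/
theorem eventually_sSd_pow_mem {U V : Set X} (hU : IsOpen U) (hV : IsOpen V)
    (hUV : U ∪ V = Set.univ) (a : SChains X) :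
    ∀ᶠ k in Filter.atTop, (sSd ^ k) a ∈ SIn U ⊔ SIn V := by
  induction a using Finsupp.induction_linear with
  | zero => simp
  | add a b ha hb =>
    filter_upwards [ha, hb] with k h₁ h₂
    rw [map_add]
    exact add_mem h₁ h₂
  | single x c =>
    obtain ⟨N, σ⟩ := x
    suffices ∀ᶠ k in Filter.atTop, (sSd ^ k) (single ⟨N, σ⟩ 1) ∈ SIn U ⊔ SIn V by
      filter_upwards [this] with k hk
      rw [show (single ⟨N, σ⟩ c : SChains X) = c • single ⟨N, σ⟩ 1 by simp, map_smul]
      exact Submodule.smul_mem _ _ hk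
    have hcov : (Set.univ : Set (Simp N)) ⊆ ⋃ i : Bool, σ ⁻¹' (cond i U V) := by
      intro t _
      have : σ t ∈ U ∪ V := hUV ▸ Set.mem_univ _
      rcases this with h | h
      · exact Set.mem_iUnion.2 ⟨true, h⟩
      · exact Set.mem_iUnion.2 ⟨false, h⟩
    have hop : ∀ i : Bool, IsOpen (σ ⁻¹' (cond i U V)) := by
      rintro (_ | _)
      · exact hV.preimage σ.continuous
      · exact hU.preimage σ.continuous
    obtain ⟨ε, hε, hleb⟩ := lebesgue_number_lemma_of_metric isCompact_univ hop hcov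
    have hθ : (N / (N + 1) : ℝ) < 1 := by
      rw [div_lt_one (by positivity)]; linarith
    have htend := tendsto_pow_atTop_nhds_zero_of_lt_one (by positivity) hθ
    filter_upwards [htend.eventually (gt_mem_nhds hε)] with k hk
    rw [single_eq_pushPoints, sSd_pow_pushPoints]
    have hstart : (single ⟨N, fun i => stdSimplex.vertex i⟩ 1 : Tuples (Simp N))
        ∈ supported ℤ ℤ (thinTuples N N 1) := by
      refine single_mem_supported ℤ _ ⟨Nat.le_succ _, fun i j => ?_⟩
      rw [dist_simp_le_iff zero_le_one]
      intro c
      have h₁ := (stdSimplex.vertex (S := ℝ) i).2.1 c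
      have h₂ := (stdSimplex.vertex (S := ℝ) j).2.1 c
      have h₃ := stdSimplex.le_one (stdSimplex.vertex (S := ℝ) i) c
      have h₄ := stdSimplex.le_one (stdSimplex.vertex (S := ℝ) j) c
      rw [abs_le]
      exact ⟨by change _ ≤ (stdSimplex.vertex (S := ℝ) i).1 c - (stdSimplex.vertex (S := ℝ) j).1 c
                change (stdSimplex.vertex (S := ℝ) j).1 c ≤ 1 at h₄
                linarith,
        by change (stdSimplex.vertex (S := ℝ) i).1 c - (stdSimplex.vertex (S := ℝ) j).1 c ≤ _
           change (stdSimplex.vertex (S := ℝ) i).1 c ≤ 1 at h₃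
           linarith⟩
    refine mem_supported_induction (pushPoints σ) _ ?_ (tSd_pow_mem_thinTuples hstart k)
    rintro ⟨m, w⟩ ⟨-, hw⟩
    rw [pushPoints, chainMap_single]
    have hmem : ∃ i : Bool, ∀ t, σ (affSimp w t) ∈ cond i U V := by
      rcases isEmpty_or_nonempty (Simp m) with hm | ⟨⟨t₀⟩⟩
      · exact ⟨true, fun t => isEmptyElim t⟩
      · obtain ⟨i, hi⟩ := hleb (affSimp w t₀) (Set.mem_univ _)
        refine ⟨i, fun t => hi ?_⟩
        rw [Metric.mem_ball]
        refine lt_of_le_of_lt ?_ hk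
        refine dist_comm (affSimp w t₀) _ ▸ dist_affSimp_le (by positivity) (fun j => ?_) t
        rw [dist_comm]
        exact dist_affSimp_le (by positivity) (fun l => hw j l) t₀
    obtain ⟨i, hi⟩ := hmem
    cases i with
    | false => exact Submodule.mem_sup_right (single_mem_SIn hi _)
    | true => exact Submodule.mem_sup_left (single_mem_SIn hi _)

end SingularSubdivision

end Prismatic

namespace Prismatic

open Finsupp Topology

/-! ### Attaching cells -/

section Attach

variable {X P : Type*} [TopologicalSpace X] [TopologicalSpace P]

/-- The space `X` is obtained from its closed subset `A` by attaching `P` along its subset `B`,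
and `B` has a collar in `P`: a neighbourhood `W` that can be pushed into `B` by a homotopy of `P`
fixing `B`. The parameter of the homotopy lies in the simplex with two vertices. -/
structure Attachment (Φ : C(P, X)) (A : Set X) (B : Set P) where
  isClosed : IsClosed A
  isQuotientMap : IsQuotientMap (Sum.elim (Subtype.val : A → X) Φ)
  mem_iff : ∀ p, Φ p ∈ A ↔ p ∈ B
  inj : ∀ p p', p ∉ B → p' ∉ B → Φ p = Φ p' → p = p'
  /-- the homotopy pushing the collar into `B` -/
  push : C(Simp 2 × P, P)
  /-- the collar -/
  W : Set P
  isOpen_W : IsOpen W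
  subset_W : B ⊆ W
  push_zero : ∀ p, push (stdSimplex.vertex 0, p) = p
  push_fixed : ∀ τ, ∀ p ∈ B, push (τ, p) = p
  push_one : ∀ p ∈ W, push (stdSimplex.vertex 1, p) ∈ B

namespace Attachment

variable {Φ : C(P, X)} {A : Set X} {B : Set P} (h : Attachment Φ A B)
include h

theorem isClosed_B : IsClosed B := by
  have : B = Φ ⁻¹' A := Set.ext fun p => (h.mem_iff p).symm
  rw [this]
  exact h.isClosed.preimage Φ.continuous

/-- The complement of `B`, as a map to `X`; it is a homeomorphism onto the complement of `A`. -/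
def openCell (_ : Attachment Φ A B) : C((Bᶜ : Set P), X) :=
  Φ.comp ⟨Subtype.val, continuous_subtype_val⟩

theorem isOpenEmbedding_openCell : IsOpenEmbedding h.openCell := by
  refine IsOpenEmbedding.of_continuous_injective_isOpenMap h.openCell.continuous ?_ ?_
  · rintro ⟨p, hp⟩ ⟨p', hp'⟩ hpp
    exact Subtype.ext (h.inj p p' hp hp' hpp)
  · intro O hO
    have hO' : IsOpen (Subtype.val '' O : Set P) :=
      h.isClosed_B.isOpen_compl.isOpenMap_subtype_val O hO
    rw [← h.isQuotientMap.isOpen_preimage]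
    have : Sum.elim (Subtype.val : A → X) Φ ⁻¹' (h.openCell '' O)
        = Sum.inr '' (Subtype.val '' O : Set P) := by
      ext y
      constructor
      · rintro ⟨⟨p, hp⟩, hpO, hy⟩
        rcases y with a | p'
        · exact absurd ((h.mem_iff p).1 (by change Φ p = a at hy; rw [hy]; exact a.2)) hp
        · change Φ p = Φ p' at hy
          have hp' : p' ∉ B := fun hB => hp ((h.mem_iff p).1 (hy ▸ (h.mem_iff p').2 hB))
          exact ⟨p', ⟨⟨p, hp⟩, hpO, h.inj p p' hp hp' hy⟩, rfl⟩
      · rintro ⟨p, ⟨q, hq, rfl⟩, rfl⟩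
        exact ⟨q, hq, rfl⟩
    rw [this]
    exact isOpenMap_inr _ hO'

theorem compl_subset_range : Aᶜ ⊆ Set.range h.openCell := by
  intro x hx
  obtain ⟨y, rfl⟩ := h.isQuotientMap.surjective x
  rcases y with a | p
  · exact absurd a.2 hx
  · exact ⟨⟨p, fun hp => hx ((h.mem_iff p).2 hp)⟩, rfl⟩

/-- The neighbourhood of `A` in `X` given by the collar. -/
def nhd : Set X := A ∪ Φ '' h.W

theorem mem_nhd_iff (p : P) : Φ p ∈ h.nhd ↔ p ∈ h.W := by
  constructor
  · rintro (hA | ⟨p', hp', hpp⟩)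
    · exact h.subset_W ((h.mem_iff p).1 hA)
    · by_cases hp : p ∈ B
      · exact h.subset_W hp
      · have hB : p' ∉ B := fun hB => hp ((h.mem_iff p).1 (hpp ▸ (h.mem_iff p').2 hB))
        exact h.inj p' p hB hp hpp ▸ hp'
  · exact fun hp => Or.inr ⟨p, hp, rfl⟩

theorem isOpen_nhd : IsOpen h.nhd := by
  rw [← h.isQuotientMap.isOpen_preimage, isOpen_sum_iff]
  constructor
  · have : (Sum.inl ⁻¹' (Sum.elim (Subtype.val : A → X) Φ ⁻¹' h.nhd) : Set A) = Set.univ :=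
      Set.eq_univ_of_forall fun a => Or.inl a.2
    rw [this]
    exact isOpen_univ
  · have : (Sum.inr ⁻¹' (Sum.elim (Subtype.val : A → X) Φ ⁻¹' h.nhd) : Set P) = h.W :=
      Set.ext h.mem_nhd_iff
    rw [this]
    exact h.isOpen_W

/-- The push of the attached space and the constant homotopy of `A` glue to a homotopy of `X`. -/
theorem exists_homotopy : ∃ H : C(Simp 2 × X, X), (∀ τ, ∀ a ∈ A, H (τ, a) = a) ∧
    ∀ τ p, H (τ, Φ p) = Φ (h.push (τ, p)) := by
  let F : A ⊕ P → C(Simp 2, X) := Sum.elim (fun a => ContinuousMap.const _ a.1)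
    (fun p => (Φ.comp (h.push.comp ContinuousMap.prodSwap)).curry p)
  have hF : Continuous F := by
    refine Continuous.sumElim ?_ (ContinuousMap.continuous _)
    exact ContinuousMap.continuous_const'.comp continuous_subtype_val
  have hwd : ∀ y y', Sum.elim (Subtype.val : A → X) Φ y = Sum.elim (Subtype.val : A → X) Φ y' →
      F y = F y' := by
    have key : ∀ p ∈ B, ∀ τ, (F (Sum.inr p)) τ = Φ p := fun p hp τ => by
      change Φ (h.push (τ, p)) = Φ p
      rw [h.push_fixed τ p hp]
    rintro (a | p) (a' | p') hy
    · exact congrArg (fun a => F (Sum.inl a)) (Subtype.ext hy)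
    · change (a : X) = Φ p' at hy
      have hp' := (h.mem_iff p').1 (hy ▸ a.2)
      ext τ
      exact hy.trans (key p' hp' τ).symm
    · change Φ p = (a' : X) at hy
      have hp := (h.mem_iff p).1 (hy ▸ a'.2)
      ext τ
      exact (key p hp τ).trans hy
    · change Φ p = Φ p' at hy
      by_cases hp : p ∈ B
      · have hp' := (h.mem_iff p').1 (hy ▸ (h.mem_iff p).2 hp)
        ext τ
        exact (key p hp τ).trans (hy.trans (key p' hp' τ).symm)
      · have hp' : p' ∉ B := fun hB => hp ((h.mem_iff p).1 (hy ▸ (h.mem_iff p').2 hB))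
        rw [h.inj p p' hp hp' hy]
  let G : X → C(Simp 2, X) := fun x => F (h.isQuotientMap.surjective x).choose
  have hG : ∀ y, G (Sum.elim (Subtype.val : A → X) Φ y) = F y := fun y =>
    hwd _ _ (h.isQuotientMap.surjective _).choose_spec
  have hGc : Continuous G := by
    rw [h.isQuotientMap.continuous_iff]
    exact (funext hG : G ∘ _ = F) ▸ hF
  refine ⟨(ContinuousMap.uncurry ⟨G, hGc⟩).comp ContinuousMap.prodSwap, ?_, ?_⟩
  · intro τ a ha
    exact DFunLike.congr_fun (hG (Sum.inl ⟨a, ha⟩)) τ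
  · intro τ p
    exact DFunLike.congr_fun (hG (Sum.inr p)) τ

end Attachment

/-- A homotopy from the identity changes a chain by a boundary and a term depending only on the
boundary of the chain. -/
theorem sMap_homotopyEnd_one {H : C(Simp 2 × X, X)} (h₀ : ∀ x, H (stdSimplex.vertex 0, x) = x)
    (a : SChains X) :
    sMap (homotopyEnd H 1) a = a + sBdry (prismOp H a) + prismOp H (sBdry a) := by
  have : homotopyEnd H 0 = ContinuousMap.id X := ContinuousMap.ext h₀
  rw [sBdry_prismOp, this, sMap_id]
  abel

/-- A retraction argument: if the homotopy `H` from the identity preserves `A` and ends in `A`,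
then relative cycles are relative boundaries. -/
theorem exists_sub_sBdry_mem_of_homotopy {A : Set X} (H : C(Simp 2 × X, X))
    (h₀ : ∀ x, H (stdSimplex.vertex 0, x) = x) (hA : ∀ τ, ∀ a ∈ A, H (τ, a) ∈ A)
    (h₁ : ∀ x, H (stdSimplex.vertex 1, x) ∈ A) {z : SChains X} (hz : sBdry z ∈ SIn A) :
    ∃ w, z - sBdry w ∈ SIn A := by
  refine ⟨-prismOp H z, ?_⟩
  have e := sMap_homotopyEnd_one h₀ z
  have : z - sBdry (-prismOp H z) = sMap (homotopyEnd H 1) z - prismOp H (sBdry z) := by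
    rw [e, map_neg]; abel
  rw [this]
  exact sub_mem (sMap_mem_SIn (A := Set.univ) (fun x _ => h₁ x) (SIn_univ z))
    (prismOp_mem_SIn hA hz)

namespace Attachment

variable {Φ : C(P, X)} {A : Set X} {B : Set P} (h : Attachment Φ A B)
include h

theorem nhd_union_compl : h.nhd ∪ Aᶜ = Set.univ := by
  refine Set.eq_univ_of_forall fun x => ?_
  by_cases hx : x ∈ A
  · exact Or.inl (Or.inl hx)
  · exact Or.inr hx

theorem push_chain (a : SChains P) :
    sMap (homotopyEnd h.push 1) a = a + sBdry (prismOp h.push a) + prismOp h.push (sBdry a) :=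
  sMap_homotopyEnd_one h.push_zero a

/-- Excision, surjectivity: a relative cycle of `(X, A)` comes, up to a relative boundary, from a
relative cycle of `(P, B)`. -/
theorem exists_relCycle {z : SChains X} (hz : sBdry z ∈ SIn A) :
    ∃ w v, sBdry v ∈ SIn B ∧ z - sBdry w - sMap Φ v ∈ SIn A := by
  -- the homotopy `H` of `X` fixes `A` and pushes the neighbourhood `h.nhd` into `A`
  obtain ⟨H, hHA, hHΦ⟩ := h.exists_homotopy
  have hH₀ : ∀ x, H (stdSimplex.vertex 0, x) = x := by
    intro x
    by_cases hx : x ∈ A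
    · exact hHA _ x hx
    · obtain ⟨p, rfl⟩ := h.compl_subset_range hx
      exact (hHΦ _ _).trans (congrArg Φ (h.push_zero _))
  have hHA' : ∀ τ, ∀ a ∈ A, H (τ, a) ∈ A := fun τ a ha => by rw [hHA τ a ha]; exact ha
  have hH₁ : ∀ x ∈ h.nhd, homotopyEnd H 1 x ∈ A := by
    rintro x (hx | ⟨p, hp, rfl⟩)
    · exact hHA' _ x hx
    · change H (_, Φ p) ∈ A
      rw [hHΦ, h.mem_iff]
      exact h.push_one p hp
  -- a fine subdivision of `z` is a sum of `y` near `A` and of `v` in the open cell; the relative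
  -- cycle sought is the push of `v`, and the push of `y` lies in `A`
  obtain ⟨k, hk⟩ := (eventually_sSd_pow_mem h.isOpen_nhd h.isClosed.isOpen_compl
    h.nhd_union_compl z).exists
  obtain ⟨y, hy, v, hv, hyv⟩ := Submodule.mem_sup.1 hk
  obtain ⟨v', -, hv'⟩ := exists_sMap_eq_of_isEmbedding h.isOpenEmbedding_openCell.isEmbedding
    h.compl_subset_range hv
  have hA_nhd : A ⊆ h.nhd := Set.subset_union_left
  have hbz := sSd_pow_mem_SIn hz k
  have hbv : sBdry v ∈ SIn h.nhd := by
    have : sBdry v = (sSd ^ k) (sBdry z) - sBdry y := by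
      rw [← sBdry_sSd_pow, ← hyv, map_add]; abel
    rw [this]
    exact sub_mem (SIn_mono hA_nhd hbz) (sBdry_mem_SIn hy)
  have hbv' : sBdry v' ∈ SIn (h.openCell ⁻¹' h.nhd) := by
    refine mem_SIn_of_sMap h.isOpenEmbedding_openCell.injective ?_
    rwa [← sBdry_sMap, hv']
  let ι : C((Bᶜ : Set P), P) := ⟨Subtype.val, continuous_subtype_val⟩
  have hΦv : sMap Φ (sMap ι v') = v := by rw [sMap_sMap]; exact hv'
  have hbv'' : sBdry (sMap ι v') ∈ SIn h.W := by
    rw [sBdry_sMap]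
    exact sMap_mem_SIn (fun x hx => (h.mem_nhd_iff _).1 hx) hbv'
  refine ⟨sSdHIter k z - prismOp H ((sSd ^ k) z), sMap (homotopyEnd h.push 1) (sMap ι v'), ?_, ?_⟩
  · rw [sBdry_sMap]
    exact sMap_mem_SIn h.push_one hbv''
  · have e₁ := sBdry_sSdHIter k z
    have e₂ := sMap_homotopyEnd_one hH₀ ((sSd ^ k) z)
    have e₃ : sMap Φ (sMap (homotopyEnd h.push 1) (sMap ι v')) = sMap (homotopyEnd H 1) v := by
      rw [← hΦv, sMap_sMap, sMap_sMap Φ]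
      · rw [sMap_sMap (homotopyEnd H 1), sMap_sMap]
        refine congrArg (fun f : C((Bᶜ : Set P), X) => sMap f v') (ContinuousMap.ext fun x => ?_)
        exact (hHΦ _ _).symm
    have e₄ : z - sBdry (sSdHIter k z - prismOp H ((sSd ^ k) z))
        - sMap Φ (sMap (homotopyEnd h.push 1) (sMap ι v'))
        = sSdHIter k (sBdry z) - prismOp H ((sSd ^ k) (sBdry z))
          + sMap (homotopyEnd H 1) y := by
      rw [e₃, map_sub, e₁]
      rw [← hyv, map_add, hyv, sBdry_sSd_pow] at e₂
      have e₅ : sMap (homotopyEnd H 1) v = (sSd ^ k) z + sBdry (prismOp H ((sSd ^ k) z))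
          + prismOp H ((sSd ^ k) (sBdry z)) - sMap (homotopyEnd H 1) y := by
        rw [← e₂]; abel
      rw [e₅]
      abel
    rw [e₄]
    exact add_mem (sub_mem (sSdHIter_mem_SIn hz k) (prismOp_mem_SIn hHA' hbz))
      (sMap_mem_SIn hH₁ hy)

/-- Excision, injectivity: a relative cycle of `(P, B)` that bounds in `(X, A)` bounds in
`(P, B)`. -/
theorem exists_relBoundary {v : SChains P} (hv : sBdry v ∈ SIn B) {w : SChains X}
    (hw : sMap Φ v - sBdry w ∈ SIn A) : ∃ w', v - sBdry w' ∈ SIn B := by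
  have hWB : h.W ∪ Bᶜ = Set.univ := by
    refine Set.eq_univ_of_forall fun x => ?_
    by_cases hx : x ∈ B
    · exact Or.inl (h.subset_W hx)
    · exact Or.inr hx
  -- subdivide `w` and `v` into a part near `A`, respectively `B`, and a part in the open cell
  obtain ⟨k, hkw, hkv⟩ := ((eventually_sSd_pow_mem h.isOpen_nhd h.isClosed.isOpen_compl
    h.nhd_union_compl w).and (eventually_sSd_pow_mem h.isOpen_W h.isClosed_B.isOpen_compl
      hWB v)).exists
  obtain ⟨w₁, hw₁, w₂, hw₂, hw₁₂⟩ := Submodule.mem_sup.1 hkw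
  obtain ⟨y₁, hy₁, y₂, hy₂, hy₁₂⟩ := Submodule.mem_sup.1 hkv
  obtain ⟨w', -, hw'⟩ := exists_sMap_eq_of_isEmbedding h.isOpenEmbedding_openCell.isEmbedding
    h.compl_subset_range hw₂
  let ι : C((Bᶜ : Set P), P) := ⟨Subtype.val, continuous_subtype_val⟩
  obtain ⟨y', -, hy'⟩ := exists_sMap_eq_of_isEmbedding (f := ι) IsEmbedding.subtypeVal
    (B := Bᶜ) (fun x hx => ⟨⟨x, hx⟩, rfl⟩) hy₂
  have hΦι : ∀ c, sMap Φ (sMap ι c) = sMap h.openCell c := fun c => by rw [sMap_sMap]; rfl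
  -- the parts inside the open cell agree up to chains in the collar
  have hd : y' - sBdry w' ∈ SIn (h.openCell ⁻¹' h.nhd) := by
    refine mem_SIn_of_sMap h.isOpenEmbedding_openCell.injective ?_
    have : sMap h.openCell (y' - sBdry w')
        = (sSd ^ k) (sMap Φ v - sBdry w) - sMap Φ y₁ + sBdry w₁ := by
      rw [map_sub, ← hΦι, hy', ← sBdry_sMap, hw', map_sub, ← sBdry_sSd_pow, ← hw₁₂,
        ← sMap_sSd_pow, ← hy₁₂, map_add, map_add]
      abel
    rw [this]
    have hA_nhd : A ⊆ h.nhd := Set.subset_union_left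
    exact add_mem (sub_mem (SIn_mono hA_nhd (sSd_pow_mem_SIn hw k))
      (sMap_mem_SIn (fun x hx => (h.mem_nhd_iff x).2 hx) hy₁)) (sBdry_mem_SIn hw₁)
  have hd' : y₂ - sBdry (sMap ι w') ∈ SIn h.W := by
    rw [← hy', sBdry_sMap, ← map_sub]
    exact sMap_mem_SIn (fun x hx => (h.mem_nhd_iff _).1 hx) hd
  refine ⟨sMap (homotopyEnd h.push 1) (sMap ι w') + sSdHIter k v
    - prismOp h.push ((sSd ^ k) v), ?_⟩
  -- pushing moves everything near `B` into `B`
  have e₁ := sBdry_sSdHIter k v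
  have e₂ := h.push_chain ((sSd ^ k) v)
  rw [sBdry_sSd_pow] at e₂
  have hpB : ∀ τ, ∀ p ∈ B, h.push (τ, p) ∈ B := fun τ p hp => by
    rw [h.push_fixed τ p hp]; exact hp
  have e₃ : v - sBdry (sMap (homotopyEnd h.push 1) (sMap ι w') + sSdHIter k v
        - prismOp h.push ((sSd ^ k) v))
      = sMap (homotopyEnd h.push 1) y₁ + sMap (homotopyEnd h.push 1) (y₂ - sBdry (sMap ι w'))
        + sSdHIter k (sBdry v) - prismOp h.push ((sSd ^ k) (sBdry v)) := by
    have e₅ : sBdry (prismOp h.push ((sSd ^ k) v)) = sMap (homotopyEnd h.push 1) ((sSd ^ k) v)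
        - (sSd ^ k) v - prismOp h.push ((sSd ^ k) (sBdry v)) := by
      rw [e₂]; abel
    have e₆ : sMap (homotopyEnd h.push 1) ((sSd ^ k) v)
        = sMap (homotopyEnd h.push 1) y₁ + sMap (homotopyEnd h.push 1) y₂ := by
      rw [← hy₁₂, map_add]
    rw [map_sub, map_add, e₁, e₅, map_sub, sBdry_sMap, e₆]
    abel
  rw [e₃]
  exact sub_mem (add_mem (add_mem (sMap_mem_SIn h.push_one hy₁) (sMap_mem_SIn h.push_one hd'))
    (sSdHIter_mem_SIn hv k)) (prismOp_mem_SIn hpB (sSd_pow_mem_SIn hv k))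

end Attachment

end Attach

end Prismatic

namespace Prismatic

open Finsupp Topology

/-! ### Barycentric coordinates on prisms -/

instance Prism.instCompactSpace : (ks : List ℕ) → CompactSpace (Prism ks)
  | [] => inferInstanceAs (CompactSpace Unit)
  | m :: ms =>
    haveI := Prism.instCompactSpace ms
    inferInstanceAs (CompactSpace (stdSimplex ℝ (Fin (m + 2)) × Prism ms))

instance Prism.instT2Space : (ks : List ℕ) → T2Space (Prism ks)
  | [] => inferInstanceAs (T2Space Unit)
  | m :: ms =>
    haveI := Prism.instT2Space ms
    inferInstanceAs (T2Space (stdSimplex ℝ (Fin (m + 2)) × Prism ms))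

/-- The identification of a prism with the product of its first factor and the prism of the other
factors, as a continuous map. -/
def consC (m : ℕ) (ms : List ℕ) : C(Simp (m + 2) × Prism ms, Prism (m :: ms)) :=
  ⟨id, continuous_id⟩

/-- The two projections of a prism to its first factor and to the prism of the other factors. -/
def unconsC (m : ℕ) (ms : List ℕ) : C(Prism (m :: ms), Simp (m + 2) × Prism ms) :=
  ⟨id, continuous_id⟩

/-- The barycentric coordinates of a point of a prism; they are indexed by the vertices of the
factors, hence by the facets, and a facet is the zero set of its coordinate. -/
def coord : (ks : List ℕ) → Prism ks → Facet ks → ℝ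
  | [], _ => Empty.elim
  | _ :: ms, (x, y) => Sum.elim (fun i => x i) (coord ms y)

/-- The union of the facets of a prism. -/
def facetUnion (ks : List ℕ) : Set (Prism ks) := {x | ∃ f, coord ks x f = 0}

/-- The condition that the coordinates belonging to each factor sum to one. -/
def BlockSum : (ks : List ℕ) → (Facet ks → ℝ) → Prop
  | [], _ => True
  | m :: ms, v => ∑ i : Fin (m + 2), v (Sum.inl i) = 1 ∧ BlockSum ms (fun f => v (Sum.inr f))

theorem continuous_coord : (ks : List ℕ) → (f : Facet ks) → Continuous fun x => coord ks x f
  | m :: ms, Sum.inl i => by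
    have : Continuous fun x : Simp (m + 2) × Prism ms => x.1 i :=
      (continuous_apply i).comp (continuous_subtype_val.comp continuous_fst)
    exact this.comp (unconsC m ms).continuous
  | m :: ms, Sum.inr f => by
    have : Continuous fun x : Simp (m + 2) × Prism ms => coord ms x.2 f :=
      (continuous_coord ms f).comp continuous_snd
    exact this.comp (unconsC m ms).continuous

theorem coord_injective : (ks : List ℕ) → Function.Injective (coord ks)
  | [] => fun _ _ _ => rfl
  | m :: ms => by
    rintro ⟨x, y⟩ ⟨x', y'⟩ h
    refine Prod.ext ?_ (coord_injective ms ?_)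
    · ext i
      exact congrFun h (Sum.inl i)
    · funext f
      exact congrFun h (Sum.inr f)

theorem coord_nonneg : (ks : List ℕ) → (x : Prism ks) → (f : Facet ks) → 0 ≤ coord ks x f
  | _ :: _, (x, _), Sum.inl i => x.2.1 i
  | _ :: ms, (_, y), Sum.inr f => coord_nonneg ms y f

theorem blockSum_coord : (ks : List ℕ) → (x : Prism ks) → BlockSum ks (coord ks x)
  | [], _ => trivial
  | _ :: ms, (x, y) => ⟨x.2.2, blockSum_coord ms y⟩

theorem exists_coord_eq : (ks : List ℕ) → (v : Facet ks → ℝ) → (∀ f, 0 ≤ v f) → BlockSum ks v →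
    ∃ x, coord ks x = v
  | [], _, _, _ => ⟨(), funext fun f => f.elim⟩
  | m :: ms, v, h₀, h₁ => by
    obtain ⟨y, hy⟩ := exists_coord_eq ms (fun f => v (Sum.inr f)) (fun f => h₀ _) h₁.2
    refine ⟨(⟨fun i => v (Sum.inl i), fun i => h₀ _, h₁.1⟩, y), ?_⟩
    funext f
    rcases f with i | f
    · rfl
    · exact congrFun hy f

theorem isEmbedding_coord (ks : List ℕ) : IsEmbedding (coord ks) :=
  ((continuous_pi (continuous_coord ks)).isClosedEmbedding (coord_injective ks)).isEmbedding

theorem blockSum_extrapolate : (ks : List ℕ) → {v y : Facet ks → ℝ} → BlockSum ks v →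
    BlockSum ks y → (c : ℝ) → BlockSum ks (fun f => v f + c * (v f - y f))
  | [], _, _, _, _, _ => trivial
  | m :: ms, v, y, hv, hy, c => by
    refine ⟨?_, blockSum_extrapolate ms hv.2 hy.2 c⟩
    rw [Finset.sum_add_distrib, ← Finset.mul_sum, Finset.sum_sub_distrib, hv.1, hy.1]
    ring

/-! ### Pushing a prism away from a pole -/

section Push

variable {ks : List ℕ} {J : Finset (Facet ks)} (hJ : J.Nonempty) {y : Facet ks → ℝ}

/-- The position of a point between the pole `y` (value `1`) and the union of the facets in `J`
(value `0`). -/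
noncomputable def depth (hJ : J.Nonempty) (y : Facet ks → ℝ) (x : Prism ks) : ℝ :=
  J.inf' hJ fun f => coord ks x f / y f

theorem continuous_depth : Continuous (depth hJ y) :=
  Continuous.finset_inf'_apply hJ fun f _ => (continuous_coord ks f).div_const _

theorem depth_nonneg (hy : ∀ f ∈ J, 0 < y f) (x : Prism ks) : 0 ≤ depth hJ y x :=
  Finset.le_inf' _ _ fun f hf => div_nonneg (coord_nonneg ks x f) (hy f hf).le

theorem depth_mul_le (hy : ∀ f ∈ J, 0 < y f) (x : Prism ks) {f : Facet ks} (hf : f ∈ J) :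
    depth hJ y x * y f ≤ coord ks x f := by
  have : depth hJ y x ≤ coord ks x f / y f := Finset.inf'_le _ hf
  rwa [le_div_iff₀ (hy f hf)] at this

theorem exists_depth_eq (hy : ∀ f ∈ J, 0 < y f) (x : Prism ks) :
    ∃ f ∈ J, coord ks x f = depth hJ y x * y f := by
  obtain ⟨f, hf, h⟩ := Finset.exists_mem_eq_inf' hJ fun f => coord ks x f / y f
  refine ⟨f, hf, ?_⟩
  rw [depth, h, div_mul_cancel₀ _ (hy f hf).ne']

theorem depth_eq_zero (hy : ∀ f ∈ J, 0 < y f) {x : Prism ks} {f : Facet ks} (hf : f ∈ J)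
    (hx : coord ks x f = 0) : depth hJ y x = 0 := by
  refine le_antisymm ?_ (depth_nonneg hJ hy x)
  have := depth_mul_le hJ hy x hf
  rw [hx] at this
  nlinarith [hy f hf]

/-- Let `y` be a point of the affine span of a prism whose coordinates are positive exactly on the
set `J` of facets. Moving along the rays from `y` defines a homotopy of the prism that fixes the
facets in `J` and pushes all points that are not too close to `y` into these facets. -/
theorem exists_push (hy₁ : BlockSum ks y) (hy : ∀ f ∈ J, 0 < y f) (hy' : ∀ f ∉ J, y f ≤ 0) :
    ∃ H : C(Simp 2 × Prism ks, Prism ks), (∀ x, H (stdSimplex.vertex 0, x) = x) ∧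
      (∀ τ x, (∃ f ∈ J, coord ks x f = 0) → H (τ, x) = x) ∧
      ∀ x, depth hJ y x ≤ 1 / 2 → ∃ f ∈ J, coord ks (H (stdSimplex.vertex 1, x)) f = 0 := by
  set s := depth hJ y with hs
  -- at depth at most `1 / 2` this speed is `s / (1 - s)`, which moves the point exactly to the
  -- facets; the maximum keeps it continuous near the pole
  let sp : Prism ks → ℝ := fun x => s x / max (1 - s x) (1 / 2)
  have hmax : ∀ x, 0 < max (1 - s x) (1 / 2) := fun x => lt_max_of_lt_right (by norm_num)
  have hs₀ : ∀ x, 0 ≤ s x := depth_nonneg hJ hy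
  have hsp₀ : ∀ x, 0 ≤ sp x := fun x => div_nonneg (hs₀ x) (hmax x).le
  have hsp₁ : ∀ x, sp x * (1 - s x) ≤ s x := fun x => by
    have h₁ : sp x * max (1 - s x) (1 / 2) = s x := div_mul_cancel₀ _ (hmax x).ne'
    calc sp x * (1 - s x) ≤ sp x * max (1 - s x) (1 / 2) :=
          mul_le_mul_of_nonneg_left (le_max_left _ _) (hsp₀ x)
      _ = s x := h₁
  let v : Simp 2 × Prism ks → Facet ks → ℝ := fun q f =>
    coord ks q.2 f + (q.1 1 * sp q.2) * (coord ks q.2 f - y f)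
  have hv₀ : ∀ q f, 0 ≤ v q f := by
    rintro ⟨τ, x⟩ f
    have hτ₀ : 0 ≤ τ 1 := τ.2.1 1
    have hτ₁ : τ 1 ≤ 1 := stdSimplex.le_one τ 1
    change 0 ≤ coord ks x f + (τ 1 * sp x) * (coord ks x f - y f)
    have hc₀ : 0 ≤ τ 1 * sp x := mul_nonneg hτ₀ (hsp₀ x)
    by_cases hf : f ∈ J
    · have h₁ := depth_mul_le hJ hy x hf
      rw [← hs] at h₁
      have h₂ : τ 1 * sp x * (1 - s x) ≤ s x := by
        rcases le_total (1 - s x) 0 with h | h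
        · exact (mul_nonpos_of_nonneg_of_nonpos hc₀ h).trans (hs₀ x)
        · calc τ 1 * sp x * (1 - s x) = τ 1 * (sp x * (1 - s x)) := by ring
            _ ≤ 1 * (sp x * (1 - s x)) :=
              mul_le_mul_of_nonneg_right hτ₁ (mul_nonneg (hsp₀ x) h)
            _ ≤ s x := by rw [one_mul]; exact hsp₁ x
      have h₃ : 0 ≤ y f * (s x - τ 1 * sp x * (1 - s x)) :=
        mul_nonneg (hy f hf).le (sub_nonneg.2 h₂)
      have h₄ := mul_le_mul_of_nonneg_left h₁ (add_nonneg zero_le_one hc₀)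
      linarith
    · exact add_nonneg (coord_nonneg ks x f) (mul_nonneg hc₀
        (sub_nonneg.2 ((hy' f hf).trans (coord_nonneg ks x f))))
  have hvb : ∀ q, BlockSum ks (v q) := fun q =>
    blockSum_extrapolate ks (blockSum_coord ks q.2) hy₁ _
  choose H hH using fun q => exists_coord_eq ks (v q) (hv₀ q) (hvb q)
  have hsc : Continuous s := continuous_depth hJ
  have hspc : Continuous sp :=
    hsc.div ((continuous_const.sub hsc).max continuous_const) fun x => (hmax x).ne'
  have hHc : Continuous H := by
    rw [(isEmbedding_coord ks).continuous_iff]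
    refine continuous_pi fun f => ?_
    have : (fun q => (coord ks ∘ H) q f) = fun q => v q f := funext fun q => congrFun (hH q) f
    rw [this]
    have hc : Continuous fun q : Simp 2 × Prism ks => coord ks q.2 f :=
      (continuous_coord ks f).comp continuous_snd
    have hτ : Continuous fun q : Simp 2 × Prism ks => q.1 1 :=
      (continuous_apply 1).comp (continuous_subtype_val.comp continuous_fst)
    exact hc.add ((hτ.mul (hspc.comp continuous_snd)).mul (hc.sub continuous_const))
  refine ⟨⟨H, hHc⟩, ?_, ?_, ?_⟩
  · intro x
    refine coord_injective ks ((hH _).trans (funext fun f => ?_))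
    change coord ks x f + ((stdSimplex.vertex (S := ℝ) (0 : Fin 2)) 1 * sp x) * _ = _
    simp
  · rintro τ x ⟨f, hf, hx⟩
    refine coord_injective ks ((hH _).trans (funext fun g => ?_))
    have : sp x = 0 := by
      change s x / _ = 0
      rw [hs, depth_eq_zero hJ hy hf hx, zero_div]
    change coord ks x g + (τ 1 * sp x) * _ = _
    rw [this]
    ring
  · intro x hx
    obtain ⟨f, hf, hxf⟩ := exists_depth_eq hJ hy x
    rw [← hs] at hxf
    refine ⟨f, hf, ?_⟩
    rw [ContinuousMap.coe_mk, hH]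
    change coord ks x f + ((stdSimplex.vertex (S := ℝ) (1 : Fin 2)) 1 * sp x) * _ = 0
    have h₁ : sp x * (1 - s x) = s x := by
      change s x / max (1 - s x) (1 / 2) * (1 - s x) = s x
      rw [max_eq_left (by linarith), div_mul_cancel₀ _ (by linarith)]
    rw [hxf]
    simp only [stdSimplex.vertex_coe, Pi.single_eq_same, one_mul]
    linear_combination (- y f) * h₁

end Push

/-! ### Collars and retractions of prisms -/

theorem coord_center_pos : (ks : List ℕ) → (f : Facet ks) → 0 < coord ks (center ks) f
  | m :: ms, Sum.inl i => by
    change 0 < (stdSimplex.barycenter (𝕜 := ℝ) (X := Fin (m + 2))).val i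
    rw [stdSimplex.barycenter_apply, Fintype.card_fin]
    positivity
  | _ :: ms, Sum.inr f => coord_center_pos ms f

/-- The boundary of a prism has a collar: away from the center, push radially from the center until
the boundary is reached. -/
theorem exists_collar (ks : List ℕ) : ∃ (H : C(Simp 2 × Prism ks, Prism ks)) (W : Set (Prism ks)),
    IsOpen W ∧ facetUnion ks ⊆ W ∧ (∀ x, H (stdSimplex.vertex 0, x) = x) ∧
      (∀ τ, ∀ x ∈ facetUnion ks, H (τ, x) = x) ∧
      ∀ x ∈ W, H (stdSimplex.vertex 1, x) ∈ facetUnion ks := by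
  rcases ks with _ | ⟨m, ms⟩
  · exact ⟨ContinuousMap.snd, ∅, isOpen_empty, fun x ⟨f, _⟩ => f.elim, fun _ => rfl,
      fun _ _ _ => rfl, fun _ h => h.elim⟩
  · have hJ : (Finset.univ : Finset (Facet (m :: ms))).Nonempty := ⟨Sum.inl 0, Finset.mem_univ _⟩
    have hpos := coord_center_pos (m :: ms)
    obtain ⟨H, h₀, h₁, h₂⟩ := exists_push hJ (blockSum_coord _ (center (m :: ms)))
      (fun f _ => hpos f) (fun f hf => absurd (Finset.mem_univ f) hf)
    refine ⟨H, {x | depth hJ (coord _ (center (m :: ms))) x < 1 / 2},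
      isOpen_lt (continuous_depth hJ) continuous_const, ?_, h₀, ?_, ?_⟩
    · rintro x ⟨f, hf⟩
      change depth hJ _ x < 1 / 2
      rw [depth_eq_zero hJ (fun f _ => hpos f) (Finset.mem_univ f) hf]
      norm_num
    · rintro τ x ⟨f, hf⟩
      exact h₁ τ x ⟨f, Finset.mem_univ f, hf⟩
    · intro x hx
      obtain ⟨f, -, hf⟩ := h₂ x (le_of_lt hx)
      exact ⟨f, hf⟩

/-- The union of all facets except the one opposite to the first vertex of the first factor. -/
def openBox (m : ℕ) (ms : List ℕ) : Set (Prism (m :: ms)) :=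
  {x | ∃ f, f ≠ Sum.inl 0 ∧ coord (m :: ms) x f = 0}

theorem openBox_subset (m : ℕ) (ms : List ℕ) : openBox m ms ⊆ facetUnion (m :: ms) :=
  fun _ ⟨f, _, hf⟩ => ⟨f, hf⟩

/-- A prism retracts by deformation onto the union of all its facets but one. -/
theorem exists_retraction (m : ℕ) (ms : List ℕ) :
    ∃ H : C(Simp 2 × Prism (m :: ms), Prism (m :: ms)), (∀ x, H (stdSimplex.vertex 0, x) = x) ∧
      (∀ τ, ∀ x ∈ openBox m ms, H (τ, x) = x) ∧
      ∀ x, H (stdSimplex.vertex 1, x) ∈ openBox m ms := by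
  classical
  -- the pole lies so far beyond the omitted facet that all points have depth at most `1 / 2`
  let y : Facet (m :: ms) → ℝ := Sum.elim
    (Fin.cases (1 - (m + 1) * 2) (fun _ : Fin (m + 1) => 2)) (coord ms (center ms))
  let J : Finset (Facet (m :: ms)) := Finset.univ.filter (fun f => f ≠ Sum.inl 0)
  have hmem : ∀ f, f ∈ J ↔ f ≠ Sum.inl 0 := fun f => by simp [J]
  have hJ : J.Nonempty := ⟨Sum.inl 1, (hmem _).2 fun h => by simpa using Sum.inl_injective h⟩
  have hy₁ : BlockSum (m :: ms) y := by
    refine ⟨?_, blockSum_coord ms (center ms)⟩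
    change ∑ i : Fin (m + 2), (Fin.cases (1 - (m + 1) * 2) (fun _ : Fin (m + 1) => 2) i : ℝ) = 1
    rw [Fin.sum_univ_succ]
    simp
  have hy : ∀ f ∈ J, 0 < y f := by
    intro f hf
    rcases f with i | f
    · obtain ⟨j, rfl⟩ := Fin.exists_succ_eq.2 (fun h => (hmem _).1 hf (congrArg Sum.inl h))
      change (0 : ℝ) < 2
      norm_num
    · exact coord_center_pos ms f
  have hy' : ∀ f ∉ J, y f ≤ 0 := by
    intro f hf
    rw [hmem, not_not] at hf
    subst hf
    change (1 : ℝ) - (m + 1) * 2 ≤ 0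
    have : (0 : ℝ) ≤ m := Nat.cast_nonneg m
    linarith
  obtain ⟨H, h₀, h₁, h₂⟩ := exists_push hJ hy₁ hy hy'
  refine ⟨H, h₀, fun τ x ⟨f, hf, hx⟩ => h₁ τ x ⟨f, (hmem f).2 hf, hx⟩, fun x => ?_⟩
  have hd : depth hJ y x ≤ 1 / 2 := by
    have hle : depth hJ y x ≤ coord (m :: ms) x (Sum.inl 1) / y (Sum.inl 1) :=
      Finset.inf'_le _ ((hmem _).2 fun h => by simpa using Sum.inl_injective h)
    have hx1 : coord (m :: ms) x (Sum.inl 1) ≤ 1 := stdSimplex.le_one x.1 1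
    have hy1 : y (Sum.inl 1) = 2 := rfl
    rw [hy1] at hle
    linarith
  obtain ⟨f, hf, hx⟩ := h₂ x hd
  exact ⟨f, (hmem f).1 hf, hx⟩

/-! ### Facets -/

theorem simpMap_succAbove_self {n : ℕ} (i : Fin (n + 1)) (x : Simp n) :
    simpMap i.succAbove x i = 0 := by
  change FunOnFinite.linearMap ℝ ℝ i.succAbove x i = 0
  rw [FunOnFinite.linearMap_apply_apply, Finset.filter_false_of_mem]
  · rfl
  · exact fun j _ => Fin.succAbove_ne i j

theorem simpMap_apply_of_injective {m n : ℕ} {f : Fin m → Fin n} (hf : Function.Injective f)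
    (x : Simp m) (j : Fin m) : simpMap f x (f j) = x j := by
  change FunOnFinite.linearMap ℝ ℝ f x (f j) = x j
  rw [FunOnFinite.linearMap_apply_apply]
  have : Finset.univ.filter (fun k => f k = f j) = {j} := by
    ext k
    simp [hf.eq_iff]
  rw [this, Finset.sum_singleton]

theorem exists_simpMap_succAbove {n : ℕ} {i : Fin (n + 1)} {x : Simp (n + 1)} (hx : x i = 0) :
    ∃ y, simpMap i.succAbove y = x := by
  refine ⟨⟨fun j => x (i.succAbove j), fun j => x.2.1 _, ?_⟩, ?_⟩
  · have h : ∑ j, x j = 1 := x.2.2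
    rwa [Fin.sum_univ_succAbove _ i, hx, zero_add] at h
  · ext k
    rcases Fin.eq_self_or_eq_succAbove i k with rfl | ⟨j, rfl⟩
    · rw [simpMap_succAbove_self, hx]
    · rw [simpMap_apply_of_injective Fin.succAbove_right_injective]
      rfl

theorem continuous_headFacetPoint : (m : ℕ) → (ms : List ℕ) → (i : Fin (m + 2)) →
    Continuous (headFacetPoint m ms i)
  | 0, ms, _ => (consC 0 ms).continuous.comp (continuous_const.prodMk continuous_id)
  | m + 1, ms, i => (consC (m + 1) ms).continuous.comp
      (((simpMap i.succAbove).prodMap (ContinuousMap.id (Prism ms))).continuous.comp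
        (unconsC m ms).continuous)

theorem continuous_facetPoint : (ks : List ℕ) → (f : Facet ks) → Continuous (facetPoint ks f)
  | m :: ms, Sum.inl i => continuous_headFacetPoint m ms i
  | m :: ms, Sum.inr f => (consC m ms).continuous.comp
      ((continuous_id.prodMap (continuous_facetPoint ms f)).comp (unconsC m _).continuous)

/-- The inclusion of a facet as a continuous map. -/
noncomputable def facetC (ks : List ℕ) (f : Facet ks) : C(Prism (facetShape ks f), Prism ks) :=
  ⟨facetPoint ks f, continuous_facetPoint ks f⟩

theorem coord_facetPoint_self : (ks : List ℕ) → (f : Facet ks) → (x : Prism (facetShape ks f)) →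
    coord ks (facetPoint ks f x) f = 0
  | 0 :: _, Sum.inl i, _ => simpMap_succAbove_self i _
  | (_ + 1) :: _, Sum.inl i, (x, _) => simpMap_succAbove_self i x
  | _ :: ms, Sum.inr f, (_, y) => coord_facetPoint_self ms f y

theorem exists_facetPoint_eq : (ks : List ℕ) → (f : Facet ks) → (x : Prism ks) →
    coord ks x f = 0 → ∃ y, facetPoint ks f y = x
  | 0 :: ms, Sum.inl i, (x, y), h => by
    obtain ⟨z, hz⟩ := exists_simpMap_succAbove (x := x) (i := i) h
    refine ⟨y, Prod.ext ?_ rfl⟩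
    rw [← hz]
    exact congrArg (simpMap i.succAbove) (Subsingleton.elim _ _)
  | (m + 1) :: ms, Sum.inl i, (x, y), h => by
    obtain ⟨z, hz⟩ := exists_simpMap_succAbove (x := x) (i := i) h
    exact ⟨(z, y), Prod.ext hz rfl⟩
  | m :: ms, Sum.inr f, (x, y), h => by
    obtain ⟨z, hz⟩ := exists_facetPoint_eq ms f y h
    exact ⟨(x, z), Prod.ext rfl hz⟩

theorem range_facetPoint (ks : List ℕ) (f : Facet ks) :
    Set.range (facetPoint ks f) = {x | coord ks x f = 0} := by
  ext x
  constructor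
  · rintro ⟨y, rfl⟩
    exact coord_facetPoint_self ks f y
  · exact exists_facetPoint_eq ks f x

theorem simpMap_injective {m n : ℕ} {f : Fin m → Fin n} (hf : Function.Injective f) :
    Function.Injective (simpMap f) := by
  intro x y h
  ext j
  rw [← simpMap_apply_of_injective hf, h, simpMap_apply_of_injective hf]

theorem facetPoint_injective : (ks : List ℕ) → (f : Facet ks) →
    Function.Injective (facetPoint ks f)
  | 0 :: _, Sum.inl _ => fun _ _ h => congrArg Prod.snd h
  | (m + 1) :: ms, Sum.inl i => by
    rintro ⟨x, y⟩ ⟨x', y'⟩ h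
    have h' : (simpMap i.succAbove x, y) = (simpMap i.succAbove x', y') := h
    exact Prod.ext (simpMap_injective Fin.succAbove_right_injective (Prod.ext_iff.1 h').1)
      (Prod.ext_iff.1 h').2
  | m :: ms, Sum.inr f => by
    rintro ⟨x, y⟩ ⟨x', y'⟩ h
    have h' : (x, facetPoint ms f y) = (x', facetPoint ms f y') := h
    exact Prod.ext (Prod.ext_iff.1 h').1 (facetPoint_injective ms f (Prod.ext_iff.1 h').2)

/-- The facet opposite to the first vertex of the first factor meets the other facets in its own
boundary. -/
theorem headFacetPoint_mem_openBox : (m : ℕ) → (ms : List ℕ) → (x : Prism (decreaseHead m ms)) →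
    (headFacetPoint m ms 0 x ∈ openBox m ms ↔ x ∈ facetUnion (decreaseHead m ms))
  | 0, ms, x => by
    constructor
    · rintro ⟨f, hf, hx⟩
      rcases f with i | f
      · obtain ⟨j, rfl⟩ := Fin.exists_succ_eq.2 (fun h => hf (congrArg Sum.inl h))
        change simpMap (Fin.succAbove 0) (stdSimplex.vertex (0 : Fin 1)) j.succ = 0 at hx
        rw [← Fin.succAbove_zero, simpMap_apply_of_injective Fin.succAbove_right_injective,
          Subsingleton.elim j 0] at hx
        simp at hx
      · exact ⟨f, hx⟩
    · rintro ⟨f, hx⟩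
      exact ⟨Sum.inr f, by simp, hx⟩
  | m + 1, ms, (x, y) => by
    constructor
    · rintro ⟨f, hf, hx⟩
      rcases f with i | f
      · obtain ⟨j, rfl⟩ := Fin.exists_succ_eq.2 (fun h => hf (congrArg Sum.inl h))
        change simpMap (Fin.succAbove 0) x j.succ = 0 at hx
        rw [← Fin.succAbove_zero, simpMap_apply_of_injective Fin.succAbove_right_injective] at hx
        exact ⟨Sum.inl j, hx⟩
      · exact ⟨Sum.inr f, hx⟩
    · rintro ⟨f, hx⟩
      rcases f with j | f
      · refine ⟨Sum.inl j.succ, fun h => Fin.succ_ne_zero j (Sum.inl_injective h), ?_⟩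
        change simpMap (Fin.succAbove 0) x j.succ = 0
        rw [← Fin.succAbove_zero, simpMap_apply_of_injective Fin.succAbove_right_injective]
        exact hx
      · exact ⟨Sum.inr f, by simp, hx⟩

end Prismatic

namespace Prismatic

open Finsupp Topology

/-! ### Fundamental chains of prisms -/

/-- The fundamental chain of a prism: the iterated cross product of the simplices. -/
noncomputable def fundChain : (ks : List ℕ) → SChains (Prism ks)
  | [] => single ⟨1, ContinuousMap.const _ ()⟩ 1
  | m :: ms => sMap (consC m ms) (sCross (m + 1) (fundChain ms))

theorem fundChain_mem_homog : (ks : List ℕ) → fundChain ks ∈ homog (dim ks + 1)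
  | [] => single_mem_homog _ _ _
  | m :: ms => by
    have := chainMap_mem_homog (fun _ σ => (consC m ms).comp σ)
      (sCross_mem_homog (m + 1) (dim ms) (fundChain_mem_homog ms))
    exact this

/-- The inclusion of a facet belonging to the first factor as a continuous map. -/
noncomputable def headC (m : ℕ) (ms : List ℕ) (i : Fin (m + 2)) :
    C(Prism (decreaseHead m ms), Prism (m :: ms)) :=
  ⟨headFacetPoint m ms i, continuous_headFacetPoint m ms i⟩

/-- The contribution of a facet to the boundary of the fundamental chain. -/
noncomputable def facetTerm (ks : List ℕ) (f : Facet ks) : SChains (Prism ks) :=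
  (-1 : ℤ) ^ facetExponent ks f • sMap (facetC ks f) (fundChain (facetShape ks f))

theorem facetTerm_inl (m : ℕ) (ms : List ℕ) (i : Fin (m + 2)) :
    facetTerm (m :: ms) (Sum.inl i)
      = (-1 : ℤ) ^ (i : ℕ) • sMap (headC m ms i) (fundChain (decreaseHead m ms)) := rfl

theorem facetTerm_inr (m : ℕ) (ms : List ℕ) (f : Facet ms) :
    facetTerm (m :: ms) (Sum.inr f)
      = (-1 : ℤ) ^ (m + 1) • sMap (consC m ms) (sCross (m + 1) (facetTerm ms f)) := by
  have h : facetTerm (m :: ms) (Sum.inr f) = (-1 : ℤ) ^ ((m + 1) + facetExponent ms f) •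
      sMap ((consC m ms).comp ((ContinuousMap.id _).prodMap (facetC ms f)))
        (sCross (m + 1) (fundChain (facetShape ms f))) := by
    rw [← sMap_id (sCross (m + 1) (fundChain (facetShape ms f))), sMap_sMap]
    have : facetTerm (m :: ms) (Sum.inr f) = (-1 : ℤ) ^ ((m + 1) + facetExponent ms f) •
      sMap (facetC (m :: ms) (Sum.inr f)) (sMap (consC m (facetShape ms f))
        (sCross (m + 1) (fundChain (facetShape ms f)))) := rfl
    refine this.trans (congrArg _ ?_)
    exact sMap_sMap _ _ _
  rw [h, facetTerm, map_smul, map_smul, ← sMap_sCross, sMap_sMap, smul_smul, ← pow_add]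

theorem sMap_headC (m : ℕ) (ms : List ℕ) (i : Fin (m + 2)) :
    sMap (consC m ms) (sMap ((simpMap i.succAbove).prodMap (ContinuousMap.id (Prism ms)))
      (sCross m (fundChain ms)))
      = sMap (headC m ms i) (fundChain (decreaseHead m ms)) := by
  cases m with
  | zero =>
    rw [sCross_zero, sMap_sMap, sMap_sMap]
    rfl
  | succ m =>
    rw [sMap_sMap]
    exact (sMap_sMap (headC (m + 1) ms i) (consC m ms) (sCross (m + 1) (fundChain ms))).symm

/-- The empty simplex. -/
def emptySimp (X : Type*) [TopologicalSpace X] : C(Simp 0, X) :=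
  ⟨fun t => isEmptyElim t, continuous_of_discreteTopology⟩

theorem eq_emptySimp {X : Type*} [TopologicalSpace X] (σ : C(Simp 0, X)) : σ = emptySimp X :=
  ContinuousMap.ext fun t => isEmptyElim t

theorem sum_facets_cons {M : Type*} [AddCommMonoid M] (m : ℕ) (ms : List ℕ)
    (g : Facet (m :: ms) → M) :
    ∑ f, g f = ∑ i : Fin (m + 2), g (Sum.inl i) + ∑ f : Facet ms, g (Sum.inr f) :=
  Fintype.sum_sum_type g

/-- The boundary of the fundamental chain of a prism is the sum of the fundamental chains of the
facets with the expected signs. -/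
theorem sBdry_fundChain : (ks : List ℕ) → ks ≠ [] →
    sBdry (fundChain ks) = ∑ f : Facet ks, facetTerm ks f
  | m :: ms, _ => by
    rw [sum_facets_cons, fundChain, sBdry_sMap, sBdry_sCross, map_add, map_sum]
    congr 1
    · refine Finset.sum_congr rfl fun i _ => ?_
      rw [map_smul, sMap_headC, facetTerm_inl]
    · rcases eq_or_ne ms [] with rfl | hms
      · have h₁ : sBdry (fundChain []) = single ⟨0, emptySimp _⟩ 1 := by
          rw [fundChain, bdryOf_single_succ, Fin.sum_univ_one,
            eq_emptySimp (ContinuousMap.comp _ _)]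
          simp only [Fin.val_zero, pow_zero, one_smul]
        rw [h₁, sCross_single_zero, smul_zero, map_zero]
        exact (Finset.sum_eq_zero fun f _ => f.elim).symm
      · rw [sBdry_fundChain ms hms, map_sum, Finset.smul_sum, map_sum]
        refine Finset.sum_congr rfl fun f _ => ?_
        rw [map_smul, facetTerm_inr]

theorem facetTerm_mem (ks : List ℕ) (f : Facet ks) :
    facetTerm ks f ∈ SIn {x | coord ks x f = 0} :=
  Submodule.smul_mem _ _ (sMap_mem_SIn (A := Set.univ)
    (fun x _ => coord_facetPoint_self ks f x) (SIn_univ _))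

theorem sBdry_fundChain_mem (ks : List ℕ) : sBdry (fundChain ks) ∈ SIn (facetUnion ks) := by
  rcases eq_or_ne ks [] with rfl | h
  · rw [fundChain, bdryOf_single_succ]
    refine sum_mem fun i _ => Submodule.smul_mem _ _ ?_
    exact single_mem_SIn (fun t => isEmptyElim (α := Simp 0) t) _
  · rw [sBdry_fundChain ks h]
    exact sum_mem fun f _ =>
      SIn_mono (B := facetUnion ks) (fun x hx => ⟨f, hx⟩) (facetTerm_mem ks f)

/-- The fundamental chain of the facet opposite to the first vertex occurs in the boundary with
sign `+1`; the other facets make up the open box. -/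
theorem sBdry_fundChain_sub_mem (m : ℕ) (ms : List ℕ) :
    sBdry (fundChain (m :: ms)) - sMap (headC m ms 0) (fundChain (decreaseHead m ms))
      ∈ SIn (openBox m ms) := by
  rw [sBdry_fundChain _ (List.cons_ne_nil _ _), sum_facets_cons, Fin.sum_univ_succ,
    facetTerm_inl, Fin.val_zero, pow_zero, one_smul, add_assoc, add_sub_cancel_left]
  refine add_mem (sum_mem fun i _ => ?_) (sum_mem fun f _ => ?_)
  · exact SIn_mono (B := openBox m ms)
      (fun x hx => ⟨_, fun h => Fin.succ_ne_zero i (Sum.inl_injective h), hx⟩) (facetTerm_mem _ _)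
  · exact SIn_mono (B := openBox m ms) (fun x hx => ⟨_, fun h => by simp at h, hx⟩)
      (facetTerm_mem _ _)

/-! ### Relative homology of prisms -/

/-- The augmented singular chains of a point have a contraction, the cone operator. -/
theorem exists_cone_of_unique (P : Type*) [TopologicalSpace P] [Unique P] :
    ∃ c : SChains P →ₗ[ℤ] SChains P, (∀ a, sBdry (c a) = a - c (sBdry a)) ∧
      ∀ σ : C(Simp 0, P), c (single ⟨0, σ⟩ 1) = single ⟨1, ContinuousMap.const _ default⟩ 1 := by
  let φ : SChains P →ₗ[ℤ] Tuples Unit :=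
    chainMap (X := fun n => C(Simp n, P)) (Y := fun n => Fin n → Unit) fun _ _ _ => ()
  let ψ : Tuples Unit →ₗ[ℤ] SChains P :=
    chainMap (X := fun n => Fin n → Unit) (Y := fun n => C(Simp n, P))
      fun _ _ => ContinuousMap.const _ default
  have hψ : ∀ a, sBdry (ψ a) = ψ (tBdry a) := fun a =>
    bdryOf_chainMap (X := fun n => Fin n → Unit) (Y := fun n => C(Simp n, P))
      (fun _ i w => w ∘ i.succAbove) (fun _ i σ => σ.comp (simpMap i.succAbove)) _
      (fun _ _ _ => rfl) a
  have hφ : ∀ a, tBdry (φ a) = φ (sBdry a) := fun a =>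
    bdryOf_chainMap (X := fun n => C(Simp n, P)) (Y := fun n => Fin n → Unit)
      (fun _ i σ => σ.comp (simpMap i.succAbove)) (fun _ i w => w ∘ i.succAbove) _
      (fun _ _ _ => rfl) a
  have hψφ : ∀ a, ψ (φ a) = a := by
    intro a
    have : ψ ∘ₗ φ = LinearMap.id := by
      refine chains_ext fun n σ => ?_
      simp only [LinearMap.comp_apply, φ, ψ, chainMap_single, LinearMap.id_apply]
      congr 2
      exact ContinuousMap.ext fun t => Subsingleton.elim _ _
    exact LinearMap.congr_fun this a
  refine ⟨ψ ∘ₗ cone () ∘ₗ φ, fun a => ?_, fun σ => ?_⟩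
  · simp only [LinearMap.comp_apply]
    rw [hψ, tBdry_cone, map_sub, hψφ, hφ]
  · simp only [LinearMap.comp_apply, φ, ψ, chainMap_single, cone_single]

/-- Since chains are augmented, the chains in the empty set are the multiples of the empty simplex,
and not only zero. -/
theorem exists_smul_of_mem_SIn_empty {P : Type*} [TopologicalSpace P] {a : SChains P}
    (ha : a ∈ SIn (∅ : Set P)) : ∃ k : ℤ, a = k • single ⟨0, emptySimp P⟩ 1 := by
  have : a ∈ Submodule.span ℤ {(single ⟨0, emptySimp P⟩ 1 : SChains P)} := by
    refine SIn_induction LinearMap.id _ (fun n σ hσ => ?_) ha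
    rcases n with _ | n
    · rw [LinearMap.id_apply, eq_emptySimp σ]
      exact Submodule.mem_span_singleton_self _
    · exact (hσ (stdSimplex.vertex 0)).elim
  obtain ⟨k, hk⟩ := Submodule.mem_span_singleton.1 this
  exact ⟨k, hk.symm⟩

instance : Unique (Prism []) := inferInstanceAs (Unique Unit)

theorem facetUnion_nil : facetUnion [] = ∅ :=
  Set.eq_empty_of_forall_notMem fun _ ⟨f, _⟩ => f.elim

/-- The inclusion of the boundary of a prism. -/
def facetUnionIncl (ks : List ℕ) : C(facetUnion ks, Prism ks) :=
  ⟨Subtype.val, continuous_subtype_val⟩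

/-- The facet opposite to the first vertex of the first factor, as a part of the boundary. -/
noncomputable def headFacetC (m : ℕ) (ms : List ℕ) :
    C(Prism (decreaseHead m ms), facetUnion (m :: ms)) :=
  ⟨fun x => ⟨headC m ms 0 x, Sum.inl 0, coord_facetPoint_self (m :: ms) (Sum.inl 0) x⟩,
    (headC m ms 0).continuous.subtype_mk _⟩

/-- The boundary of a prism is obtained from all its facets but one by attaching the last one. -/
theorem nonempty_attachment_headFacet (m : ℕ) (ms : List ℕ) :
    Nonempty (Attachment (headFacetC m ms) (Subtype.val ⁻¹' openBox m ms)
      (facetUnion (decreaseHead m ms))) := by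
  obtain ⟨H, W, hW, hBW, h₀, h₁, h₂⟩ := exists_collar (decreaseHead m ms)
  have hcl : IsClosed (openBox m ms) := by
    have : openBox m ms = ⋃ f : Facet (m :: ms), ⋃ _ : f ≠ Sum.inl 0,
        {x | coord (m :: ms) x f = 0} := by
      ext x
      simp only [openBox, Set.mem_iUnion, exists_prop]
      exact Iff.rfl
    rw [this]
    exact isClosed_iUnion_of_finite fun f => isClosed_iUnion_of_finite fun _ =>
      isClosed_eq (continuous_coord _ f) continuous_const
  have hcl' : IsClosed (Subtype.val ⁻¹' openBox m ms : Set (facetUnion (m :: ms))) :=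
    hcl.preimage continuous_subtype_val
  refine ⟨⟨hcl', ?_, fun p => headFacetPoint_mem_openBox m ms p, ?_, H, W, hW, hBW, h₀, h₁, h₂⟩⟩
  · refine IsClosedMap.isQuotientMap ?_ ?_ ?_
    · exact hcl'.isClosedMap_subtype_val.sumElim (headFacetC m ms).continuous.isClosedMap
    · exact continuous_subtype_val.sumElim (headFacetC m ms).continuous
    · rintro ⟨x, f, hf⟩
      rcases eq_or_ne f (Sum.inl 0) with rfl | hne
      · obtain ⟨y, hy⟩ := exists_facetPoint_eq (m :: ms) (Sum.inl 0) x hf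
        exact ⟨Sum.inr y, Subtype.ext (a1 := headFacetC m ms y) hy⟩
      · exact ⟨Sum.inl ⟨⟨x, f, hf⟩, f, hne, hf⟩, rfl⟩
  · intro p p' _ _ h
    exact facetPoint_injective (m :: ms) (Sum.inl 0) (Subtype.ext_iff.1 h)

/-- The homology of a prism relative to its boundary is freely generated by the fundamental
chain. The proof is by induction on the dimension: the prism retracts onto the union of all its
facets but one, and relative to this union the boundary has the homology of the remaining facet
relative to its own boundary. -/
theorem relHomology_prism (n : ℕ) : ∀ ks : List ℕ, dim ks = n →
    (∀ z : SChains (Prism ks), sBdry z ∈ SIn (facetUnion ks) →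
      ∃ w, ∃ k : ℤ, z - sBdry w - k • fundChain ks ∈ SIn (facetUnion ks)) ∧
    ∀ (k : ℤ) (w : SChains (Prism ks)), k • fundChain ks - sBdry w ∈ SIn (facetUnion ks) →
      k = 0 := by
  induction n with
  | zero =>
    rintro (_ | ⟨m, ms⟩) hks
    · rw [facetUnion_nil]
      constructor
      · intro z hz
        obtain ⟨c, hc, hc₀⟩ := exists_cone_of_unique (Prism [])
        obtain ⟨k, hk⟩ := exists_smul_of_mem_SIn_empty hz
        refine ⟨c z, k, ?_⟩
        rw [hc, hk, map_smul, hc₀, sub_sub_cancel]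
        have : fundChain [] = single ⟨1, ContinuousMap.const _ default⟩ 1 := rfl
        rw [this, sub_self]
        exact zero_mem _
      · intro k w h
        obtain ⟨l, hl⟩ := exists_smul_of_mem_SIn_empty h
        have := congrArg sBdry hl
        rw [map_sub, map_smul, map_smul, sBdry_sBdry, sub_zero, bdryOf_single_zero, smul_zero,
          fundChain, bdryOf_single_succ, Fin.sum_univ_one] at this
        simpa using this
    · simp [dim] at hks
  | succ n ih =>
    rintro (_ | ⟨m, ms⟩) hks
    · simp [dim] at hks
    have hdim : dim (decreaseHead m ms) = n := by
      have := dim_facetShape_add_one (m :: ms) (Sum.inl 0)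
      change dim (decreaseHead m ms) + 1 = _ at this
      omega
    obtain ⟨ih₁, ih₂⟩ := ih _ hdim
    obtain ⟨att⟩ := nonempty_attachment_headFacet m ms
    set ι := facetUnionIncl (m :: ms)
    set Φ := headFacetC m ms
    have hι : Function.Injective ι := Subtype.val_injective
    have hιΦ : ∀ c, sMap ι (sMap Φ c) = sMap (headC m ms 0) c := fun c => by
      rw [sMap_sMap]; rfl
    have hlift : ∀ b ∈ SIn (facetUnion (m :: ms)), ∃ a, sMap ι a = b := fun b hb => by
      obtain ⟨a, -, ha⟩ := exists_sMap_eq_of_isEmbedding (f := ι) IsEmbedding.subtypeVal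
        (fun x hx => ⟨⟨x, hx⟩, rfl⟩) hb
      exact ⟨a, ha⟩
    have hsub := sBdry_fundChain_sub_mem m ms
    constructor
    · intro z hz
      obtain ⟨y, hy⟩ := hlift _ hz
      have hy0 : sBdry y = 0 := sMap_injective hι (by
        rw [← sBdry_sMap, hy, sBdry_sBdry, map_zero])
      -- modulo the open box, the boundary of `z` is a multiple of the facet left out
      obtain ⟨w, v, hv, hyv⟩ := att.exists_relCycle (z := y) (by rw [hy0]; exact zero_mem _)
      obtain ⟨w₂, k, hk⟩ := ih₁ v hv
      obtain ⟨H, h₀, h₁, h₂⟩ := exists_retraction m ms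
      have hR : sBdry (z - sMap ι (w + sMap Φ w₂) - k • fundChain (m :: ms))
          ∈ SIn (openBox m ms) := by
        have e : sBdry (z - sMap ι (w + sMap Φ w₂) - k • fundChain (m :: ms))
            = sMap ι (y - sBdry w - sMap Φ v) + sMap ι (sMap Φ (v - sBdry w₂
              - k • fundChain (decreaseHead m ms)))
              - k • (sBdry (fundChain (m :: ms)) - sMap (headC m ms 0)
                (fundChain (decreaseHead m ms))) := by
          rw [← hιΦ]
          simp only [map_sub, map_add, map_smul, hy, sBdry_sMap, smul_sub]
          abel
        rw [e]
        refine sub_mem (add_mem (sMap_mem_SIn (fun x hx => hx) hyv)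
          (sMap_mem_SIn (fun x hx => hx) (sMap_mem_SIn (fun x hx => (att.mem_iff x).2 hx) hk)))
          (Submodule.smul_mem _ _ hsub)
      -- what remains is a relative cycle modulo the open box, onto which the prism retracts
      obtain ⟨w₃, hw₃⟩ := exists_sub_sBdry_mem_of_homotopy H h₀
        (fun τ a ha => by rw [h₁ τ a ha]; exact ha) h₂ hR
      refine ⟨w₃, k, ?_⟩
      have e : z - sBdry w₃ - k • fundChain (m :: ms)
          = (z - sMap ι (w + sMap Φ w₂) - k • fundChain (m :: ms) - sBdry w₃)
            + sMap ι (w + sMap Φ w₂) := by abel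
      rw [e]
      exact add_mem (SIn_mono (openBox_subset m ms) hw₃)
        (sMap_mem_SIn (A := Set.univ) (fun x _ => x.2) (SIn_univ _))
    · intro k w h
      obtain ⟨b, hb⟩ := hlift _ h
      have hbd : sMap ι (sBdry b) = k • sBdry (fundChain (m :: ms)) := by
        rw [← sBdry_sMap, hb, map_sub, sBdry_sBdry, sub_zero, map_smul]
      -- the boundary of `b` exhibits `k` times the facet left out as a relative boundary
      obtain ⟨w', hw'⟩ := att.exists_relBoundary (v := k • fundChain (decreaseHead m ms))
        (w := b) (by rw [map_smul]; exact Submodule.smul_mem _ _ (sBdry_fundChain_mem _)) (by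
          refine mem_SIn_of_sMap (f := ι) hι ?_
          have e : sMap ι (sMap Φ (k • fundChain (decreaseHead m ms)) - sBdry b)
              = - (k • (sBdry (fundChain (m :: ms)) - sMap (headC m ms 0)
                (fundChain (decreaseHead m ms)))) := by
            rw [map_sub, hbd, hιΦ, map_smul, smul_sub]
            abel
          rw [e]
          exact neg_mem (Submodule.smul_mem _ _ hsub))
      exact ih₂ k w' hw'

end Prismatic

namespace Prismatic

/-! ### Good labelings of facets -/

section Tuples

variable {G : Type u}

/-- A tuple as a sequence, continued arbitrarily. -/
def toSeq {m : ℕ} (g : Fin (m + 1) → G) (n : ℕ) : G :=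
  if h : n < m + 1 then g ⟨n, h⟩ else g 0

theorem toSeq_val {m : ℕ} (g : Fin (m + 1) → G) (i : Fin (m + 1)) : toSeq g i = g i :=
  dif_pos i.2

theorem toSeq_of_lt {m : ℕ} (g : Fin (m + 1) → G) {n : ℕ} (h : n < m + 1) :
    toSeq g n = g ⟨n, h⟩ := dif_pos h

theorem take_succ_ofFn {m : ℕ} (g : Fin (m + 1) → G) {p : ℕ} (h : p < m + 1) :
    (List.ofFn g).take (p + 1) = (List.ofFn g).take p ++ [toSeq g p] := by
  rw [List.take_add_one, List.getElem?_eq_getElem (by simpa using h), List.getElem_ofFn,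
    toSeq_of_lt g h]
  rfl

theorem vertexWord_baseVertex : (ks : List ℕ) → (g : Label G ks) →
    vertexWord ks g (baseVertex ks) = []
  | [], _ => rfl
  | _ :: ms, (_, gs) => vertexWord_baseVertex ms gs

end Tuples

section Sequences

variable {G : Type u} [Shalgebra G]

/-- The product `h p ⋯ h (p + d)`. -/
def prodFrom (h : ℕ → G) (p : ℕ) : ℕ → G
  | 0 => h p
  | d + 1 => prodFrom h p d * h (p + d + 1)

/-- The result of letting `h 0, …, h (p - 1)` act on `a` in turn. -/
def actPrefix (h : ℕ → G) (a : G) : ℕ → G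
  | 0 => a
  | p + 1 => actPrefix h a p ⊲ h p

/-- The face operation on sequences: the entries number `i - 1` and `i` are multiplied, or the
first entry is dropped if `i = 0`. -/
def seqFace (i : ℕ) (h : ℕ → G) (n : ℕ) : G :=
  if n + 1 < i then h n else if n + 1 = i then h n * h (n + 1) else h (n + 1)

/-- The order preserving injection of natural numbers that omits `i`. -/
def skip (i p : ℕ) : ℕ := if p < i then p else p + 1

/-- Passing to a face does not change the products along its edges, by associativity. -/
theorem prodFrom_seqFace (i : ℕ) (h : ℕ → G) (p d : ℕ) :
    prodFrom (seqFace i h) p d = prodFrom h (skip i p) (skip i (p + d + 1) - skip i p - 1) := by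
  induction d with
  | zero =>
    rcases lt_trichotomy (p + 1) i with hp | hp | hp
    · have h₁ : skip i p = p := if_pos (by omega)
      have h₂ : skip i (p + 0 + 1) = p + 1 := if_pos (by omega)
      rw [h₁, h₂, show p + 1 - p - 1 = 0 by omega, prodFrom, prodFrom, seqFace, if_pos hp]
    · have h₁ : skip i p = p := if_pos (by omega)
      have h₂ : skip i (p + 0 + 1) = p + 2 := if_neg (by omega)
      rw [h₁, h₂, show p + 2 - p - 1 = 0 + 1 by omega, prodFrom, prodFrom, prodFrom, seqFace,
        if_neg (by omega), if_pos hp]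
    · have h₁ : skip i p = p + 1 := if_neg (by omega)
      have h₂ : skip i (p + 0 + 1) = p + 2 := if_neg (by omega)
      rw [h₁, h₂, show p + 2 - (p + 1) - 1 = 0 by omega, prodFrom, prodFrom, seqFace,
        if_neg (by omega), if_neg (by omega)]
  | succ d ih =>
    rw [prodFrom, ih]
    rcases lt_trichotomy (p + d + 1 + 1) i with hp | hp | hp
    · have h₁ : skip i p = p := if_pos (by omega)
      have h₂ : skip i (p + d + 1) = p + d + 1 := if_pos (by omega)
      have h₃ : skip i (p + (d + 1) + 1) = p + d + 2 := if_pos (by omega)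
      rw [h₁, h₂, h₃, show p + d + 1 - p - 1 = d by omega,
        show p + d + 2 - p - 1 = d + 1 by omega, prodFrom, seqFace, if_pos hp]
    · have h₁ : skip i p = p := if_pos (by omega)
      have h₂ : skip i (p + d + 1) = p + d + 1 := if_pos (by omega)
      have h₃ : skip i (p + (d + 1) + 1) = p + d + 3 := if_neg (by omega)
      rw [h₁, h₂, h₃, show p + d + 1 - p - 1 = d by omega,
        show p + d + 3 - p - 1 = d + 1 + 1 by omega, prodFrom, prodFrom, seqFace,
        if_neg (by omega), if_pos hp, mul_assoc]
      rfl
    · have h₂ : skip i (p + d + 1) = p + d + 2 := if_neg (by omega)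
      have h₃ : skip i (p + (d + 1) + 1) = p + d + 3 := if_neg (by omega)
      rw [h₂, h₃, seqFace, if_neg (by omega), if_neg (by omega)]
      have h₁ : skip i p ≤ p + 1 := by unfold skip; split_ifs <;> omega
      obtain ⟨e, he⟩ : ∃ e, p + d + 2 - skip i p - 1 = e := ⟨_, rfl⟩
      rw [he, show p + d + 3 - skip i p - 1 = e + 1 by omega, prodFrom]
      congr 2
      omega

/-- Passing to a face does not change the action of the words of its vertices, by the axiom
`(a ⊲ b) ⊲ c = a ⊲ (b * c)`, provided that the acted element absorbs a dropped first entry. -/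
theorem actPrefix_skip (i : ℕ) (h : ℕ → G) (a : G) (p : ℕ) :
    actPrefix h a (skip i p) = actPrefix (seqFace i h) (if i = 0 then a ⊲ h 0 else a) p := by
  induction p with
  | zero =>
    rcases Nat.eq_zero_or_pos i with rfl | hi
    · rfl
    · rw [show skip i 0 = 0 from if_pos hi, if_neg hi.ne']
      rfl
  | succ p ih =>
    rw [actPrefix, ← ih]
    rcases lt_trichotomy (p + 1) i with hp | hp | hp
    · rw [show skip i (p + 1) = p + 1 from if_pos hp, show skip i p = p from if_pos (by omega),
        seqFace, if_pos hp, actPrefix]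
    · rw [show skip i (p + 1) = p + 1 + 1 from if_neg (by omega),
        show skip i p = p from if_pos (by omega),
        seqFace, if_neg (by omega), if_pos hp, actPrefix, actPrefix, Shalgebra.act_act_eq_act_mul]
    · rw [show skip i (p + 1) = p + 1 + 1 from if_neg (by omega),
        show skip i p = p + 1 from if_neg (by omega),
        seqFace, if_neg (by omega), if_neg (by omega), actPrefix]

theorem prodFrom_congr {h h' : ℕ → G} {p d : ℕ} (e : ∀ n ≤ p + d, h n = h' n) :
    prodFrom h p d = prodFrom h' p d := by
  induction d with
  | zero => exact e p le_rfl
  | succ d ih => rw [prodFrom, prodFrom, ih fun n hn => e n (by omega), e _ (by omega)]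

theorem actPrefix_congr {h h' : ℕ → G} {a : G} {p : ℕ} (e : ∀ n < p, h n = h' n) :
    actPrefix h a p = actPrefix h' a p := by
  induction p with
  | zero => rfl
  | succ p ih => rw [actPrefix, actPrefix, ih fun n hn => e n (by omega), e _ (by omega)]

theorem actWord_eq_foldl (a : G) (l : List G) : actWord a l = l.foldl (· ⊲ ·) a := by
  cases l with
  | nil => rfl
  | cons b bs =>
    rw [actWord, List.foldl_cons]
    induction bs generalizing b with
    | nil => rfl
    | cons c cs ih => rw [List.foldl_cons, List.foldl_cons, ih, Shalgebra.act_act_eq_act_mul]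

theorem foldl_take_ofFn {m : ℕ} (g : Fin (m + 1) → G) (a : G) {p : ℕ} (hp : p ≤ m + 1) :
    ((List.ofFn g).take p).foldl (· ⊲ ·) a = actPrefix (toSeq g) a p := by
  induction p with
  | zero => rfl
  | succ p ih =>
    rw [take_succ_ofFn g (by omega), List.foldl_append, ih (by omega)]
    rfl

theorem edgeProd_eq_prodFrom {m : ℕ} (g : Fin (m + 1) → G)
    (e : {e : Fin (m + 2) × Fin (m + 2) // e.1 < e.2}) :
    edgeProd g e = prodFrom (toSeq g) e.1.1 (e.1.2 - e.1.1 - 1) := by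
  obtain ⟨⟨⟨p, hp⟩, ⟨p', hp'⟩⟩, hlt⟩ := e
  have hlt' : p < p' := hlt
  have hpm : p < m + 1 := by omega
  change (((List.ofFn g).take p').drop (p + 1)).foldl (· * ·) (g ⟨p, hpm⟩) = _
  change _ = prodFrom (toSeq g) p (p' - p - 1)
  obtain ⟨d, rfl⟩ : ∃ d, p' = p + d + 1 := ⟨p' - p - 1, by omega⟩
  rw [show p + d + 1 - p - 1 = d by omega]
  have hpd : p + d + 1 < m + 2 := hp'
  clear hlt hlt' hp'
  induction d with
  | zero =>
    rw [List.drop_eq_nil_of_le (by simp)]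
    exact (toSeq_of_lt g _).symm
  | succ d ih =>
    have h' : ((List.ofFn g).take (p + (d + 1))).drop (p + 1)
        = ((List.ofFn g).take (p + d + 1)).drop (p + 1) := rfl
    rw [take_succ_ofFn g (p := p + (d + 1)) (by omega), List.drop_append_of_le_length, h',
      List.foldl_append, ih (by omega)]
    · rfl
    · simp only [List.length_take, List.length_ofFn]
      omega

theorem blockFace_apply {m : ℕ} (i : Fin (m + 2)) (g : Fin (m + 1) → G) (k : Fin m) :
    blockFace i g k = if (k : ℕ) + 1 < i then g k.castSucc else
      if (k : ℕ) + 1 = i then g k.castSucc * g k.succ else g k.succ := by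
  refine Fin.cases ?_ (fun i => ?_) i
  · simp [blockFace, Fin.tail]
  · simp only [blockFace, Fin.cases_succ, Fin.contractNth, Fin.val_succ, add_lt_add_iff_right,
      add_left_inj]

theorem toSeq_blockFace {m : ℕ} (i : Fin (m + 3)) (g : Fin (m + 2) → G) {n : ℕ} (hn : n < m + 1) :
    toSeq (blockFace i g) n = seqFace i (toSeq g) n := by
  rw [toSeq_of_lt _ hn, blockFace_apply, seqFace, toSeq_of_lt g (show n < m + 1 + 1 by omega),
    toSeq_of_lt g (show n + 1 < m + 1 + 1 by omega)]
  rfl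

theorem val_succAbove_eq_skip {n : ℕ} (i : Fin (n + 1)) (p : Fin n) :
    (i.succAbove p : ℕ) = skip i p := by
  rw [Fin.succAbove, skip]
  simp only [Fin.lt_def, Fin.val_castSucc]
  split_ifs <;> rfl

theorem edgeProd_blockFace {m : ℕ} (i : Fin (m + 3)) (g : Fin (m + 2) → G)
    (e : {e : Fin (m + 2) × Fin (m + 2) // e.1 < e.2}) :
    edgeProd g ⟨(i.succAbove e.1.1, i.succAbove e.1.2), i.strictMono_succAbove e.2⟩
      = edgeProd (blockFace i g) e := by
  obtain ⟨⟨p, p'⟩, hlt⟩ := e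
  have hlt' : (p : ℕ) < p' := hlt
  rw [edgeProd_eq_prodFrom, edgeProd_eq_prodFrom]
  change prodFrom _ (i.succAbove p : ℕ) ((i.succAbove p' : ℕ) - (i.succAbove p : ℕ) - 1)
    = prodFrom _ (p : ℕ) ((p' : ℕ) - p - 1)
  rw [prodFrom_congr (h := toSeq (blockFace i g)) (h' := seqFace i (toSeq g))
    (fun n hn => toSeq_blockFace i g (by omega)), prodFrom_seqFace, val_succAbove_eq_skip,
    val_succAbove_eq_skip, show (p : ℕ) + ((p' : ℕ) - p - 1) + 1 = p' by omega]

/-- The action of at most one element. -/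
def actOption (t : G) : Option G → G
  | none => t
  | some a => t ⊲ a

theorem actTuple_apply {m : ℕ} (g : Fin m → G) (a : Option G) (t : Fin m) :
    actTuple g a t = actOption (g t) a := by
  cases a <;> rfl

theorem actOption_mul (s t : G) (a : Option G) :
    actOption (s * t) a = actOption s a * actOption t a := by
  cases a with
  | none => rfl
  | some a => exact Shalgebra.mul_act s t a

theorem edgeProd_actTuple {m : ℕ} (g : Fin (m + 1) → G) (a : Option G)
    (e : {e : Fin (m + 2) × Fin (m + 2) // e.1 < e.2}) :
    edgeProd (actTuple g a) e = actOption (edgeProd g e) a := by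
  have hs : ∀ n, toSeq (actTuple g a) n = actOption (toSeq g n) a := fun n => by
    unfold toSeq
    split_ifs <;> exact actTuple_apply _ _ _
  rw [edgeProd_eq_prodFrom, edgeProd_eq_prodFrom]
  generalize (e.1.2 : ℕ) - e.1.1 - 1 = d
  induction d with
  | zero => exact hs _
  | succ d ih => rw [prodFrom, prodFrom, ih, hs, actOption_mul]

end Sequences

section Labelings

variable {G : Type u} [Shalgebra G]

/-- Restricting to a facet changes the word of a vertex only by the acting element of the
facet. -/
theorem actWord_vertexWord_facetVertex : (ks : List ℕ) → (f : Facet ks) → (g : Label G ks) →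
    (v : Vertex (facetShape ks f)) → (a : G) →
    actWord a (vertexWord ks g (facetVertex ks f v))
      = actWord (actOption a (faceActor ks f g)) (vertexWord _ (face ks f g) v)
  | 0 :: ms, Sum.inl i, (g, gs), v, a => by
    change actWord a ((List.ofFn g).take (i.succAbove 0 : Fin 2) ++ vertexWord ms gs v)
      = actWord (actOption a (if i = 0 then some (g 0) else none)) (vertexWord ms gs v)
    rw [actWord_eq_foldl, actWord_eq_foldl, List.foldl_append]
    congr 1
    fin_cases i <;> simp [actOption, List.ofFn_succ]
  | (m + 1) :: ms, Sum.inl i, (g, gs), (p, v), a => by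
    change actWord a ((List.ofFn g).take (i.succAbove p : Fin (m + 3)) ++ vertexWord ms gs v)
      = actWord (actOption a (if i = 0 then some (g 0) else none))
        ((List.ofFn (blockFace i g)).take p ++ vertexWord ms gs v)
    rw [actWord_eq_foldl, actWord_eq_foldl, List.foldl_append, List.foldl_append,
      foldl_take_ofFn _ _ (by omega), foldl_take_ofFn _ _ (by omega)]
    congr 1
    rw [val_succAbove_eq_skip, actPrefix_skip, actPrefix_congr (h := toSeq (blockFace i g))
      (h' := seqFace i (toSeq g)) (fun n hn => toSeq_blockFace i g (by omega))]
    congr 1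
    by_cases hi : i = 0
    · subst hi; rfl
    · rw [if_neg hi, if_neg (fun h : (i : ℕ) = 0 => hi (Fin.ext h))]; rfl
  | m :: ms, Sum.inr f, (g, gs), (p, v), a => by
    change actWord a ((List.ofFn g).take p ++ vertexWord ms gs (facetVertex ms f v))
      = actWord (actOption a (faceActor ms f gs))
        ((List.ofFn (actTuple g (faceActor ms f gs))).take p ++ vertexWord _ (face ms f gs) v)
    have ih := actWord_vertexWord_facetVertex ms f gs v
    simp only [actWord_eq_foldl] at ih ⊢
    rw [List.foldl_append, List.foldl_append, ih]
    congr 1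
    have hl : ∀ (l : List G) (t : G), actOption (l.foldl (· ⊲ ·) t) (faceActor ms f gs)
        = (l.map (fun x => actOption x (faceActor ms f gs))).foldl (· ⊲ ·)
            (actOption t (faceActor ms f gs)) := by
      intro l
      induction l with
      | nil => intro t; rfl
      | cons b bs ih =>
        intro t
        rw [List.foldl_cons, ih, List.map_cons, List.foldl_cons]
        congr 1
        cases faceActor ms f gs with
        | none => rfl
        | some c => exact Shalgebra.self_distrib t b c
    rw [hl, List.map_take, List.map_ofFn]
    have : (fun x => actOption x (faceActor ms f gs)) ∘ g = actTuple g (faceActor ms f gs) :=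
      funext fun t => (actTuple_apply _ _ _).symm
    rw [this]

/-- An edge of a facet has the same label in the prism and in the face. -/
theorem goodLabeling_facetEdge_apply : (ks : List ℕ) → (f : Facet ks) → (g : Label G ks) →
    (e : Edge (facetShape ks f)) →
    goodLabeling ks g (facetEdge ks f e) = goodLabeling (facetShape ks f) (face ks f g) e
  | 0 :: _, Sum.inl _, (_, _), _ => rfl
  | (_ + 1) :: ms, Sum.inl i, (g, gs), Sum.inl (e, v) =>
    congrArg (fun t => actWord t (vertexWord ms gs v)) (edgeProd_blockFace i g e)
  | (_ + 1) :: _, Sum.inl _, (_, _), Sum.inr (_, _) => rfl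
  | _ :: ms, Sum.inr f, (g, gs), Sum.inl (e, v) => by
    change actWord (edgeProd g e) (vertexWord ms gs (facetVertex ms f v))
      = actWord (edgeProd (actTuple g (faceActor ms f gs)) e) (vertexWord _ (face ms f gs) v)
    rw [actWord_vertexWord_facetVertex, edgeProd_actTuple]
  | _ :: ms, Sum.inr f, (_, gs), Sum.inr (_, e) => goodLabeling_facetEdge_apply ms f gs e

/-- The labeling that a good labeling induces on a facet is the good labeling of the face. -/
theorem goodLabeling_comp_facetEdge (ks : List ℕ) (f : Facet ks) (g : Label G ks) :
    goodLabeling ks g ∘ facetEdge ks f = goodLabeling (facetShape ks f) (face ks f g) :=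
  funext (goodLabeling_facetEdge_apply ks f g)

/-- A bracketed tuple is determined by its good labeling: its entries are the labels of the edges
of length one through the base vertices of the other factors. -/
theorem goodLabeling_injective : (ks : List ℕ) →
    Function.Injective (goodLabeling (G := G) ks)
  | [] => fun _ _ _ => rfl
  | m :: ms => by
    rintro ⟨g, gs⟩ ⟨g', gs'⟩ h
    refine Prod.ext (funext fun t => ?_) (goodLabeling_injective ms (funext fun e => ?_))
    · have := congrFun h (Sum.inl (⟨(t.castSucc, t.succ), Fin.castSucc_lt_succ⟩, baseVertex ms))
      change actWord (edgeProd g _) (vertexWord ms gs _)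
        = actWord (edgeProd g' _) (vertexWord ms gs' _) at this
      rw [vertexWord_baseVertex, vertexWord_baseVertex, edgeProd_eq_prodFrom,
        edgeProd_eq_prodFrom] at this
      have hd : (t.succ : ℕ) - (t.castSucc : ℕ) - 1 = 0 := by simp
      change prodFrom (toSeq g) (t.castSucc : ℕ) ((t.succ : ℕ) - (t.castSucc : ℕ) - 1)
        = prodFrom (toSeq g') (t.castSucc : ℕ) ((t.succ : ℕ) - (t.castSucc : ℕ) - 1) at this
      rw [hd] at this
      exact (toSeq_val g t).symm.trans (this.trans (toSeq_val g' t))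
    · exact congrFun h (Sum.inr (0, e))

end Labelings

end Prismatic

namespace Prismatic

/-! ### Iterated facets and the open cells of the classifying space -/

/-- The faces of arbitrary codimension of the prism `Δ^{ks}` that are prisms of shape `ks'`: each
factor of the face is either a single vertex, and is then dropped from the shape, or is spanned by
at least two vertices, listed in increasing order. -/
inductive SubPrism : List ℕ → List ℕ → Type
  | nil : SubPrism [] []
  | drop {ks' ms : List ℕ} {m : ℕ} (p : Fin (m + 2)) (F : SubPrism ks' ms) :
      SubPrism ks' (m :: ms)
  | keep {ks' ms : List ℕ} {r m : ℕ} (s : Fin (r + 2) → Fin (m + 2)) (hs : StrictMono s)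
      (F : SubPrism ks' ms) : SubPrism (r :: ks') (m :: ms)

namespace SubPrism

/-- The inclusion of a face on vertices. -/
def vertex : {ks' ks : List ℕ} → SubPrism ks' ks → Vertex ks' → Vertex ks
  | _, _, nil, v => v
  | _, _, drop p F, v => (p, F.vertex v)
  | _, _, keep s _ F, (p, v) => (s p, F.vertex v)

/-- The inclusion of a face on edges. -/
def edge : {ks' ks : List ℕ} → SubPrism ks' ks → Edge ks' → Edge ks
  | _, _, nil, e => e
  | _, _, drop p F, e => Sum.inr (p, F.edge e)
  | _, _, keep s hs F, Sum.inl (e, v) =>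
    Sum.inl (⟨(s e.1.1, s e.1.2), hs e.2⟩, F.vertex v)
  | _, _, keep s _ F, Sum.inr (p, e) => Sum.inr (s p, F.edge e)

/-- The inclusion of a face on points. -/
noncomputable def point : {ks' ks : List ℕ} → SubPrism ks' ks → Prism ks' → Prism ks
  | _, _, nil, x => x
  | _, _, drop p F, x => (stdSimplex.vertex (S := ℝ) p, F.point x)
  | _, _, keep s _ F, (x, y) => (simpMap s x, F.point y)

/-- The whole prism as a face of itself. -/
def refl : (ks : List ℕ) → SubPrism ks ks
  | [] => nil
  | _ :: ms => keep id strictMono_id (refl ms)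

theorem vertex_refl : (ks : List ℕ) → (v : Vertex ks) → (refl ks).vertex v = v
  | [], _ => rfl
  | _ :: ms, (_, v) => Prod.ext rfl (vertex_refl ms v)

theorem edge_refl : (ks : List ℕ) → (e : Edge ks) → (refl ks).edge e = e
  | _ :: ms, Sum.inl (e, v) =>
    congrArg (fun w => (Sum.inl (e, w) : _ ⊕ _)) (vertex_refl ms v)
  | _ :: ms, Sum.inr (p, e) => congrArg (fun w => (Sum.inr (p, w) : _ ⊕ _)) (edge_refl ms e)

theorem point_refl : (ks : List ℕ) → (x : Prism ks) → (refl ks).point x = x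
  | [], _ => rfl
  | m :: ms, (x, y) => Prod.ext (DFunLike.congr_fun (simpMap_id (m + 2)) x) (point_refl ms y)

theorem dim_le : {ks' ks : List ℕ} → SubPrism ks' ks → dim ks' ≤ dim ks
  | _, _, nil => le_rfl
  | _, _, drop _ F => F.dim_le.trans (Nat.le_add_left _ _)
  | _, _, keep _ hs F => by
    have := Fintype.card_le_of_injective _ hs.injective
    simp only [Fintype.card_fin] at this
    have := F.dim_le
    simp only [dim]
    omega

/-- A face of a facet is a face. -/
theorem exists_trans_facet : (ks : List ℕ) → (f : Facet ks) → (ks' : List ℕ) →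
    (F : SubPrism ks' (facetShape ks f)) →
    ∃ F' : SubPrism ks' ks, (∀ v, F'.vertex v = facetVertex ks f (F.vertex v)) ∧
      (∀ e, F'.edge e = facetEdge ks f (F.edge e)) ∧
      ∀ x, F'.point x = facetPoint ks f (F.point x)
  | 0 :: _, Sum.inl i, _, F =>
    ⟨drop (i.succAbove 0) F, fun _ => rfl, fun _ => rfl, fun _ => Prod.ext
      (stdSimplex.map_vertex (S := ℝ) i.succAbove 0).symm rfl⟩
  | (m + 1) :: ms, Sum.inl i, ks', F => by
    change SubPrism ks' (m :: ms) at F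
    cases F with
    | drop p F =>
      exact ⟨drop (i.succAbove p) F, fun _ => rfl, fun _ => rfl, fun _ => Prod.ext
        (stdSimplex.map_vertex (S := ℝ) i.succAbove p).symm rfl⟩
    | keep s hs F =>
      refine ⟨keep (i.succAbove ∘ s) ((Fin.strictMono_succAbove i).comp hs) F, fun _ => rfl, ?_, ?_⟩
      · rintro (_ | _) <;> rfl
      · rintro ⟨x, y⟩
        exact Prod.ext (DFunLike.congr_fun (simpMap_comp s i.succAbove) x).symm rfl
  | m :: ms, Sum.inr f, ks', F => by
    change SubPrism ks' (m :: facetShape ms f) at F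
    cases F with
    | drop p F =>
      obtain ⟨F', h₁, h₂, h₃⟩ := exists_trans_facet ms f ks' F
      exact ⟨drop p F', fun v => Prod.ext rfl (h₁ v),
        fun e => congrArg (fun w => (Sum.inr (p, w) : _ ⊕ _)) (h₂ e),
        fun x => Prod.ext rfl (h₃ x)⟩
    | @keep ks' _ r _ s hs F =>
      obtain ⟨F', h₁, h₂, h₃⟩ := exists_trans_facet ms f ks' F
      refine ⟨keep s hs F', fun v => Prod.ext rfl (h₁ v.2), ?_, fun x => Prod.ext rfl (h₃ x.2)⟩
      rintro (⟨e, v⟩ | ⟨p, e⟩)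
      · exact congrArg (fun w => (Sum.inl (_, w) : _ ⊕ _)) (h₁ v)
      · exact congrArg (fun w => (Sum.inr (s p, w) : _ ⊕ _)) (h₂ e)

end SubPrism

theorem simpMap_ne_zero_iff {a n : ℕ} {s : Fin a → Fin n} (hs : Function.Injective s) {x : Simp a}
    (hx : ∀ i, x i ≠ 0) (j : Fin n) : simpMap s x j ≠ 0 ↔ j ∈ Set.range s := by
  constructor
  · intro h
    by_contra hj
    apply h
    change FunOnFinite.linearMap ℝ ℝ s x j = 0
    rw [FunOnFinite.linearMap_apply_apply, Finset.filter_false_of_mem]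
    · rfl
    · exact fun i _ hi => hj ⟨i, hi⟩
  · rintro ⟨i, rfl⟩
    rw [simpMap_apply_of_injective hs]
    exact hx i

theorem range_eq_of_simpMap_eq {a b n : ℕ} {s : Fin a → Fin n} {s' : Fin b → Fin n}
    (hs : StrictMono s) (hs' : StrictMono s') {x : Simp a} {x' : Simp b}
    (hx : ∀ i, x i ≠ 0) (hx' : ∀ i, x' i ≠ 0) (h : simpMap s x = simpMap s' x') :
    Set.range s = Set.range s' := by
  ext j
  rw [← simpMap_ne_zero_iff hs.injective hx, h, simpMap_ne_zero_iff hs'.injective hx']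

theorem card_eq_of_simpMap_eq {a b n : ℕ} {s : Fin a → Fin n} {s' : Fin b → Fin n}
    (hs : StrictMono s) (hs' : StrictMono s') {x : Simp a} {x' : Simp b}
    (hx : ∀ i, x i ≠ 0) (hx' : ∀ i, x' i ≠ 0) (h : simpMap s x = simpMap s' x') : a = b := by
  have := congrArg Set.ncard (range_eq_of_simpMap_eq hs hs' hx hx' h)
  rwa [Set.ncard_range_of_injective hs.injective, Set.ncard_range_of_injective hs'.injective,
    Nat.card_fin, Nat.card_fin] at this

theorem vertex_ne_simpMap {r n : ℕ} {s : Fin (r + 2) → Fin n} (hs : StrictMono s)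
    {x : Simp (r + 2)} (hx : ∀ i, x i ≠ 0) (p : Fin n) :
    (stdSimplex.vertex p : Simp n) ≠ simpMap s x := by
  intro h
  have h' : simpMap (fun _ : Fin 1 => p) (stdSimplex.vertex 0) = simpMap s x :=
    (stdSimplex.map_vertex (S := ℝ) (fun _ : Fin 1 => p) 0).trans h
  have := card_eq_of_simpMap_eq (Subsingleton.strictMono _) hs (fun i => ?_) hx h'
  · omega
  · rw [Subsingleton.elim i 0]
    simp

/-- A point of a prism lies in the interior of at most one face: the face is spanned in each factor
by the vertices at which the barycentric coordinates of the point do not vanish. -/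
theorem SubPrism.eq_of_point_eq {ks' ks : List ℕ} (F : SubPrism ks' ks) :
    ∀ {x' : Prism ks'}, x' ∉ facetUnion ks' → ∀ {ks'' : List ℕ} (F' : SubPrism ks'' ks)
      {x'' : Prism ks''}, x'' ∉ facetUnion ks'' → F.point x' = F'.point x'' →
      (⟨ks', F, x'⟩ : Σ l, SubPrism l ks × Prism l) = ⟨ks'', F', x''⟩ := by
  induction F with
  | nil =>
    intro x' _ ks'' F' x'' _ _
    cases F'
    rfl
  | @drop ks' ms m p F ih =>
    intro x' hx' ks'' F' x'' hx'' h
    cases F' with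
    | drop p' F' =>
      have h' : ((stdSimplex.vertex (S := ℝ) p, F.point x') : Simp (m + 2) × Prism ms)
        = (stdSimplex.vertex p', F'.point x'') := h
      obtain rfl : p = p' := by
        by_contra hp
        have := congrArg (fun z : Simp (m + 2) => z p) (Prod.ext_iff.1 h').1
        simp [hp] at this
      cases ih hx' F' hx'' (Prod.ext_iff.1 h').2
      rfl
    | keep s hs F' =>
      have h' : ((stdSimplex.vertex (S := ℝ) p, F.point x') : Simp (m + 2) × Prism ms)
        = (simpMap s x''.1, F'.point x''.2) := h
      exact absurd (Prod.ext_iff.1 h').1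
        (vertex_ne_simpMap hs (fun i hi => hx'' ⟨Sum.inl i, hi⟩) p)
  | @keep ks' ms r m s hs F ih =>
    intro x' hx' ks'' F' x'' hx'' h
    cases F' with
    | drop p' F' =>
      have h' : ((simpMap s x'.1, F.point x'.2) : Simp (m + 2) × Prism ms)
        = (stdSimplex.vertex p', F'.point x'') := h
      exact absurd (Prod.ext_iff.1 h').1.symm
        (vertex_ne_simpMap hs (fun i hi => hx' ⟨Sum.inl i, hi⟩) p')
    | @keep ks'' _ r' _ s' hs' F' =>
      obtain ⟨x, y⟩ := x'
      obtain ⟨x₁, y₁⟩ := x''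
      have h' : ((simpMap s x, F.point y) : Simp (m + 2) × Prism ms)
        = (simpMap s' x₁, F'.point y₁) := h
      have hp : ∀ i, x i ≠ 0 := fun i hi => hx' ⟨Sum.inl i, hi⟩
      have hp₁ : ∀ i, x₁ i ≠ 0 := fun i hi => hx'' ⟨Sum.inl i, hi⟩
      obtain rfl : r = r' := by
        have := card_eq_of_simpMap_eq hs hs' hp hp₁ (Prod.ext_iff.1 h').1
        omega
      obtain rfl : s = s' := (hs.range_inj hs').1
        (range_eq_of_simpMap_eq hs hs' hp hp₁ (Prod.ext_iff.1 h').1)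
      obtain rfl : x = x₁ := simpMap_injective hs.injective (Prod.ext_iff.1 h').1
      cases ih (fun ⟨f, hf⟩ => hx' ⟨Sum.inr f, hf⟩) F' (fun ⟨f, hf⟩ => hx'' ⟨Sum.inr f, hf⟩)
        (Prod.ext_iff.1 h').2
      rfl

section Carrier

variable {G : Type u} [Shalgebra G]

/-- `IsCarrier q q₀` says that the labeled prism of `q₀` is a face of the labeled prism of `q`
and that the point of `q` is the interior point `q₀` of this face. -/
def IsCarrier (q q₀ : PrismSpace G) : Prop :=
  q₀.2 ∉ facetUnion q₀.1.1 ∧ ∃ F : SubPrism q₀.1.1 q.1.1, F.point q₀.2 = q.2 ∧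
    goodLabeling q.1.1 q.1.2 ∘ F.edge = goodLabeling q₀.1.1 q₀.1.2

/-- The carrier is unique, since its face is determined by the point and its label by the good
labeling. -/
theorem IsCarrier.unique {q q₀ q₁ : PrismSpace G} (h₀ : IsCarrier q q₀) (h₁ : IsCarrier q q₁) :
    q₀ = q₁ := by
  obtain ⟨⟨ks₀, g₀⟩, x₀⟩ := q₀
  obtain ⟨⟨ks₁, g₁⟩, x₁⟩ := q₁
  obtain ⟨hx₀, F₀, hF₀, hg₀⟩ := h₀
  obtain ⟨hx₁, F₁, hF₁, hg₁⟩ := h₁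
  cases F₀.eq_of_point_eq hx₀ F₁ hx₁ (hF₀.trans hF₁.symm)
  exact congrArg (fun g => (⟨⟨ks₀, g⟩, x₀⟩ : PrismSpace G))
    (goodLabeling_injective ks₀ (hg₀.symm.trans hg₁))

theorem IsCarrier.dim_le {q q₀ : PrismSpace G} (h : IsCarrier q q₀) :
    dim q₀.1.1 ≤ dim q.1.1 := by
  obtain ⟨_, F, -⟩ := h
  exact F.dim_le

theorem isCarrier_self {q : PrismSpace G} (h : q.2 ∉ facetUnion q.1.1) : IsCarrier q q :=
  ⟨h, SubPrism.refl _, SubPrism.point_refl _ _,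
    funext fun e => congrArg _ (SubPrism.edge_refl _ e)⟩

/-- A carrier of a point of a facet is a carrier of the point in the whole prism, since the gluing
respects the labelings of the edges. -/
theorem IsCarrier.of_glue {q q' q₀ : PrismSpace G} (h : Glue G q q') (h₀ : IsCarrier q' q₀) :
    IsCarrier q q₀ := by
  obtain ⟨ks, f, g, g', hg, x⟩ := h
  obtain ⟨hx₀, F, hF, hgF⟩ := h₀
  obtain ⟨F', -, he, hp⟩ := SubPrism.exists_trans_facet ks f _ F
  refine ⟨hx₀, F', (hp _).trans (congrArg _ hF), ?_⟩
  rw [← hgF]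
  change _ = goodLabeling (facetShape ks f) g' ∘ _
  rw [← hg]
  exact funext fun e => congrArg _ (he e)

/-- A point of a facet is identified with the same point of the corresponding face. -/
theorem glue_face (ks : List ℕ) (g : Label G ks) (f : Facet ks) (x : Prism (facetShape ks f)) :
    Glue G ⟨⟨ks, g⟩, facetPoint ks f x⟩ ⟨⟨facetShape ks f, face ks f g⟩, x⟩ :=
  Glue.facet ks f g _ (goodLabeling_comp_facetEdge ks f g) x

/-- Descending from facet to facet, every point is identified with its carrier. -/
theorem exists_isCarrier (q : PrismSpace G) :
    ∃ q₀, IsCarrier q q₀ ∧ Quot.mk (Glue G) q₀ = Quot.mk (Glue G) q := by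
  obtain ⟨n, hn⟩ : ∃ n, dim q.1.1 = n := ⟨_, rfl⟩
  induction n using Nat.strong_induction_on generalizing q with
  | _ n ih =>
    by_cases hq : q.2 ∈ facetUnion q.1.1
    · obtain ⟨⟨ks, g⟩, x⟩ := q
      obtain ⟨f, hf⟩ := hq
      obtain ⟨y, hy⟩ := exists_facetPoint_eq ks f x hf
      have hglue : Glue G ⟨⟨ks, g⟩, x⟩ ⟨⟨facetShape ks f, face ks f g⟩, y⟩ :=
        hy ▸ glue_face ks g f y
      have hd := dim_facetShape_add_one ks f
      obtain ⟨q₀, h₀, h₁⟩ := ih (dim (facetShape ks f)) (by change dim ks = n at hn; omega)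
        (⟨⟨facetShape ks f, face ks f g⟩, y⟩ : PrismSpace G) rfl
      exact ⟨q₀, h₀.of_glue hglue, h₁.trans (Quot.sound hglue).symm⟩
    · exact ⟨q, isCarrier_self hq, rfl⟩

/-- The carrier is an invariant of the points of the classifying space. -/
theorem isCarrier_iff_of_mk_eq {q q' q₀ : PrismSpace G}
    (h : Quot.mk (Glue G) q = Quot.mk (Glue G) q') : IsCarrier q q₀ ↔ IsCarrier q' q₀ := by
  have key := Quot.eqvGen_exact h
  clear h
  induction key with
  | rel q q' h =>
    refine ⟨fun h₀ => ?_, IsCarrier.of_glue h⟩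
    obtain ⟨q₁, h₁, -⟩ := exists_isCarrier q'
    rwa [h₀.unique (h₁.of_glue h)]
  | refl => rfl
  | symm _ _ _ ih => exact ih.symm
  | trans _ _ _ _ _ ih₁ ih₂ => exact ih₁.trans ih₂

/-- Every point of the classifying space lies in exactly one open cell. -/
theorem existsUnique_interior_rep (b : BG G) :
    ∃! q : PrismSpace G, q.2 ∉ facetUnion q.1.1 ∧ Quot.mk (Glue G) q = b := by
  obtain ⟨q, rfl⟩ := Quot.exists_rep b
  obtain ⟨q₀, h₀, h₁⟩ := exists_isCarrier q
  refine ⟨q₀, ⟨h₀.1, h₁⟩, fun q₁ hq₁ => ?_⟩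
  exact ((isCarrier_iff_of_mk_eq hq₁.2).1 (isCarrier_self hq₁.1)).unique h₀

/-- Distinct points of the interiors of labeled prisms are not identified. -/
theorem eq_of_mk_eq {q q' : PrismSpace G} (hq : q.2 ∉ facetUnion q.1.1)
    (hq' : q'.2 ∉ facetUnion q'.1.1) (h : Quot.mk (Glue G) q = Quot.mk (Glue G) q') : q = q' :=
  (existsUnique_interior_rep (Quot.mk (Glue G) q')).unique ⟨hq, h⟩ ⟨hq', rfl⟩

/-- An interior point of a labeled prism is not identified with a point of a prism of smaller
dimension. -/
theorem dim_le_of_mk_eq {q q' : PrismSpace G} (hq : q.2 ∉ facetUnion q.1.1)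
    (h : Quot.mk (Glue G) q = Quot.mk (Glue G) q') : dim q.1.1 ≤ dim q'.1.1 :=
  ((isCarrier_iff_of_mk_eq h).1 (isCarrier_self hq)).dim_le

end Carrier

end Prismatic

namespace Prismatic

open Finsupp Topology

/-! ### The skeleta of the classifying space -/

section Skeleta

variable {G : Type u} [Shalgebra G]

/-- The characteristic map of a cell. -/
def cellMap (c : Cell G) : C(Prism c.1, BG G) where
  toFun x := Quot.mk _ ⟨c, x⟩
  continuous_toFun := continuous_quot_mk.comp continuous_sigmaMk

/-- The face of a cell belonging to a facet. -/
def faceCell (c : Cell G) (f : Facet c.1) : Cell G := ⟨facetShape c.1 f, face c.1 f c.2⟩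

theorem cellMap_facetPoint (c : Cell G) (f : Facet c.1) (x : Prism (facetShape c.1 f)) :
    cellMap c (facetPoint c.1 f x) = cellMap (faceCell c f) x :=
  Quot.sound (glue_face c.1 c.2 f x)

theorem dim_faceCell (c : Cell G) (f : Facet c.1) : dim (faceCell c f).1 + 1 = dim c.1 :=
  dim_facetShape_add_one c.1 f

variable (G) in
/-- The union of all cells of dimension less than `n`. -/
def skel (n : ℕ) : Set (BG G) := {b | ∃ q : PrismSpace G, dim q.1.1 < n ∧ Quot.mk _ q = b}

theorem skel_mono {m n : ℕ} (h : m ≤ n) : skel G m ⊆ skel G n :=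
  fun _ ⟨q, hq, hb⟩ => ⟨q, hq.trans_le h, hb⟩

theorem skel_zero : skel G 0 = ∅ :=
  Set.eq_empty_of_forall_notMem fun _ ⟨_, hq, _⟩ => Nat.not_lt_zero _ hq

theorem cellMap_mem_skel {c : Cell G} {n : ℕ} (h : dim c.1 < n) (x : Prism c.1) :
    cellMap c x ∈ skel G n := ⟨⟨c, x⟩, h, rfl⟩

theorem exists_mem_skel (b : BG G) : ∃ n, b ∈ skel G n := by
  obtain ⟨q, rfl⟩ := Quot.exists_rep b
  exact ⟨_, q, Nat.lt_succ_self _, rfl⟩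

theorem mem_facetUnion_of_cellMap_mem {c : Cell G} {n : ℕ} (h : n ≤ dim c.1) {x : Prism c.1}
    (hx : cellMap c x ∈ skel G n) : x ∈ facetUnion c.1 := by
  by_contra hx'
  obtain ⟨q, hq, hb⟩ := hx
  have h' : dim c.1 ≤ dim q.1.1 := dim_le_of_mk_eq (q := ⟨c, x⟩) hx' hb.symm
  omega

theorem cellMap_mem_skel_iff (c : Cell G) (x : Prism c.1) :
    cellMap c x ∈ skel G (dim c.1) ↔ x ∈ facetUnion c.1 := by
  refine ⟨mem_facetUnion_of_cellMap_mem le_rfl, fun ⟨f, hf⟩ => ?_⟩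
  obtain ⟨y, rfl⟩ := exists_facetPoint_eq c.1 f x hf
  rw [cellMap_facetPoint]
  refine cellMap_mem_skel (c := faceCell c f) ?_ y
  have := dim_faceCell c f
  omega

/-- The part of the preimage of a set under a characteristic map that lies in the boundary is
assembled from the preimages under the characteristic maps of the faces. -/
theorem cellMap_preimage_inter_facetUnion (c : Cell G) (S : Set (BG G)) :
    cellMap c ⁻¹' S ∩ facetUnion c.1
      = ⋃ f, facetPoint c.1 f '' (cellMap (faceCell c f) ⁻¹' S) := by
  ext x
  rw [Set.mem_iUnion]
  constructor
  · rintro ⟨hx, f, hf⟩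
    obtain ⟨y, hy⟩ := exists_facetPoint_eq c.1 f x hf
    refine ⟨f, y, ?_, hy⟩
    change cellMap (faceCell c f) y ∈ S
    rw [← cellMap_facetPoint, hy]
    exact hx
  · rintro ⟨f, y, hy, rfl⟩
    refine ⟨?_, f, coord_facetPoint_self _ _ _⟩
    change cellMap c _ ∈ S
    rw [cellMap_facetPoint]
    exact hy

theorem isClosed_iff_cellMap {S : Set (BG G)} : IsClosed S ↔ ∀ c, IsClosed (cellMap c ⁻¹' S) := by
  exact (isQuotientMap_quot_mk (r := Glue G)).isClosed_preimage.symm.trans isClosed_sigma_iff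

/-- The skeleta carry the weak topology with respect to their cells. -/
theorem isClosed_of_subset_skel {n : ℕ} {S : Set (BG G)} (hS : S ⊆ skel G n)
    (h : ∀ c : Cell G, dim c.1 < n → IsClosed (cellMap c ⁻¹' S)) : IsClosed S := by
  rw [isClosed_iff_cellMap]
  intro c
  obtain ⟨d, hd⟩ : ∃ d, dim c.1 = d := ⟨_, rfl⟩
  induction d using Nat.strong_induction_on generalizing c with
  | _ d ih =>
    rcases lt_or_ge d n with hdn | hdn
    · exact h c (hd ▸ hdn)
    · have e : cellMap c ⁻¹' S = cellMap c ⁻¹' S ∩ facetUnion c.1 :=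
        (Set.inter_eq_left.2 fun x hx => mem_facetUnion_of_cellMap_mem (hd ▸ hdn) (hS hx)).symm
      rw [e, cellMap_preimage_inter_facetUnion]
      refine isClosed_iUnion_of_finite fun f => ?_
      have := ih _ (by have := dim_faceCell c f; omega) (faceCell c f) rfl
      exact (this.isCompact.image (continuous_facetPoint c.1 f)).isClosed

theorem isClosed_skel (n : ℕ) : IsClosed (skel G n) :=
  isClosed_of_subset_skel le_rfl fun c hc => by
    have : cellMap c ⁻¹' skel G n = Set.univ :=
      Set.eq_univ_of_forall fun x => cellMap_mem_skel hc x
    exact this ▸ isClosed_univ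

/-- A set with finitely many points in each skeleton is closed. -/
theorem isClosed_of_finite_inter_skel {S : Set (BG G)} (hS : ∀ n, (S ∩ skel G n).Finite) :
    IsClosed S := by
  rw [isClosed_iff_cellMap]
  intro c
  refine Set.Finite.isClosed ?_
  obtain ⟨d, hd⟩ : ∃ d, dim c.1 = d := ⟨_, rfl⟩
  induction d using Nat.strong_induction_on generalizing c with
  | _ d ih =>
    rw [← Set.inter_union_compl (cellMap c ⁻¹' S) (facetUnion c.1),
      cellMap_preimage_inter_facetUnion]
    refine (Set.finite_iUnion fun f => ?_).union ?_
    · exact (ih _ (by have := dim_faceCell c f; omega) (faceCell c f) rfl).image _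
    · refine Set.Finite.of_finite_image ((hS (d + 1)).subset ?_) (f := cellMap c) ?_
      · rintro _ ⟨x, ⟨hx, -⟩, rfl⟩
        exact ⟨hx, cellMap_mem_skel (by omega) x⟩
      · rintro x ⟨-, hx⟩ y ⟨-, hy⟩ hxy
        have := eq_of_mk_eq (q := ⟨c, x⟩) (q' := ⟨c, y⟩) hx hy hxy
        simpa using this

/-- A compact subset meets the interiors of cells of bounded dimension only. -/
theorem exists_subset_skel {K : Set (BG G)} (hK : IsCompact K) : ∃ n, K ⊆ skel G n := by
  by_contra! hne
  -- otherwise there is an infinite closed discrete sequence in `K`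
  choose b hbK hb using fun n => Set.not_subset.1 (hne n)
  have hcl : ∀ T ⊆ Set.range b, IsClosed T := fun T hT => isClosed_of_finite_inter_skel fun n => by
    refine ((Set.finite_lt_nat n).image b).subset ?_
    rintro x ⟨hxT, hxn⟩
    obtain ⟨m, rfl⟩ := hT hxT
    refine ⟨m, ?_, rfl⟩
    by_contra hm
    exact hb m (skel_mono (not_lt.1 hm) hxn)
  have hdisc : DiscreteTopology (Set.range b) := by
    refine discreteTopology_iff_forall_isClosed.2 fun T => ?_
    have := (hcl (Subtype.val '' T) (by rintro _ ⟨x, -, rfl⟩; exact x.2)).preimage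
      (continuous_subtype_val (p := (· ∈ Set.range b)))
    rwa [Set.preimage_image_eq _ Subtype.val_injective] at this
  have hfin : (Set.range b).Finite :=
    (hK.of_isClosed_subset (hcl _ le_rfl) (Set.range_subset_iff.2 hbK)).finite
      (isDiscrete_iff_discreteTopology.2 hdisc)
  choose N hN using exists_mem_skel (G := G)
  obtain ⟨M, hM⟩ := (hfin.image N).bddAbove
  exact hb M (skel_mono (hM ⟨b M, ⟨M, rfl⟩, rfl⟩) (hN (b M)))

/-- Every singular chain lies in a skeleton, by compactness of simplices. -/
theorem exists_mem_SIn_skel (z : SChains (BG G)) : ∃ n, z ∈ SIn (skel G n) := by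
  have h : ∀ x : Σ n, C(Simp n, BG G), ∃ n, ∀ t, x.2 t ∈ skel G n := fun x => by
    obtain ⟨n, hn⟩ := exists_subset_skel (isCompact_range x.2.continuous)
    exact ⟨n, fun t => hn ⟨t, rfl⟩⟩
  choose N hN using h
  refine ⟨z.support.sup N, ?_⟩
  rw [SIn, mem_supported]
  exact fun x hx t => skel_mono (Finset.le_sup (f := N) hx) (hN x t)

/-! ### Attaching the cells of one dimension -/

variable (G) in
/-- The disjoint union of the labeled prisms of dimension `n`. -/
abbrev CellsOfDim (n : ℕ) : Type u := Σ c : {c : Cell G // dim c.1 = n}, Prism c.1.1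

variable (G) in
/-- The boundaries of the labeled prisms of dimension `n`. -/
def cellBoundaries (n : ℕ) : Set (CellsOfDim G n) := {p | p.2 ∈ facetUnion p.1.1.1}

variable (G) in
/-- The characteristic maps of all cells of dimension `n`. -/
def attachingMap (n : ℕ) : C(CellsOfDim G n, skel G (n + 1)) where
  toFun p := ⟨cellMap p.1.1 p.2, cellMap_mem_skel (by rw [p.1.2]; exact Nat.lt_succ_self n) _⟩
  continuous_toFun := (continuous_sigma fun c => (cellMap c.1).continuous).subtype_mk _

/-- Each skeleton arises from the preceding one by attaching the cells of one dimension. -/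
theorem nonempty_attachment_skel (n : ℕ) :
    Nonempty (Attachment (attachingMap G n) (Subtype.val ⁻¹' skel G n) (cellBoundaries G n)) := by
  choose H W hW hBW h₀ h₁ h₂ using fun c : {c : Cell G // dim c.1 = n} => exists_collar c.1.1
  have hcl : IsClosed (Subtype.val ⁻¹' skel G n : Set (skel G (n + 1))) :=
    (isClosed_skel n).preimage continuous_subtype_val
  have hH : Continuous fun p : Simp 2 × CellsOfDim G n =>
      (⟨p.2.1, H p.2.1 (p.1, p.2.2)⟩ : CellsOfDim G n) := by
    have hc : Continuous fun p : Σ c : {c : Cell G // dim c.1 = n}, Prism c.1.1 × Simp 2 =>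
        (⟨p.1, H p.1 (p.2.2, p.2.1)⟩ : CellsOfDim G n) :=
      continuous_sigma fun c => continuous_sigmaMk.comp ((H c).continuous.comp continuous_swap)
    exact hc.comp (((Homeomorph.sigmaProdDistrib (Y := Simp 2)
      (X := fun c : {c : Cell G // dim c.1 = n} => Prism c.1.1)).continuous).comp continuous_swap)
  refine ⟨{ isClosed := hcl, isQuotientMap := ?_, mem_iff := ?_, inj := ?_, push := ⟨_, hH⟩,
            W := {p | p.2 ∈ W p.1}, isOpen_W := ?_, subset_W := ?_, push_zero := ?_,
            push_fixed := ?_, push_one := ?_ }⟩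
  · rw [isQuotientMap_iff_isClosed]
    refine ⟨?_, fun S => ⟨fun hS => hS.preimage
      (continuous_subtype_val.sumElim (attachingMap G n).continuous), fun hS => ?_⟩⟩
    · rintro ⟨b, ⟨c, x⟩, hq, rfl⟩
      rcases Nat.lt_succ_iff_lt_or_eq.1 hq with h | h
      · exact ⟨Sum.inl ⟨⟨_, ⟨c, x⟩, hq, rfl⟩, ⟨c, x⟩, h, rfl⟩, rfl⟩
      · exact ⟨Sum.inr ⟨⟨c, h⟩, x⟩, rfl⟩
    · rw [isClosed_sum_iff] at hS
      have key : IsClosed (Subtype.val '' S : Set (BG G)) := by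
        refine isClosed_of_subset_skel (n := n + 1) (by rintro _ ⟨x, -, rfl⟩; exact x.2) ?_
        intro c hc
        rcases Nat.lt_succ_iff_lt_or_eq.1 hc with h | h
        · have hcont : Continuous fun x : Prism c.1 =>
              (⟨⟨cellMap c x, cellMap_mem_skel hc x⟩, cellMap_mem_skel h x⟩ :
                (Subtype.val ⁻¹' skel G n : Set (skel G (n + 1)))) :=
            ((cellMap c).continuous.subtype_mk _).subtype_mk _
          convert hS.1.preimage hcont using 1
          ext x
          constructor
          · rintro ⟨b, hb, hbx⟩
            have : b = ⟨cellMap c x, cellMap_mem_skel hc x⟩ := Subtype.ext hbx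
            rw [this] at hb
            exact hb
          · exact fun hx => ⟨_, hx, rfl⟩
        · convert (isClosed_sigma_iff.1 hS.2) ⟨c, h⟩ using 1
          ext x
          constructor
          · rintro ⟨b, hb, hbx⟩
            have : b = ⟨cellMap c x, cellMap_mem_skel hc x⟩ := Subtype.ext hbx
            rw [this] at hb
            exact hb
          · exact fun hx => ⟨_, hx, rfl⟩
      have := key.preimage (continuous_subtype_val (p := (· ∈ skel G (n + 1))))
      rwa [Set.preimage_image_eq _ Subtype.val_injective] at this
  · rintro ⟨⟨c, rfl⟩, x⟩
    exact cellMap_mem_skel_iff c x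
  · rintro ⟨⟨c, hc⟩, x⟩ ⟨⟨c', hc'⟩, x'⟩ hx hx' h
    have := eq_of_mk_eq (q := ⟨c, x⟩) (q' := ⟨c', x'⟩) hx hx' (Subtype.ext_iff.1 h)
    cases this
    rfl
  · exact isOpen_sigma_iff.2 hW
  · exact fun p hp => hBW p.1 hp
  · exact fun p => Sigma.ext rfl (heq_of_eq (h₀ _ _))
  · exact fun τ p hp => Sigma.ext rfl (heq_of_eq (h₁ _ _ _ hp))
  · exact fun p hp => h₂ _ _ hp

end Skeleta

end Prismatic

namespace Prismatic

open Finsupp Topology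

/-! ### Singular chains of disjoint unions -/

section DisjointUnion

variable {I : Type*} {P : I → Type*} [∀ i, TopologicalSpace (P i)]

theorem sigmaMk_comp_injective {i : I} {n : ℕ} {τ τ' : C(Simp n, P i)}
    (h : (ContinuousMap.sigmaMk i).comp τ = (ContinuousMap.sigmaMk i).comp τ') : τ = τ' :=
  ContinuousMap.ext fun t => sigma_mk_injective (DFunLike.congr_fun h t)

open Classical in
/-- The part of a chain that lies in one component of a disjoint union. The empty simplex lies in
every component, so this is a chain map only modulo the empty simplex. -/
noncomputable def component (i : I) : SChains (Σ i, P i) →ₗ[ℤ] SChains (P i) :=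
  linearCombination ℤ fun x =>
    if h : ∃ τ : C(Simp x.1, P i), (ContinuousMap.sigmaMk i).comp τ = x.2 then
      single ⟨x.1, h.choose⟩ 1 else 0

theorem component_single_comp (i : I) {n : ℕ} (τ : C(Simp n, P i)) :
    component i (single ⟨n, (ContinuousMap.sigmaMk i).comp τ⟩ 1) = single ⟨n, τ⟩ 1 := by
  have h : ∃ τ' : C(Simp n, P i),
    (ContinuousMap.sigmaMk i).comp τ' = (ContinuousMap.sigmaMk i).comp τ := ⟨τ, rfl⟩
  rw [component, linearCombination_single, one_smul, dif_pos h,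
    sigmaMk_comp_injective h.choose_spec]

theorem component_single_of_ne {i j : I} (hij : j ≠ i) {n : ℕ} (τ : C(Simp (n + 1), P j)) :
    component i (single ⟨n + 1, (ContinuousMap.sigmaMk j).comp τ⟩ 1) = 0 := by
  rw [component, linearCombination_single, one_smul, dif_neg]
  rintro ⟨τ', h⟩
  have := DFunLike.congr_fun h (stdSimplex.vertex 0)
  exact hij (congrArg Sigma.fst this).symm

theorem component_mem_SIn (i : I) {B : Set (Σ i, P i)} {z : SChains (Σ i, P i)} (hz : z ∈ SIn B) :
    component i z ∈ SIn (Sigma.mk i ⁻¹' B) := by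
  refine SIn_induction (component i) _ (fun n σ hσ => ?_) hz
  rw [component, linearCombination_single, one_smul]
  split_ifs with h
  · refine single_mem_SIn (fun t => ?_) _
    have := DFunLike.congr_fun h.choose_spec t
    change (ContinuousMap.sigmaMk i).comp h.choose t ∈ B
    rw [this]
    exact hσ t
  · exact zero_mem _

theorem component_sMap_self (i : I) (a : SChains (P i)) :
    component i (sMap (ContinuousMap.sigmaMk i) a) = a := by
  have : (component i : SChains (Σ i, P i) →ₗ[ℤ] SChains (P i)) ∘ₗ
      sMap (ContinuousMap.sigmaMk i) = LinearMap.id :=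
    chains_ext fun n τ => by
      rw [LinearMap.comp_apply, chainMap_single, component_single_comp, LinearMap.id_apply]
  exact LinearMap.congr_fun this a

theorem mem_SIn_of_isEmpty {X : Type*} [TopologicalSpace X] (σ : C(Simp 0, X)) (A : Set X) (c : ℤ) :
    single ⟨0, σ⟩ c ∈ SIn A :=
  single_mem_SIn (fun t => isEmptyElim t) c

theorem component_sMap_of_ne {i j : I} (hij : j ≠ i) (a : SChains (P j)) :
    component i (sMap (ContinuousMap.sigmaMk j) a) ∈ SIn (∅ : Set (P i)) := by
  refine SIn_induction (component i ∘ₗ sMap (ContinuousMap.sigmaMk j)) _ (fun n τ _ => ?_)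
    (SIn_univ a)
  rw [LinearMap.comp_apply, chainMap_single]
  cases n with
  | zero => exact component_mem_SIn i (mem_SIn_of_isEmpty _ ∅ 1)
  | succ n => rw [component_single_of_ne hij]; exact zero_mem _

theorem sBdry_component_sub_mem (i : I) (z : SChains (Σ i, P i)) :
    sBdry (component i z) - component i (sBdry z) ∈ SIn (∅ : Set (P i)) := by
  refine SIn_induction (sBdry ∘ₗ component i - component i ∘ₗ sBdry) _ (fun n σ _ => ?_)
    (SIn_univ z)
  simp only [LinearMap.sub_apply, LinearMap.comp_apply]
  cases n with
  | zero =>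
    rw [bdryOf_single_zero, map_zero, sub_zero]
    exact sBdry_mem_SIn (component_mem_SIn i (mem_SIn_of_isEmpty _ ∅ 1))
  | succ n =>
    obtain ⟨j, τ, rfl⟩ := σ.exists_lift_sigma
    have e : sBdry (single ⟨n + 1, (ContinuousMap.sigmaMk j).comp τ⟩ 1)
        = sMap (ContinuousMap.sigmaMk j) (sBdry (single ⟨n + 1, τ⟩ 1)) := by
      rw [← sBdry_sMap, chainMap_single]
    rw [e]
    rcases eq_or_ne j i with rfl | hij
    · rw [component_single_comp, component_sMap_self, sub_self]
      exact zero_mem _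
    · rw [component_single_of_ne hij, map_zero, zero_sub]
      exact neg_mem (component_sMap_of_ne hij _)

/-- A chain of a disjoint union is the sum of its components, up to the empty simplex. -/
theorem exists_sub_sum_component_mem (z : SChains (Σ i, P i)) :
    ∃ s : Finset I, ∀ s', s ⊆ s' →
      z - ∑ i ∈ s', sMap (ContinuousMap.sigmaMk i) (component i z) ∈ SIn (∅ : Set (Σ i, P i)) := by
  classical
  induction z using Finsupp.induction_linear with
  | zero => exact ⟨∅, fun s' _ => by simp⟩
  | add z z' hz hz' =>
    obtain ⟨s, hs⟩ := hz
    obtain ⟨t, ht⟩ := hz'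
    refine ⟨s ∪ t, fun s' h => ?_⟩
    have := add_mem (hs s' (Finset.union_subset_left h)) (ht s' (Finset.union_subset_right h))
    simp only [map_add, Finset.sum_add_distrib]
    convert this using 1
    abel
  | single x c =>
    obtain ⟨n, σ⟩ := x
    have e : (single ⟨n, σ⟩ c : SChains (Σ i, P i)) = c • single ⟨n, σ⟩ 1 := by simp
    suffices h : ∃ s : Finset I, ∀ s', s ⊆ s' → (single ⟨n, σ⟩ 1 : SChains (Σ i, P i))
        - ∑ i ∈ s', sMap (ContinuousMap.sigmaMk i) (component i (single ⟨n, σ⟩ 1)) ∈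
          SIn (∅ : Set (Σ i, P i)) by
      obtain ⟨s, hs⟩ := h
      refine ⟨s, fun s' h => ?_⟩
      have := Submodule.smul_mem _ c (hs s' h)
      rw [e]
      simp only [map_smul]
      rwa [← Finset.smul_sum, ← smul_sub]
    cases n with
    | zero =>
      refine ⟨∅, fun s' _ => sub_mem (mem_SIn_of_isEmpty _ _ _) (sum_mem fun i _ => ?_)⟩
      exact sMap_mem_SIn (fun _ h => h) (component_mem_SIn i (mem_SIn_of_isEmpty _ ∅ 1))
    | succ n =>
      obtain ⟨j, τ, rfl⟩ := σ.exists_lift_sigma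
      refine ⟨{j}, fun s' h => ?_⟩
      rw [Finset.sum_eq_single_of_mem j (h (Finset.mem_singleton_self j)),
        component_single_comp, chainMap_single, sub_self]
      · exact zero_mem _
      · intro i _ hij
        rw [component_single_of_ne hij.symm, map_zero]

variable {B : Set (Σ i, P i)} {fund : ∀ i, SChains (P i)}

/-- If each component carries a relative fundamental chain, then relative cycles of the disjoint
union are homologous to combinations of these. -/
theorem exists_relCycle_sigma
    (h : ∀ i, ∀ z, sBdry z ∈ SIn (Sigma.mk i ⁻¹' B) →
      ∃ w, ∃ k : ℤ, z - sBdry w - k • fund i ∈ SIn (Sigma.mk i ⁻¹' B))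
    {z : SChains (Σ i, P i)} (hz : sBdry z ∈ SIn B) :
    ∃ w, ∃ a : I →₀ ℤ, z - sBdry w
      - linearCombination ℤ (fun i => sMap (ContinuousMap.sigmaMk i) (fund i)) a ∈ SIn B := by
  classical
  obtain ⟨s, hs⟩ := exists_sub_sum_component_mem z
  have hc : ∀ i, sBdry (component i z) ∈ SIn (Sigma.mk i ⁻¹' B) := fun i => by
    have := add_mem (SIn_mono (Set.empty_subset _) (sBdry_component_sub_mem i z))
      (component_mem_SIn i hz)
    rwa [sub_add_cancel] at this
  choose w k hwk using fun i => h i _ (hc i)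
  refine ⟨∑ i ∈ s, sMap (ContinuousMap.sigmaMk i) (w i), ∑ i ∈ s, single i (k i), ?_⟩
  have e : z - sBdry (∑ i ∈ s, sMap (ContinuousMap.sigmaMk i) (w i))
      - linearCombination ℤ (fun i => sMap (ContinuousMap.sigmaMk i) (fund i))
        (∑ i ∈ s, single i (k i))
      = (z - ∑ i ∈ s, sMap (ContinuousMap.sigmaMk i) (component i z))
        + ∑ i ∈ s, sMap (ContinuousMap.sigmaMk i)
          (component i z - sBdry (w i) - k i • fund i) := by
    simp only [map_sum, linearCombination_single, map_sub, map_smul, Finset.sum_sub_distrib,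
      sBdry_sMap]
    abel
  rw [e]
  exact add_mem (SIn_mono (Set.empty_subset _) (hs s le_rfl))
    (sum_mem fun i _ => sMap_mem_SIn (fun _ hx => hx) (hwk i))

/-- If the multiples of the relative fundamental chains of the components are not relative
boundaries, then neither are their combinations. -/
theorem eq_zero_of_relBoundary_sigma
    (h : ∀ i, ∀ (k : ℤ) (w : SChains (P i)), k • fund i - sBdry w ∈ SIn (Sigma.mk i ⁻¹' B) → k = 0)
    {a : I →₀ ℤ} {w : SChains (Σ i, P i)}
    (hw : linearCombination ℤ (fun i => sMap (ContinuousMap.sigmaMk i) (fund i)) a - sBdry w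
      ∈ SIn B) : a = 0 := by
  ext i
  refine h i (a i) (component i w) ?_
  have h₁ : component i (linearCombination ℤ
      (fun i => sMap (ContinuousMap.sigmaMk i) (fund i)) a) - a i • fund i
        ∈ SIn (∅ : Set (P i)) := by
    clear hw
    induction a using Finsupp.induction_linear with
    | zero => simp
    | add a b ha hb =>
      have := add_mem ha hb
      rw [map_add, map_add, Finsupp.add_apply, add_smul]
      convert this using 1
      abel
    | single j c =>
      rw [linearCombination_single, map_smul]
      rcases eq_or_ne j i with rfl | hij
      · rw [component_sMap_self, single_eq_same, sub_self]
        exact zero_mem _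
      · rw [single_eq_of_ne hij.symm, zero_smul, sub_zero]
        exact Submodule.smul_mem _ _ (component_sMap_of_ne hij _)
  have h₂ := component_mem_SIn i hw
  rw [map_sub] at h₂
  have e : a i • fund i - sBdry (component i w)
      = (component i (linearCombination ℤ (fun i => sMap (ContinuousMap.sigmaMk i) (fund i)) a)
          - component i (sBdry w))
        - (component i (linearCombination ℤ (fun i => sMap (ContinuousMap.sigmaMk i) (fund i)) a)
          - a i • fund i)
        - (sBdry (component i w) - component i (sBdry w)) := by abel
  rw [e]
  exact sub_mem (sub_mem h₂ (SIn_mono (Set.empty_subset _) h₁))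
    (SIn_mono (Set.empty_subset _) (sBdry_component_sub_mem i w))

end DisjointUnion

end Prismatic

namespace Prismatic

open Finsupp Topology

/-! ### Cellular chains -/

section Cellular

variable {G : Type u} [Shalgebra G]

/-- The singular chain carried by a combination of cells. -/
noncomputable def cellChain : (Cell G →₀ ℤ) →ₗ[ℤ] SChains (BG G) :=
  linearCombination ℤ fun c => sMap (cellMap c) (fundChain c.1)

variable (G) in
/-- The combinations of cells of dimension `n`. -/
def cellsOf (n : ℕ) : Submodule ℤ (Cell G →₀ ℤ) := supported ℤ ℤ {c | dim c.1 = n}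

/-- The cellular boundary operator. In contrast to the prismatic chain groups, the vertex is
admitted as a cell. -/
noncomputable def cellBdry : (Cell G →₀ ℤ) →ₗ[ℤ] (Cell G →₀ ℤ) :=
  linearCombination ℤ fun c => ∑ f : Facet c.1, single (faceCell c f) ((-1) ^ facetExponent c.1 f)

theorem cellChain_mem_SIn {n : ℕ} {a : Cell G →₀ ℤ} (ha : a ∈ cellsOf G n) :
    cellChain a ∈ SIn (skel G (n + 1)) := by
  refine mem_supported_induction cellChain _ (fun c hc => ?_) ha
  rw [cellChain, linearCombination_single, one_smul]
  have hc' : dim c.1 = n := hc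
  exact sMap_mem_SIn (fun x _ => cellMap_mem_skel (by omega) x) (SIn_univ _)

theorem cellChain_mem_homog {n : ℕ} {a : Cell G →₀ ℤ} (ha : a ∈ cellsOf G n) :
    cellChain a ∈ homog (n + 1) := by
  refine mem_supported_induction cellChain _ (fun c hc => ?_) ha
  rw [cellChain, linearCombination_single, one_smul]
  have hc' : dim c.1 = n := hc
  exact chainMap_mem_homog _ (hc' ▸ fundChain_mem_homog c.1)

theorem cellBdry_mem {n : ℕ} {a : Cell G →₀ ℤ} (ha : a ∈ cellsOf G (n + 1)) :
    cellBdry a ∈ cellsOf G n := by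
  refine mem_supported_induction cellBdry _ (fun c hc => ?_) ha
  rw [cellBdry, linearCombination_single, one_smul]
  have hc' : dim c.1 = n + 1 := hc
  refine sum_mem fun f _ => single_mem_supported ℤ _ ?_
  have := dim_faceCell c f
  change dim (faceCell c f).1 = n
  omega

/-- The characteristic maps turn the cellular boundary into the singular one. -/
theorem sBdry_cellChain {n : ℕ} {a : Cell G →₀ ℤ} (ha : a ∈ cellsOf G (n + 1)) :
    sBdry (cellChain a) = cellChain (cellBdry a) := by
  suffices h : (sBdry ∘ₗ cellChain - cellChain ∘ₗ cellBdry :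
      (Cell G →₀ ℤ) →ₗ[ℤ] SChains (BG G)) a ∈ (⊥ : Submodule ℤ (SChains (BG G))) by
    simpa [sub_eq_zero] using h
  refine mem_supported_induction _ _ (fun c hc => ?_) ha
  have hc' : dim c.1 = n + 1 := hc
  have hne : c.1 ≠ [] := fun h => by rw [h] at hc'; simp [dim] at hc'
  rw [Submodule.mem_bot, LinearMap.sub_apply, LinearMap.comp_apply, LinearMap.comp_apply,
    sub_eq_zero, cellChain, cellBdry, linearCombination_single, linearCombination_single, one_smul,
    one_smul, sBdry_sMap, sBdry_fundChain c.1 hne, map_sum, map_sum]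
  refine Finset.sum_congr rfl fun f _ => ?_
  rw [linearCombination_single, facetTerm, map_smul, sMap_sMap]
  have e : (cellMap c).comp (facetC c.1 f) = cellMap (faceCell c f) :=
    ContinuousMap.ext fun x => cellMap_facetPoint c f x
  rw [e]
  rfl

variable (G) in
/-- The inclusion of a skeleton. -/
def skelIncl (n : ℕ) : C(skel G n, BG G) := ⟨Subtype.val, continuous_subtype_val⟩

theorem exists_lift_skel {n : ℕ} {z : SChains (BG G)} (hz : z ∈ SIn (skel G n)) :
    ∃ y, sMap (skelIncl G n) y = z := by
  obtain ⟨y, -, hy⟩ := exists_sMap_eq_of_isEmbedding (f := skelIncl G n) IsEmbedding.subtypeVal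
    (fun x hx => ⟨⟨x, hx⟩, rfl⟩) hz
  exact ⟨y, hy⟩

theorem sMap_attachingMap_linearCombination (n : ℕ) (a : {c : Cell G // dim c.1 = n} →₀ ℤ) :
    sMap (skelIncl G (n + 1)) (sMap (attachingMap G n) (linearCombination ℤ
      (fun c : {c : Cell G // dim c.1 = n} => sMap (ContinuousMap.sigmaMk
        (X := fun c : {c : Cell G // dim c.1 = n} => Prism c.1.1) c) (fundChain c.1.1)) a))
      = cellChain (a.mapDomain Subtype.val) := by
  induction a using Finsupp.induction_linear with
  | zero => simp
  | add a b ha hb => rw [map_add, map_add, map_add, ha, hb, mapDomain_add, map_add]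
  | single c k =>
    rw [linearCombination_single, mapDomain_single, cellChain, linearCombination_single, map_smul,
      map_smul, sMap_sMap, sMap_sMap]
    rfl

/-- Relative cycles of consecutive skeleta are homologous to combinations of cells. -/
theorem exists_relCycle_skel {n : ℕ} {z : SChains (BG G)} (hz : z ∈ SIn (skel G (n + 1)))
    (hbz : sBdry z ∈ SIn (skel G n)) :
    ∃ w, ∃ a ∈ cellsOf G n, z - sBdry w - cellChain a ∈ SIn (skel G n) := by
  obtain ⟨att⟩ := nonempty_attachment_skel (G := G) n
  obtain ⟨y, rfl⟩ := exists_lift_skel hz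
  rw [sBdry_sMap] at hbz
  obtain ⟨w, v, hv, hyv⟩ := att.exists_relCycle (mem_SIn_of_sMap Subtype.val_injective hbz)
  obtain ⟨w₂, a, ha⟩ := exists_relCycle_sigma
    (P := fun c : {c : Cell G // dim c.1 = n} => Prism c.1.1) (B := cellBoundaries G n)
    (fund := fun c => fundChain c.1.1)
    (fun c z hz => (relHomology_prism n c.1.1 c.2).1 z hz) hv
  refine ⟨sMap (skelIncl G (n + 1)) (w + sMap (attachingMap G n) w₂),
    a.mapDomain Subtype.val, ?_, ?_⟩
  · classical
    rw [cellsOf, mem_supported]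
    intro c hc
    obtain ⟨c', -, rfl⟩ := Finset.mem_image.1 (mapDomain_support (Finset.mem_coe.1 hc))
    exact c'.2
  · rw [← sMap_attachingMap_linearCombination]
    have h₂ := sMap_mem_SIn (f := skelIncl G (n + 1)) (B := skel G n) (fun x hx => hx) hyv
    have h₃ := sMap_mem_SIn (f := skelIncl G (n + 1)) (B := skel G n) (fun x hx => hx)
      (sMap_mem_SIn (f := attachingMap G n) (fun x hx => (att.mem_iff x).2 hx) ha)
    convert add_mem h₂ h₃ using 1
    simp only [map_add, map_sub, sBdry_sMap]
    abel

/-- Nonzero combinations of cells are not relative boundaries of consecutive skeleta. -/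
theorem eq_zero_of_relBoundary_skel {n : ℕ} {a : Cell G →₀ ℤ} (ha : a ∈ cellsOf G n)
    {w : SChains (BG G)} (hw : w ∈ SIn (skel G (n + 1)))
    (h : cellChain a - sBdry w ∈ SIn (skel G n)) : a = 0 := by
  obtain ⟨att⟩ := nonempty_attachment_skel (G := G) n
  obtain ⟨y, rfl⟩ := exists_lift_skel hw
  have ha' : a = (a.comapDomain (Subtype.val : {c : Cell G // dim c.1 = n} → Cell G)
      Subtype.val_injective.injOn).mapDomain Subtype.val :=
    (mapDomain_comapDomain _ Subtype.val_injective a fun c hc =>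
      ⟨⟨c, (mem_supported ℤ a).1 ha hc⟩, rfl⟩).symm
  generalize a.comapDomain (Subtype.val : {c : Cell G // dim c.1 = n} → Cell G)
    Subtype.val_injective.injOn = b at ha'
  subst ha'
  rw [← sMap_attachingMap_linearCombination, sBdry_sMap, ← map_sub] at h
  have h' := mem_SIn_of_sMap (f := skelIncl G (n + 1)) Subtype.val_injective h
  obtain ⟨w', hw'⟩ := att.exists_relBoundary (v := linearCombination ℤ
      (fun c : {c : Cell G // dim c.1 = n} => sMap (ContinuousMap.sigmaMk
        (X := fun c : {c : Cell G // dim c.1 = n} => Prism c.1.1) c) (fundChain c.1.1)) b) (by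
    rw [linearCombination_apply, Finsupp.sum, map_sum]
    refine sum_mem fun c _ => ?_
    rw [map_smul, sBdry_sMap]
    exact Submodule.smul_mem _ _ (sMap_mem_SIn (fun x hx => hx) (sBdry_fundChain_mem c.1.1))) h'
  rw [eq_zero_of_relBoundary_sigma (P := fun c : {c : Cell G // dim c.1 = n} => Prism c.1.1)
    (B := cellBoundaries G n) (fund := fun c => fundChain c.1.1)
    (fun c k w h => (relHomology_prism n c.1.1 c.2).2 k w h) hw', mapDomain_zero]

end Cellular

end Prismatic

namespace Prismatic

open Finsupp Topology

/-! ### Cellular chains compute singular homology -/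

section Comparison

open Classical in
/-- The part of a chain in one degree. -/
noncomputable def homogPart {X : ℕ → Type*} (n : ℕ) : Chains X →ₗ[ℤ] Chains X :=
  linearCombination ℤ fun x => if x.1 = n then single x 1 else 0

theorem homogPart_single_self {X : ℕ → Type*} {n : ℕ} (x : X n) :
    homogPart n (single ⟨n, x⟩ 1 : Chains X) = single ⟨n, x⟩ 1 := by
  simp [homogPart]

theorem homogPart_single_of_ne {X : ℕ → Type*} {m n : ℕ} (h : m ≠ n) (x : X m) :
    homogPart n (single ⟨m, x⟩ 1 : Chains X) = 0 := by
  simp [homogPart, h]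

theorem homogPart_of_mem {X : ℕ → Type*} {n : ℕ} {a : Chains X} (ha : a ∈ homog n) :
    homogPart n a = a := by
  have := homog_induction (homogPart n - LinearMap.id) (⊥ : Submodule ℤ (Chains X)) (fun x => by
    rw [Submodule.mem_bot, LinearMap.sub_apply, homogPart_single_self, LinearMap.id_apply,
      sub_self]) ha
  simpa [sub_eq_zero] using this

theorem homogPart_of_mem_of_ne {X : ℕ → Type*} {m n : ℕ} (h : m ≠ n) {a : Chains X}
    (ha : a ∈ homog m) : homogPart n a = 0 :=
  homog_induction (homogPart n) (⊥ : Submodule ℤ (Chains X)) (fun x => by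
    rw [Submodule.mem_bot, homogPart_single_of_ne h]) ha

theorem homogPart_mem {X : ℕ → Type*} (n : ℕ) (a : Chains X) : homogPart n a ∈ homog n := by
  have h : LinearMap.range (homogPart (X := X) n) ≤ homog n := by
    rw [homogPart, range_linearCombination, Submodule.span_le]
    rintro _ ⟨x, rfl⟩
    dsimp only
    split_ifs with h
    · obtain ⟨m, x⟩ := x
      obtain rfl : m = n := h
      exact single_mem_homog _ _ _
    · exact zero_mem _
  exact h ⟨a, rfl⟩

theorem sBdry_homogPart {X : Type*} [TopologicalSpace X] (n : ℕ) (a : SChains X) :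
    sBdry (homogPart (n + 1) a) = homogPart n (sBdry a) := by
  have : sBdry ∘ₗ homogPart (n + 1) = (homogPart n ∘ₗ sBdry : SChains X →ₗ[ℤ] SChains X) := by
    refine chains_ext fun m σ => ?_
    simp only [LinearMap.comp_apply]
    cases m with
    | zero => rw [homogPart_single_of_ne (by simp), bdryOf_single_zero, map_zero, map_zero]
    | succ m =>
      rcases eq_or_ne m n with rfl | h
      · rw [homogPart_single_self, bdryOf_single_succ, map_sum]
        exact Finset.sum_congr rfl fun i _ => by rw [map_smul, homogPart_single_self]
      · rw [homogPart_single_of_ne (by simpa using h), bdryOf_single_succ, map_sum, map_zero]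
        exact (Finset.sum_eq_zero fun i _ => by
          rw [map_smul, homogPart_single_of_ne h, smul_zero]).symm
  exact LinearMap.congr_fun this a

theorem sBdry_mem_homog {X : Type*} [TopologicalSpace X] {n : ℕ} {a : SChains X}
    (ha : a ∈ homog (n + 1)) : sBdry a ∈ homog n := by
  rw [← homogPart_of_mem ha, sBdry_homogPart]
  exact homogPart_mem _ _

variable {G : Type u}

open Classical in
/-- The part of a combination of cells in one dimension. -/
noncomputable def cellPart (n : ℕ) : (Cell G →₀ ℤ) →ₗ[ℤ] (Cell G →₀ ℤ) :=
  linearCombination ℤ fun c => if dim c.1 = n then single c 1 else 0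

theorem cellPart_single_of_eq {n : ℕ} {c : Cell G} (h : dim c.1 = n) (k : ℤ) :
    cellPart n (single c k) = single c k := by
  rw [cellPart, linearCombination_single, if_pos h, smul_single, smul_eq_mul, mul_one]

theorem cellPart_single_of_ne {n : ℕ} {c : Cell G} (h : dim c.1 ≠ n) (k : ℤ) :
    cellPart n (single c k) = 0 := by
  rw [cellPart, linearCombination_single, if_neg h, smul_zero]

theorem cellPart_mem (n : ℕ) (a : Cell G →₀ ℤ) : cellPart n a ∈ cellsOf G n := by
  induction a using Finsupp.induction_linear with
  | zero => rw [map_zero]; exact zero_mem _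
  | add a b ha hb => rw [map_add]; exact add_mem ha hb
  | single c k =>
    by_cases h : dim c.1 = n
    · rw [cellPart_single_of_eq h]; exact single_mem_supported ℤ k h
    · rw [cellPart_single_of_ne h]; exact zero_mem _

variable (G) in
/-- The only cell of dimension zero. -/
def vertexCell : Cell G := ⟨[], PUnit.unit⟩

theorem eq_single_of_mem_cellsOf_zero {a : Cell G →₀ ℤ} (ha : a ∈ cellsOf G 0) :
    a = single (vertexCell G) (a (vertexCell G)) := by
  ext c
  by_cases hc : c.1 = []
  · obtain ⟨ks, g⟩ := c
    obtain rfl : ks = [] := hc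
    exact single_eq_same.symm
  · rw [single_eq_of_ne fun h : c = vertexCell G => hc (congrArg Sigma.fst h)]
    by_contra h
    have : dim c.1 = 0 := (mem_supported ℤ a).1 ha (mem_support_iff.2 h)
    obtain ⟨_ | ⟨m, ms⟩, g⟩ := c
    · exact hc rfl
    · simp [dim] at this

variable [Shalgebra G]

theorem homogPart_cellChain (n : ℕ) (a : Cell G →₀ ℤ) :
    homogPart (n + 1) (cellChain a) = cellChain (cellPart n a) := by
  induction a using Finsupp.induction_linear with
  | zero => simp
  | add a b ha hb => simp only [map_add, ha, hb]
  | single c k =>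
    have hm : cellChain (single c k) ∈ homog (dim c.1 + 1) :=
      cellChain_mem_homog (single_mem_supported ℤ k (show dim c.1 = dim c.1 from rfl))
    by_cases h : dim c.1 = n
    · rw [cellPart_single_of_eq h]
      subst h
      exact homogPart_of_mem hm
    · rw [cellPart_single_of_ne h, map_zero]
      exact homogPart_of_mem_of_ne (by simpa using h) hm

theorem cellBdry_mem_zero {a : Cell G →₀ ℤ} (ha : a ∈ cellsOf G 0) : cellBdry a = 0 := by
  refine mem_supported_induction cellBdry (⊥ : Submodule ℤ (Cell G →₀ ℤ)) (fun c hc => ?_) ha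
  rw [Submodule.mem_bot, cellBdry, linearCombination_single, one_smul]
  refine Finset.sum_eq_zero fun f _ => ?_
  have := dim_faceCell c f
  have hc' : dim c.1 = 0 := hc
  omega

theorem cellBdry_cellPart (n : ℕ) (a : Cell G →₀ ℤ) :
    cellBdry (cellPart (n + 1) a) = cellPart n (cellBdry a) := by
  induction a using Finsupp.induction_linear with
  | zero => simp
  | add a b ha hb => simp only [map_add, ha, hb]
  | single c k =>
    have hf := dim_faceCell c
    rw [show cellBdry (single c k) = k • ∑ f : Facet c.1,
      single (faceCell c f) ((-1) ^ facetExponent c.1 f) from linearCombination_single ..,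
      map_smul, map_sum]
    by_cases h : dim c.1 = n + 1
    · rw [cellPart_single_of_eq h, cellBdry, linearCombination_single]
      congr 1
      refine Finset.sum_congr rfl fun f _ => (cellPart_single_of_eq ?_ _).symm
      have := hf f
      omega
    · rw [cellPart_single_of_ne h, map_zero, Finset.sum_eq_zero, smul_zero]
      intro f _
      refine cellPart_single_of_ne ?_ _
      have := hf f
      omega

theorem cellBdry_cellPart_zero (a : Cell G →₀ ℤ) : cellBdry (cellPart 0 a) = 0 :=
  cellBdry_mem_zero (cellPart_mem 0 a)

/-- Combinations of cells of one dimension that carry boundaries within the skeleton of that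
dimension vanish. -/
theorem eq_zero_of_cellChain_eq {n : ℕ} {a : Cell G →₀ ℤ} (ha : a ∈ cellsOf G n)
    {w : SChains (BG G)} (hw : w ∈ SIn (skel G (n + 1))) (h : cellChain a = sBdry w) : a = 0 :=
  eq_zero_of_relBoundary_skel ha hw (by rw [h, sub_self]; exact zero_mem _)

/-- The cellular boundary squares to zero because the singular one does and combinations of cells
of one dimension are determined by their singular chains. -/
theorem cellBdry_cellBdry {n : ℕ} {a : Cell G →₀ ℤ} (ha : a ∈ cellsOf G (n + 2)) :
    cellBdry (cellBdry a) = 0 := by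
  have h₁ := cellBdry_mem ha
  refine eq_zero_of_cellChain_eq (cellBdry_mem h₁) (zero_mem _) ?_
  rw [← sBdry_cellChain h₁, ← sBdry_cellChain ha, sBdry_sBdry, map_zero]

theorem sBdry_cellChain_vertex (k : ℤ) :
    sBdry (cellChain (single (vertexCell G) k))
      = single ⟨0, emptySimp (BG G)⟩ k := by
  have : cellChain (single (vertexCell G) k)
      = k • sMap (cellMap (vertexCell G)) (fundChain []) := linearCombination_single ..
  have h : sMap (cellMap (vertexCell G)) (fundChain [])
      = single ⟨1, (cellMap (vertexCell G)).comp (ContinuousMap.const _ ())⟩ 1 :=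
    chainMap_single ..
  rw [this, map_smul, h, bdryOf_single_succ, Fin.sum_univ_one, Fin.val_zero, pow_zero, one_smul,
    smul_single, smul_eq_mul, mul_one, eq_emptySimp (ContinuousMap.comp _ (simpMap _))]

theorem eq_zero_of_sBdry_cellChain_eq_zero {a : Cell G →₀ ℤ} (ha : a ∈ cellsOf G 0)
    (h : sBdry (cellChain a) = 0) : a = 0 := by
  rw [eq_single_of_mem_cellsOf_zero ha] at h ⊢
  rw [sBdry_cellChain_vertex, single_eq_zero] at h
  rw [h, single_zero]

/-- A singular cycle in a skeleton is homologous to a cellular cycle without vertices. The top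
dimensional part of the cycle is cellular modulo the lower skeleton, and splits off as a cycle
since cells of one dimension less are independent. -/
theorem exists_cellular_cycle (N : ℕ) : ∀ z : SChains (BG G), z ∈ SIn (skel G N) → sBdry z = 0 →
    ∃ w, ∃ a, cellBdry a = 0 ∧ cellPart 0 a = 0 ∧ z = sBdry w + cellChain a := by
  induction N with
  | zero =>
    intro z hz _
    rw [skel_zero] at hz
    obtain ⟨k, rfl⟩ := exists_smul_of_mem_SIn_empty hz
    -- the empty simplex is the boundary of any vertex
    refine ⟨cellChain (single (vertexCell G) k), 0, map_zero _, map_zero _, ?_⟩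
    rw [map_zero, add_zero, sBdry_cellChain_vertex, smul_single, smul_eq_mul, mul_one]
  | succ n ih =>
    intro z hz hbz
    obtain ⟨w, a, ha, hz'⟩ := exists_relCycle_skel hz (by rw [hbz]; exact zero_mem _)
    have hb : sBdry (z - sBdry w - cellChain a) = - sBdry (cellChain a) := by
      rw [map_sub, map_sub, hbz, sBdry_sBdry, sub_zero, zero_sub]
    have key : sBdry (cellChain a) = 0 ∧ cellBdry a = 0 ∧ cellPart 0 a = 0 := by
      cases n with
      | zero =>
        rw [skel_zero] at hz'
        have ha₀ : a = 0 := by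
          obtain ⟨k, hk⟩ := exists_smul_of_mem_SIn_empty hz'
          rw [hk, map_smul, bdryOf_single_zero, smul_zero] at hb
          exact eq_zero_of_sBdry_cellChain_eq_zero ha (neg_eq_zero.1 hb.symm)
        rw [ha₀]; simp
      | succ n =>
        have h₁ := sBdry_cellChain ha
        have h₂ : cellBdry a = 0 := eq_zero_of_cellChain_eq (cellBdry_mem ha) (neg_mem hz')
          (by rw [map_neg, hb, neg_neg, h₁])
        refine ⟨by rw [h₁, h₂, map_zero], h₂, ?_⟩
        refine mem_supported_induction (cellPart 0) (⊥ : Submodule ℤ (Cell G →₀ ℤ))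
          (fun c hc => ?_) ha
        have hc' : dim c.1 = n + 1 := hc
        rw [Submodule.mem_bot, cellPart_single_of_ne (by omega)]
    obtain ⟨w', a', ha', ha₀', hw'⟩ := ih _ hz' (by rw [hb, key.1, neg_zero])
    refine ⟨w + w', a + a', by rw [map_add, key.2.1, ha', add_zero],
      by rw [map_add, key.2.2, ha₀', add_zero], ?_⟩
    rw [map_add, map_add]
    have : z = (z - sBdry w - cellChain a) + sBdry w + cellChain a := by abel
    rw [this, hw']
    abel

/-- Every singular cycle of positive degree is homologous to a cellular cycle of the same degree,
and every reduced singular cycle of degree zero is a boundary. -/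
theorem exists_cellular_cycle_homog {n : ℕ} {z : SChains (BG G)} (hz : z ∈ homog (n + 1))
    (hbz : sBdry z = 0) : ∃ w ∈ homog (n + 2), ∃ a ∈ cellsOf G n, cellBdry a = 0 ∧
      (n = 0 → a = 0) ∧ z = sBdry w + cellChain a := by
  obtain ⟨N, hN⟩ := exists_mem_SIn_skel z
  obtain ⟨w, a, ha, ha₀, h⟩ := exists_cellular_cycle N z hN hbz
  refine ⟨homogPart (n + 2) w, homogPart_mem _ _, cellPart n a, cellPart_mem n a, ?_, ?_, ?_⟩
  · cases n with
    | zero => exact cellBdry_cellPart_zero a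
    | succ n => rw [cellBdry_cellPart, ha, map_zero]
  · rintro rfl
    exact ha₀
  · rw [sBdry_homogPart, ← homogPart_cellChain, ← map_add, ← h, homogPart_of_mem hz]

/-- A cellular chain bounding in the singular complex bounds in the cellular complex. The bounding
chain is moved down from skeleton to skeleton until it is cellular. -/
theorem exists_cellBdry_eq {n : ℕ} {a : Cell G →₀ ℤ} (ha : a ∈ cellsOf G n) (N : ℕ) :
    ∀ w ∈ SIn (skel G (n + 1 + N)), cellChain a = sBdry w →
      ∃ b ∈ cellsOf G (n + 1), cellBdry b = a := by
  induction N with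
  | zero =>
    intro w hw h
    exact ⟨0, zero_mem _, by rw [map_zero, eq_zero_of_cellChain_eq ha hw h]⟩
  | succ N ih =>
    intro w hw h
    obtain ⟨u, b, hb, hw'⟩ := exists_relCycle_skel (n := n + 1 + N) hw (by
      rw [← h]; exact SIn_mono (skel_mono (by omega)) (cellChain_mem_SIn ha))
    have hbd : sBdry (w - sBdry u - cellChain b) = cellChain a - sBdry (cellChain b) := by
      rw [map_sub, map_sub, sBdry_sBdry, sub_zero, h]
    cases N with
    | zero =>
      -- the cells `b` split off bound `a` up to a boundary in the skeleton of dimension `n`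
      refine ⟨b, hb, ?_⟩
      rw [sBdry_cellChain hb, ← map_sub] at hbd
      have := eq_zero_of_cellChain_eq (sub_mem ha (cellBdry_mem hb)) hw' hbd.symm
      exact (sub_eq_zero.1 this).symm
    | succ N =>
      -- the cells `b` split off form a cycle, and `w` can be replaced by a chain one skeleton lower
      have hb' : b ∈ cellsOf G ((n + 1 + N) + 1) := hb
      have h₀ : cellBdry b = 0 := by
        refine eq_zero_of_relBoundary_skel (cellBdry_mem hb') (neg_mem hw') ?_
        rw [map_neg, hbd, neg_sub, sBdry_cellChain hb', sub_sub_cancel]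
        exact SIn_mono (skel_mono (by omega)) (cellChain_mem_SIn ha)
      refine ih _ hw' ?_
      rw [hbd, sBdry_cellChain hb', h₀, map_zero, sub_zero]

end Comparison

end Prismatic

namespace Prismatic

open Finsupp Topology

/-! ### Comparison with the singular chain complex -/

section SingularComplex

open CategoryTheory Limits Simplicial

variable (X : Type u) [TopologicalSpace X]

/-- The singular chain complex with integer coefficients. -/
noncomputable abbrev singComplex : ChainComplex (ModuleCat.{u} ℤ) ℕ :=
  ((AlgebraicTopology.singularChainComplexFunctor (ModuleCat.{u} ℤ)).obj
    (ModuleCat.of ℤ (ULift.{u} ℤ))).obj (TopCat.of X)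

/-- The singular simplicial set. -/
noncomputable abbrev singSet : SSet.{u} := TopCat.toSSet.obj (TopCat.of X)

/-- The simplices of the singular simplicial set are the continuous maps from the standard
simplices. -/
noncomputable def singSimplexEquiv (n : ℕ) : (singSet X) _⦋n⦌ ≃ C(Simp (n + 1), X) :=
  TopCat.toSSetObjEquiv (TopCat.of X) (Opposite.op ⦋n⦌)

theorem singSimplexEquiv_δ {n : ℕ} (i : Fin (n + 2)) (x : (singSet X) _⦋n + 1⦌) :
    singSimplexEquiv X n ((singSet X).δ i x)
      = (singSimplexEquiv X (n + 1) x).comp (simpMap i.succAbove) := rfl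

/-- The inclusion of the direct summand belonging to a simplex. -/
noncomputable def singι {n : ℕ} (x : (singSet X) _⦋n⦌) :
    ULift.{u} ℤ →ₗ[ℤ] (singComplex X).X n :=
  (SSet.ιChainComplex (R := ModuleCat.of ℤ (ULift.{u} ℤ)) (singSet X) x).hom

/-- The generator of the singular chain complex belonging to a simplex. -/
noncomputable def singGen {n : ℕ} (σ : C(Simp (n + 1), X)) : (singComplex X).X n :=
  singι X ((singSimplexEquiv X n).symm σ) ⟨1⟩

/-- The map from chains in the sense of finitely supported functions to the singular chain complex;
it kills all simplices of the wrong dimension. -/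
noncomputable def toSing (n : ℕ) : SChains X →ₗ[ℤ] (singComplex X).X n :=
  linearCombination ℤ fun x => if h : x.1 = n + 1 then singGen X (h ▸ x.2) else 0

/-- The inverse map from the singular chain complex to chains in the sense of finitely supported
functions. -/
noncomputable def ofSing (n : ℕ) : (singComplex X).X n →ₗ[ℤ] SChains X :=
  ((SSet.isColimitChainComplexXCofan (singSet X) (ModuleCat.of ℤ (ULift.{u} ℤ)) n).desc
    (Cofan.mk (ModuleCat.of ℤ (SChains X)) fun x => ModuleCat.ofHom
      (LinearMap.toSpanSingleton ℤ (SChains X) (single ⟨n + 1, singSimplexEquiv X n x⟩ 1) ∘ₗ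
        ULift.moduleEquiv.toLinearMap))).hom

theorem ι_ofSing (n : ℕ) (x : (singSet X) _⦋n⦌) (k : ULift.{u} ℤ) :
    ofSing X n (singι X x k)
      = k.down • single ⟨n + 1, singSimplexEquiv X n x⟩ 1 := by
  have := (SSet.isColimitChainComplexXCofan (singSet X) (ModuleCat.of ℤ (ULift.{u} ℤ)) n).fac
    (Cofan.mk (ModuleCat.of ℤ (SChains X)) fun x => ModuleCat.ofHom
      (LinearMap.toSpanSingleton ℤ (SChains X) (single ⟨n + 1, singSimplexEquiv X n x⟩ 1) ∘ₗ
        ULift.moduleEquiv.toLinearMap)) ⟨x⟩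
  exact LinearMap.congr_fun (congrArg ModuleCat.Hom.hom this) k

/-- Linear maps on singular chains that agree on the generators are equal. -/
theorem sing_ext {n : ℕ} {M : Type u} [AddCommGroup M] [Module ℤ M]
    {f g : (singComplex X).X n →ₗ[ℤ] M}
    (h : ∀ σ, f (singGen X σ) = g (singGen X σ)) : f = g := by
  have : ModuleCat.ofHom f = ModuleCat.ofHom g := by
    refine SSet.chainComplex_hom_ext fun x => ?_
    refine ModuleCat.hom_ext (LinearMap.ext fun k => ?_)
    have hk : k = k.down • (⟨1⟩ : ULift.{u} ℤ) := by
      ext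
      simp
    have hx := h (singSimplexEquiv X n x)
    rw [singGen, Equiv.symm_apply_apply] at hx
    change f (singι X x k) = g (singι X x k)
    rw [hk, map_zsmul, map_zsmul, map_zsmul, hx]
  exact congrArg ModuleCat.Hom.hom this

theorem ofSing_singGen {n : ℕ} (σ : C(Simp (n + 1), X)) :
    ofSing X n (singGen X σ) = single ⟨n + 1, σ⟩ 1 := by
  rw [singGen, ι_ofSing, Equiv.apply_symm_apply, one_smul]

theorem toSing_single {n : ℕ} (σ : C(Simp (n + 1), X)) :
    toSing X n (single ⟨n + 1, σ⟩ 1) = singGen X σ := by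
  rw [toSing, linearCombination_single, dif_pos rfl]
  exact ((singComplex X).X n).isModule.one_smul _

theorem toSing_ofSing {n : ℕ} (y : (singComplex X).X n) : toSing X n (ofSing X n y) = y := by
  have : (toSing X n ∘ₗ ofSing X n : (singComplex X).X n →ₗ[ℤ] (singComplex X).X n)
      = LinearMap.id := sing_ext X fun σ => by
    rw [LinearMap.comp_apply, ofSing_singGen, toSing_single, LinearMap.id_apply]
  exact LinearMap.congr_fun this y

theorem ofSing_toSing {n : ℕ} {a : SChains X} (ha : a ∈ homog (n + 1)) :
    ofSing X n (toSing X n a) = a := by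
  have := homog_induction (ofSing X n ∘ₗ toSing X n - LinearMap.id)
    (⊥ : Submodule ℤ (SChains X)) (fun σ => by
      rw [Submodule.mem_bot, LinearMap.sub_apply, LinearMap.comp_apply, toSing_single,
        ofSing_singGen, LinearMap.id_apply, sub_self]) ha
  simpa [sub_eq_zero] using this

theorem ofSing_mem {n : ℕ} (y : (singComplex X).X n) : ofSing X n y ∈ homog (n + 1) := by
  have : homogPart (n + 1) ∘ₗ ofSing X n = ofSing X n := sing_ext X fun σ => by
    rw [LinearMap.comp_apply, ofSing_singGen, homogPart_single_self]
  rw [← this]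
  exact homogPart_mem _ _

theorem ofSing_d {n : ℕ} (y : (singComplex X).X (n + 1)) :
    ofSing X n (((singComplex X).d (n + 1) n).hom y) = sBdry (ofSing X (n + 1) y) := by
  have : ofSing X n ∘ₗ ((singComplex X).d (n + 1) n).hom = sBdry ∘ₗ ofSing X (n + 1) := by
    refine sing_ext X fun σ => ?_
    rw [LinearMap.comp_apply, LinearMap.comp_apply, ofSing_singGen, bdryOf_single_succ]
    have h := LinearMap.congr_fun (congrArg ModuleCat.Hom.hom
      (SSet.ιChainComplex_d (singSet X) (ModuleCat.of ℤ (ULift.{u} ℤ))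
        ((singSimplexEquiv X (n + 1)).symm σ))) ⟨1⟩
    have h' : ((singComplex X).d (n + 1) n).hom (singGen X σ)
        = ∑ i : Fin (n + 2), (-1 : ℤ) ^ (i : ℕ) •
          singι X ((singSet X).δ i ((singSimplexEquiv X (n + 1)).symm σ)) ⟨1⟩ := by
      refine h.trans ?_
      rw [ModuleCat.hom_sum, LinearMap.sum_apply]
      rfl
    rw [h', map_sum]
    refine Finset.sum_congr rfl fun i _ => ?_
    rw [map_zsmul, ι_ofSing, singSimplexEquiv_δ, Equiv.apply_symm_apply, one_smul]
  exact LinearMap.congr_fun this y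

end SingularComplex

end Prismatic

namespace Prismatic

open Finsupp Topology

/-! ### The homology of the classifying space -/

section HomologyComparison

open CategoryTheory Limits

/-- The homology of a short complex of modules is a quotient of any module that maps to the cycles
and covers them modulo boundaries. -/
theorem nonempty_quotient_equiv_homology {R : Type*} [Ring R] {S : ShortComplex (ModuleCat.{u} R)}
    {M : Type*} [AddCommGroup M] [Module R M] (N : Submodule R M) (φ : M →ₗ[R] S.X₂)
    (h₀ : ∀ x, S.g.hom (φ x) = 0) (h₁ : ∀ y, S.g.hom y = 0 → ∃ x u, y = φ x + S.f.hom u)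
    (h₂ : ∀ x, x ∈ N ↔ ∃ u, φ x = S.f.hom u) : Nonempty ((M ⧸ N) ≃ₗ[R] S.homology) := by
  let ρ : M →ₗ[R] (LinearMap.ker S.g.hom ⧸ LinearMap.range S.moduleCatToCycles) :=
    (LinearMap.range S.moduleCatToCycles).mkQ ∘ₗ
      φ.codRestrict (LinearMap.ker S.g.hom) (fun x => LinearMap.mem_ker.2 (h₀ x))
  have hker : N = LinearMap.ker ρ := by
    ext x
    rw [h₂, LinearMap.mem_ker, LinearMap.comp_apply, Submodule.mkQ_apply,
      Submodule.Quotient.mk_eq_zero, LinearMap.mem_range]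
    refine exists_congr fun u => ?_
    rw [eq_comm]
    exact (Subtype.ext_iff (a1 := S.moduleCatToCycles u) (a2 := φ.codRestrict
      (LinearMap.ker S.g.hom) (fun x => LinearMap.mem_ker.2 (h₀ x)) x)).symm
  have hsurj : Function.Surjective ρ := by
    intro q
    obtain ⟨⟨y, hy⟩, rfl⟩ := Submodule.Quotient.mk_surjective _ q
    obtain ⟨x, u, rfl⟩ := h₁ y hy
    refine ⟨x, ?_⟩
    rw [LinearMap.comp_apply, Submodule.mkQ_apply, Submodule.Quotient.eq]
    refine ⟨-u, Subtype.ext ?_⟩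
    change S.f.hom (-u) = φ x - (φ x + S.f.hom u)
    rw [map_neg]
    abel
  exact ⟨((Submodule.quotEquivOfEq _ _ hker).trans (ρ.quotKerEquivOfSurjective hsurj)).trans
    S.moduleCatHomologyIso.toLinearEquiv.symm⟩

/-- Singular homology is the homology of consecutive terms of the singular chain complex. -/
theorem nonempty_sc'_homology_equiv (X : Type u) [TopologicalSpace X] (i j k : ℕ)
    (hi : (ComplexShape.down ℕ).prev j = i) (hk : (ComplexShape.down ℕ).next j = k) :
    Nonempty (((singComplex X).sc' i j k).homology ≃ₗ[ℤ] singularHomology j X) :=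
  ⟨(ShortComplex.homologyMapIso ((singComplex X).isoSc' i j k hi hk)).toLinearEquiv.symm⟩

end HomologyComparison

section ToCells

variable {G : Type u}

variable (G) in
/-- The inclusion of a prismatic chain group into the group of combinations of cells. -/
noncomputable def toCells (n : ℕ) : ChainGroup G n →ₗ[ℤ] (Cell G →₀ ℤ) :=
  lmapDomain ℤ ℤ Subtype.val

theorem toCells_single {n : ℕ} (c : Generator G n) (k : ℤ) :
    toCells G n (single c k) = single c.1 k := mapDomain_single

theorem toCells_injective (n : ℕ) : Function.Injective (toCells G n) :=
  mapDomain_injective Subtype.val_injective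

theorem toCells_mem {n : ℕ} (a : ChainGroup G n) : toCells G n a ∈ cellsOf G n := by
  classical
  rw [cellsOf, mem_supported]
  intro c hc
  obtain ⟨c', -, rfl⟩ := Finset.mem_image.1 (mapDomain_support (Finset.mem_coe.1 hc))
  exact c'.2.2

theorem exists_toCells_eq {n : ℕ} (hn : n ≠ 0) {a : Cell G →₀ ℤ} (ha : a ∈ cellsOf G n) :
    ∃ x, toCells G n x = a := by
  refine ⟨a.comapDomain Subtype.val Subtype.val_injective.injOn,
    mapDomain_comapDomain _ Subtype.val_injective a fun c hc => ?_⟩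
  have hc' : dim c.1 = n := (mem_supported ℤ a).1 ha hc
  refine ⟨⟨c, fun h => hn ?_, hc'⟩, rfl⟩
  rw [← hc', h]
  rfl

theorem subsingleton_chainGroup_zero : Subsingleton (ChainGroup G 0) := by
  have : IsEmpty (Generator G 0) := by
    refine ⟨fun ⟨⟨ks, g⟩, hne, hd⟩ => ?_⟩
    rcases ks with _ | ⟨m, ms⟩
    · exact hne rfl
    · simp [dim] at hd
  infer_instance

variable [Shalgebra G]

theorem cellBdry_single (c : Cell G) :
    cellBdry (single c 1)
      = ∑ f : Facet c.1, single (faceCell c f) ((-1) ^ facetExponent c.1 f) := by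
  rw [cellBdry, linearCombination_single, one_smul]

/-- The two ends of a cell of dimension one cancel. So the cellular complex is not affected by
leaving out the vertex, except in degree zero. -/
theorem cellBdry_eq_zero {a : Cell G →₀ ℤ} (ha : a ∈ cellsOf G 1) : cellBdry a = 0 := by
  refine mem_supported_induction cellBdry (⊥ : Submodule ℤ (Cell G →₀ ℤ)) (fun c hc => ?_) ha
  rw [Submodule.mem_bot, cellBdry_single]
  obtain ⟨ks, g⟩ := c
  have hc' : dim ks = 1 := hc
  obtain rfl : ks = [0] := by
    match ks, hc' with
    | [0], _ => rfl
    | [m + 1], h => simp [dim] at h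
    | m :: m' :: ms, h => simp only [dim] at h; omega
  refine (sum_facets_cons 0 [] _).trans ?_
  rw [Fin.sum_univ_two]
  have h₀ : (∑ f : Facet [], single (faceCell (⟨[0], g⟩ : Cell G) (Sum.inr f))
      ((-1 : ℤ) ^ facetExponent [0] (Sum.inr f))) = 0 := Finset.sum_empty
  rw [h₀, add_zero]
  change single (vertexCell G) ((-1 : ℤ) ^ 0) + single (vertexCell G) ((-1) ^ 1) = 0
  rw [← single_add]
  simp

/-- The prismatic differential is the cellular boundary. -/
theorem cellBdry_toCells {n : ℕ} (a : ChainGroup G n) :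
    cellBdry (toCells G n a) = toCells G (n - 1) (differential G n a) := by
  have : cellBdry ∘ₗ toCells G n = toCells G (n - 1) ∘ₗ differential G n := by
    refine Finsupp.lhom_ext' fun c => LinearMap.ext_ring ?_
    change cellBdry (toCells G n (single c 1)) = toCells G (n - 1) (differential G n (single c 1))
    rw [toCells_single, differential, linearCombination_single, one_smul, map_sum]
    by_cases hn : n = 1
    · rw [cellBdry_eq_zero (single_mem_supported ℤ _ (c.2.2.trans hn))]
      refine (Finset.sum_eq_zero fun f _ => ?_).symm
      rw [dif_neg, map_zero]
      have h₂ := dim_facetShape_add_one c.1.1 f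
      have h₃ := c.2.2
      intro h
      have h₄ : facetShape c.1.1 f ≠ [] := h
      match hs : facetShape c.1.1 f, h₄ with
      | m :: ms, _ => rw [hs] at h₂; simp only [dim] at h₂; omega
    · rw [cellBdry_single]
      refine Finset.sum_congr rfl fun f _ => ?_
      have hne : facetShape c.1.1 f ≠ [] := fun h => by
        have h₂ := dim_facetShape_add_one c.1.1 f
        rw [h] at h₂
        exact hn (c.2.2.symm.trans h₂.symm)
      rw [dif_pos hne]
      have hdim : dim (faceCell c.1 f).1 = n - 1 := by
        have h₂ := dim_faceCell c.1 f
        have h₃ := c.2.2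
        omega
      exact (toCells_single (n := n - 1) ⟨faceCell c.1 f, hne, hdim⟩ _).symm
  exact LinearMap.congr_fun this a

theorem differential_comp_differential (n : ℕ) :
    differential G n ∘ₗ differential G (n + 1) = 0 := by
  refine LinearMap.ext fun x => ?_
  rcases n with _ | n
  · exact (subsingleton_chainGroup_zero (G := G)).elim _ _
  · refine toCells_injective n ?_
    change toCells G (n + 1 - 1) (differential G (n + 1) (differential G (n + 2) x))
      = toCells G n 0
    rw [← cellBdry_toCells]
    have h : toCells G (n + 1) (differential G (n + 2) x) = cellBdry (toCells G (n + 2) x) :=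
      (cellBdry_toCells x).symm
    rw [h, cellBdry_cellBdry (toCells_mem x), map_zero]

theorem ofSing_injective {X : Type u} [TopologicalSpace X] {n : ℕ} :
    Function.Injective (ofSing X n) := fun x y h => by
  rw [← toSing_ofSing X x, h, toSing_ofSing X y]

theorem ofSing_d_toSing {X : Type u} [TopologicalSpace X] {n : ℕ} {w : SChains X}
    (hw : w ∈ homog (n + 2)) :
    ofSing X n (((singComplex X).d (n + 1) n).hom (toSing X (n + 1) w)) = sBdry w := by
  rw [ofSing_d, ofSing_toSing X hw]

/-- In positive degrees the prismatic homology is the singular homology of the classifying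
space. -/
theorem nonempty_homology_equiv {n : ℕ} (hn : 1 ≤ n) :
    Nonempty (Homology G n ≃ₗ[ℤ] singularHomology n (BG G)) := by
  obtain ⟨n, rfl⟩ : ∃ m, n = m + 1 := ⟨n - 1, by omega⟩
  obtain ⟨e⟩ := nonempty_sc'_homology_equiv (BG G) (n + 2) (n + 1) n
    (ChainComplex.prev ℕ (n + 1)) (ChainComplex.next_nat_succ n)
  suffices h : Nonempty (Homology G (n + 1) ≃ₗ[ℤ]
      ((singComplex (BG G)).sc' (n + 2) (n + 1) n).homology) from ⟨h.some.trans e⟩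
  have hφ : ∀ x : ChainGroup G (n + 1), cellChain (toCells G (n + 1) x) ∈ homog (n + 2) :=
    fun x => cellChain_mem_homog (toCells_mem x)
  refine nonempty_quotient_equiv_homology _ (toSing (BG G) (n + 1) ∘ₗ cellChain ∘ₗ
    toCells G (n + 1) ∘ₗ (LinearMap.ker (differential G (n + 1))).subtype) ?_ ?_ ?_
  · rintro ⟨x, hx⟩
    change ((singComplex (BG G)).d (n + 1) n).hom
      (toSing (BG G) (n + 1) (cellChain (toCells G (n + 1) x))) = 0
    refine ofSing_injective ?_
    rw [ofSing_d_toSing (hφ x), sBdry_cellChain (toCells_mem x), cellBdry_toCells,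
      LinearMap.mem_ker.1 hx, map_zero, map_zero, map_zero]
  · intro y hy
    change (singComplex (BG G)).X (n + 1) at y
    replace hy : ((singComplex (BG G)).d (n + 1) n).hom y = 0 := hy
    have hz : sBdry (ofSing (BG G) (n + 1) y) = 0 := by rw [← ofSing_d, hy, map_zero]
    obtain ⟨w, hw, a, ha, hba, -, h⟩ := exists_cellular_cycle_homog (ofSing_mem (BG G) y) hz
    obtain ⟨x, rfl⟩ := exists_toCells_eq n.succ_ne_zero ha
    rw [cellBdry_toCells] at hba
    have hx : differential G (n + 1) x = 0 := toCells_injective n (hba.trans (map_zero _).symm)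
    refine ⟨⟨x, hx⟩, toSing (BG G) (n + 2) w, ofSing_injective ?_⟩
    change _ = ofSing (BG G) (n + 1) (toSing (BG G) (n + 1) (cellChain (toCells G (n + 1) x))
      + ((singComplex (BG G)).d (n + 2) (n + 1)).hom (toSing (BG G) (n + 2) w))
    rw [map_add, ofSing_toSing _ (hφ x), ofSing_d_toSing hw, h, add_comm]
  · rintro ⟨x, hx⟩
    change (∃ v, differential G (n + 2) v = x) ↔
      ∃ u, toSing (BG G) (n + 1) (cellChain (toCells G (n + 1) x))
        = ((singComplex (BG G)).d (n + 2) (n + 1)).hom u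
    constructor
    · rintro ⟨v, rfl⟩
      refine ⟨toSing (BG G) (n + 2) (cellChain (toCells G (n + 2) v)), ofSing_injective ?_⟩
      rw [ofSing_toSing _ (hφ _), ofSing_d_toSing (cellChain_mem_homog (toCells_mem v)),
        sBdry_cellChain (toCells_mem v), cellBdry_toCells]
      rfl
    · rintro ⟨u, hu⟩
      have hu' : cellChain (toCells G (n + 1) x) = sBdry (ofSing (BG G) (n + 2) u) := by
        rw [← ofSing_d, ← hu, ofSing_toSing _ (hφ x)]
      obtain ⟨N, hN⟩ := exists_mem_SIn_skel (ofSing (BG G) (n + 2) u)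
      obtain ⟨b, hb, hbx⟩ := exists_cellBdry_eq (toCells_mem x) N _
        (SIn_mono (skel_mono (Nat.le_add_left N (n + 1 + 1))) hN) hu'
      obtain ⟨v, rfl⟩ := exists_toCells_eq (n + 1).succ_ne_zero hb
      exact ⟨v, toCells_injective (n + 1) ((cellBdry_toCells v).symm.trans hbx)⟩

theorem subsingleton_homology_zero : Subsingleton (Homology G 0) := by
  have := subsingleton_chainGroup_zero (G := G)
  exact (Submodule.Quotient.mk_surjective _).subsingleton

/-- The classifying space has the zeroth homology of a connected space. -/
theorem nonempty_singularHomology_zero_equiv :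
    Nonempty (singularHomology 0 (BG G) ≃ₗ[ℤ] ℤ) := by
  obtain ⟨e⟩ := nonempty_sc'_homology_equiv (BG G) 1 0 0
    (ChainComplex.prev ℕ 0) ChainComplex.next_nat_zero
  suffices h : Nonempty ((ℤ ⧸ (⊥ : Submodule ℤ ℤ)) ≃ₗ[ℤ]
      ((singComplex (BG G)).sc' 1 0 0).homology) from
    ⟨(((Submodule.quotEquivOfEqBot _ rfl).symm.trans h.some).trans e).symm⟩
  have hφ : ∀ k : ℤ, cellChain (single (vertexCell G) k) ∈ homog 1 := fun k =>
    cellChain_mem_homog (single_mem_supported ℤ k (show dim (vertexCell G).1 = 0 from rfl))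
  refine nonempty_quotient_equiv_homology _ (toSing (BG G) 0 ∘ₗ cellChain ∘ₗ
    lsingle (vertexCell G)) ?_ ?_ ?_
  · intro k
    change ((singComplex (BG G)).d 0 0).hom _ = 0
    rw [(singComplex (BG G)).shape 0 0 (by simp)]
    rfl
  · intro y _
    -- the augmentation `k` of `y`; subtracting `k` times the vertex gives a reduced cycle
    obtain ⟨k, hk⟩ : ∃ k : ℤ, sBdry (ofSing (BG G) 0 y) = single ⟨0, emptySimp (BG G)⟩ k := by
      obtain ⟨k, hk⟩ := exists_smul_of_mem_SIn_empty (homog_induction LinearMap.id _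
        (fun σ => mem_SIn_of_isEmpty σ (∅ : Set (BG G)) 1)
        (sBdry_mem_homog (ofSing_mem (BG G) (n := 0) y)))
      exact ⟨k, by rw [smul_single, smul_eq_mul, mul_one] at hk; exact hk⟩
    obtain ⟨w, hw, a, -, -, ha, h⟩ := exists_cellular_cycle_homog (n := 0)
      (sub_mem (ofSing_mem (BG G) y) (hφ k))
      (by rw [map_sub, hk, sBdry_cellChain_vertex, sub_self])
    rw [ha rfl, map_zero, add_zero] at h
    refine ⟨k, toSing (BG G) 1 w, ofSing_injective ?_⟩
    change _ = ofSing (BG G) 0 (toSing (BG G) 0 (cellChain (single (vertexCell G) k))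
      + ((singComplex (BG G)).d 1 0).hom (toSing (BG G) 1 w))
    rw [map_add, ofSing_toSing _ (hφ k), ofSing_d_toSing hw, ← h, add_sub_cancel]
  · intro k
    rw [Submodule.mem_bot]
    change k = 0 ↔ ∃ u, toSing (BG G) 0 (cellChain (single (vertexCell G) k))
      = ((singComplex (BG G)).d 1 0).hom u
    constructor
    · rintro rfl
      exact ⟨0, by simp⟩
    · rintro ⟨u, hu⟩
      have hu' : cellChain (single (vertexCell G) k) = sBdry (ofSing (BG G) 1 u) := by
        rw [← ofSing_d, ← hu, ofSing_toSing _ (hφ k)]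
      have := congrArg sBdry hu'
      rw [sBdry_sBdry, sBdry_cellChain_vertex] at this
      exact single_eq_zero.1 this

end ToCells

end Prismatic

namespace Prismatic

open Topology

/-! ### The boundary of a prism -/

/-- The barycentric coordinates as affine functions on the space containing the chart. -/
def affineCoord : (ks : List ℕ) → (Fin (dim ks) → ℝ) → Facet ks → ℝ
  | [], _ => Empty.elim
  | m :: ms, v => Sum.elim
      (Fin.cases (1 - ∑ i : Fin (m + 1), v (Fin.castAdd (dim ms) i))
        fun i => v (Fin.castAdd (dim ms) i))
      (affineCoord ms fun r => v (Fin.natAdd (m + 1) r))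

theorem affineCoord_chart : (ks : List ℕ) → (x : Prism ks) → (f : Facet ks) →
    affineCoord ks (chart ks x) f = coord ks x f
  | m :: ms, (x, y), Sum.inl i => by
    have h : ∀ i : Fin (m + 1), chart (m :: ms) (x, y) (Fin.castAdd (dim ms) i) = x i.succ :=
      fun i => Fin.append_left (fun i : Fin (m + 1) => x i.succ) (chart ms y) i
    refine Fin.cases ?_ (fun i => ?_) i
    · change 1 - ∑ i : Fin (m + 1), chart (m :: ms) (x, y) (Fin.castAdd (dim ms) i) = x 0
      have hx : ∑ i, x i = 1 := x.2.2
      rw [Fin.sum_univ_succ] at hx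
      rw [Finset.sum_congr rfl fun i _ => h i]
      linarith
    · exact h i
  | m :: ms, (x, y), Sum.inr f => by
    have h : (fun r => chart (m :: ms) (x, y) (Fin.natAdd (m + 1) r)) = chart ms y :=
      funext fun r => Fin.append_right (fun i : Fin (m + 1) => x i.succ) (chart ms y) r
    change affineCoord ms (fun r => chart (m :: ms) (x, y) (Fin.natAdd (m + 1) r)) f
      = coord ms y f
    rw [h]
    exact affineCoord_chart ms y f

theorem blockSum_affineCoord : (ks : List ℕ) → (v : Fin (dim ks) → ℝ) →
    BlockSum ks (affineCoord ks v)
  | [], _ => trivial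
  | m :: ms, v => by
    refine ⟨?_, blockSum_affineCoord ms _⟩
    rw [Fin.sum_univ_succ]
    exact sub_add_cancel _ _

theorem affineCoord_injective : (ks : List ℕ) → Function.Injective (affineCoord ks)
  | [] => fun _ _ _ => funext fun r => Fin.elim0 r
  | m :: ms => fun v w h => by
    refine funext fun r => ?_
    refine Fin.addCases (m := m + 1) (n := dim ms) (fun i => ?_) (fun i => ?_) r
    · exact congrFun h (Sum.inl i.succ)
    · exact congrFun (affineCoord_injective ms (funext fun f => congrFun h (Sum.inr f))) i

theorem continuous_affineCoord : (ks : List ℕ) → (f : Facet ks) →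
    Continuous fun v => affineCoord ks v f
  | m :: ms, Sum.inl i => by
    refine Fin.cases ?_ (fun i => ?_) i
    · exact continuous_const.sub (continuous_finsetSum _ fun i _ => continuous_apply _)
    · exact continuous_apply _
  | m :: ms, Sum.inr f =>
    (continuous_affineCoord ms f).comp (continuous_pi fun _ => continuous_apply _)

theorem affineCoord_extrapolate : (ks : List ℕ) → (v c : Fin (dim ks) → ℝ) → (t : ℝ) →
    (f : Facet ks) → affineCoord ks (v + t • (v - c)) f
      = (1 + t) * affineCoord ks v f - t * affineCoord ks c f
  | m :: ms, v, c, t, Sum.inl i => by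
    refine Fin.cases ?_ (fun i => ?_) i
    · change 1 - ∑ i : Fin (m + 1), (v _ + t * (v _ - c _))
        = (1 + t) * (1 - ∑ i : Fin (m + 1), v _) - t * (1 - ∑ i : Fin (m + 1), c _)
      rw [Finset.sum_add_distrib, ← Finset.mul_sum, Finset.sum_sub_distrib]
      ring
    · change v _ + t * (v _ - c _) = (1 + t) * v _ - t * c _
      ring
  | m :: ms, v, c, t, Sum.inr f => affineCoord_extrapolate ms _ _ t f

/-- The chart identifies a prism with the convex polytope cut out by its facet coordinates. -/
theorem range_chart (ks : List ℕ) :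
    Set.range (chart ks) = {v | ∀ f, 0 ≤ affineCoord ks v f} := by
  ext v
  constructor
  · rintro ⟨x, rfl⟩ f
    rw [affineCoord_chart]
    exact coord_nonneg ks x f
  · intro hv
    obtain ⟨x, hx⟩ := exists_coord_eq ks _ hv (blockSum_affineCoord ks v)
    refine ⟨x, affineCoord_injective ks (funext fun f => ?_)⟩
    rw [affineCoord_chart, hx]

theorem interior_range_chart (ks : List ℕ) :
    interior (Set.range (chart ks)) = {v | ∀ f, 0 < affineCoord ks v f} := by
  refine Set.Subset.antisymm (fun v hv f => ?_) (interior_maximal ?_ ?_)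
  · have hv₀ : 0 ≤ affineCoord ks v f := by
      have := interior_subset hv
      rw [range_chart] at this
      exact this f
    refine hv₀.lt_of_ne fun h₀ => ?_
    -- moving away from the center, the vanishing coordinate becomes negative at once
    have hc : Continuous fun t : ℝ => v + t • (v - chart ks (center ks)) := by fun_prop
    have hev : ∀ᶠ t : ℝ in 𝓝[>] 0, v + t • (v - chart ks (center ks)) ∈ Set.range (chart ks) := by
      refine (hc.tendsto' 0 v (by simp)).eventually ?_ |>.filter_mono nhdsWithin_le_nhds
      exact mem_interior_iff_mem_nhds.1 hv
    obtain ⟨t, ht, ht₀⟩ := (hev.and self_mem_nhdsWithin).exists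
    rw [range_chart] at ht
    have := ht f
    rw [affineCoord_extrapolate, ← h₀, affineCoord_chart, mul_zero, zero_sub] at this
    have := mul_pos (show (0 : ℝ) < t from ht₀) (coord_center_pos ks f)
    linarith
  · rw [range_chart]
    exact fun v hv f => (hv f).le
  · have : {v | ∀ f, 0 < affineCoord ks v f} = ⋂ f, {v | 0 < affineCoord ks v f} := by
      ext v; simp
    rw [this]
    exact isOpen_iInter_of_finite fun f => isOpen_lt continuous_const (continuous_affineCoord ks f)

theorem isClosed_range_chart (ks : List ℕ) : IsClosed (Set.range (chart ks)) := by
  have : {v | ∀ f, 0 ≤ affineCoord ks v f} = ⋂ f, {v | 0 ≤ affineCoord ks v f} := by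
    ext v; simp
  rw [range_chart, this]
  exact isClosed_iInter fun f => isClosed_le continuous_const (continuous_affineCoord ks f)

/-- The boundary of a prism is where some barycentric coordinate vanishes. -/
theorem boundary_eq_facetUnion (ks : List ℕ) : boundary ks = facetUnion ks := by
  ext x
  change chart ks x ∈ frontier _ ↔ _
  rw [(isClosed_range_chart ks).frontier_eq, interior_range_chart]
  constructor
  · rintro ⟨-, h⟩
    by_contra hx
    refine h fun f => ?_
    rw [affineCoord_chart]
    exact (coord_nonneg ks x f).lt_of_ne fun h => hx ⟨f, h.symm⟩
  · rintro ⟨f, hf⟩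
    refine ⟨⟨x, rfl⟩, fun h => (h f).ne' ?_⟩
    rw [affineCoord_chart, hf]

theorem boundary_eq_iUnion_range (ks : List ℕ) :
    boundary ks = ⋃ f, Set.range (facetPoint ks f) := by
  rw [boundary_eq_facetUnion]
  ext x
  rw [Set.mem_iUnion]
  refine exists_congr fun f => ?_
  rw [range_facetPoint]
  exact Iff.rfl

end Prismatic

namespace Prismatic

/-! ### The orientation of the facets -/

/-- If a linear form `l` vanishes on all columns of a square matrix but the first, and deleting
the row `a` and the first column leaves the identity matrix, then the determinant is determined by
the value of `l` on the first column. -/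
theorem mul_det_of_form {n : ℕ} (A : Matrix (Fin (n + 1)) (Fin (n + 1)) ℝ) (a : Fin (n + 1))
    (l : Fin (n + 1) → ℝ) (h₀ : ∀ c : Fin n, ∑ r, l r * A r c.succ = 0)
    (h₁ : ∀ r c : Fin n, A (a.succAbove r) c.succ = if r = c then 1 else 0) :
    l a * A.det = (-1) ^ (a : ℕ) * ∑ r, l r * A r 0 := by
  have h := Matrix.det_updateRow_sum A a l
  rw [smul_eq_mul] at h
  rw [← h, Matrix.det_succ_row _ a, Fin.sum_univ_succ]
  refine (congrArg₂ (· + ·) ?_ (Finset.sum_eq_zero ?_)).trans (add_zero _)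
  · have hm : (A.updateRow a (∑ k, l k • A k)).submatrix a.succAbove (Fin.succAbove 0) = 1 := by
      ext r c
      rw [Matrix.submatrix_apply, Matrix.updateRow_ne (Fin.succAbove_ne a r),
        Fin.succAbove_zero, h₁]
      rfl
    rw [hm, Matrix.det_one, mul_one, Matrix.updateRow_self, Finset.sum_apply]
    simp
  · intro c _
    rw [Matrix.updateRow_self, Finset.sum_apply]
    have := h₀ c
    simp only [Pi.smul_apply, smul_eq_mul]
    rw [this, mul_zero, zero_mul]

/-- The linear part of the affine function that gives the barycentric coordinate belonging to a
facet. -/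
def facetForm : (ks : List ℕ) → Facet ks → Fin (dim ks) → ℝ
  | m :: ms, Sum.inl i =>
    Fin.append (Fin.cases (fun _ => -1) (fun i => Pi.single i 1) i : Fin (m + 1) → ℝ)
      (fun _ : Fin (dim ms) => 0)
  | m :: ms, Sum.inr f => Fin.append (fun _ : Fin (m + 1) => 0) (facetForm ms f)

/-- The position of a coordinate that occurs in the linear form of a facet and such that all other
coordinates restrict to coordinates of the facet. -/
def pivot : (ks : List ℕ) → Facet ks → Fin (dim ks)
  | m :: ms, Sum.inl i => Fin.castAdd (dim ms) (Fin.cases (0 : Fin (m + 1)) id i)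
  | m :: ms, Sum.inr f => Fin.natAdd (m + 1) (pivot ms f)

theorem chart_castAdd (m : ℕ) (ms : List ℕ) (x : Simp (m + 2)) (y : Prism ms) (i : Fin (m + 1)) :
    chart (m :: ms) (x, y) (Fin.castAdd (dim ms) i) = x i.succ :=
  Fin.append_left (fun i : Fin (m + 1) => x i.succ) (chart ms y) i

theorem chart_natAdd (m : ℕ) (ms : List ℕ) (x : Simp (m + 2)) (y : Prism ms) (i : Fin (dim ms)) :
    chart (m :: ms) (x, y) (Fin.natAdd (m + 1) i) = chart ms y i :=
  Fin.append_right (fun i : Fin (m + 1) => x i.succ) (chart ms y) i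

theorem sum_fin_dim_cons (m : ℕ) (ms : List ℕ) (v : Fin (dim (m :: ms)) → ℝ) :
    ∑ r, v r = ∑ i : Fin (m + 1), v (Fin.castAdd (dim ms) i)
      + ∑ i : Fin (dim ms), v (Fin.natAdd (m + 1) i) :=
  Fin.sum_univ_add (a := m + 1) (b := dim ms) v

theorem sum_facetForm_chart : (ks : List ℕ) → (f : Facet ks) → (x y : Prism ks) →
    ∑ r, facetForm ks f r * (chart ks x r - chart ks y r) = coord ks x f - coord ks y f
  | m :: ms, Sum.inl i, (x, x'), (y, y') => by
    rw [sum_fin_dim_cons]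
    simp only [chart_castAdd, chart_natAdd]
    have h₁ : ∀ j : Fin (m + 1), facetForm (m :: ms) (Sum.inl i) (Fin.castAdd (dim ms) j)
        = (Fin.cases (fun _ => -1) (fun i => Pi.single i 1) i : Fin (m + 1) → ℝ) j :=
      fun j => Fin.append_left _ _ j
    have h₂ : ∀ j : Fin (dim ms), facetForm (m :: ms) (Sum.inl i) (Fin.natAdd (m + 1) j) = 0 :=
      fun j => Fin.append_right _ _ j
    rw [Finset.sum_congr rfl fun j _ => by rw [h₁ j], Finset.sum_eq_zero (s := Finset.univ)
      (f := fun j => facetForm (m :: ms) (Sum.inl i) (Fin.natAdd (m + 1) j) * _)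
      fun j _ => by rw [h₂ j, zero_mul], add_zero]
    change _ = x i - y i
    refine Fin.cases ?_ (fun i => ?_) i
    · have hx : ∑ i, x i = 1 := x.2.2
      have hy : ∑ i, y i = 1 := y.2.2
      rw [Fin.sum_univ_succ] at hx hy
      simp only [Fin.cases_zero, ← Finset.mul_sum, Finset.sum_sub_distrib]
      linarith
    · simp [Pi.single_apply]
  | m :: ms, Sum.inr f, (x, x'), (y, y') => by
    rw [sum_fin_dim_cons]
    simp only [chart_castAdd, chart_natAdd]
    have h₁ : ∀ j : Fin (m + 1), facetForm (m :: ms) (Sum.inr f) (Fin.castAdd (dim ms) j) = 0 :=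
      fun j => Fin.append_left (fun _ : Fin (m + 1) => 0) (facetForm ms f) j
    have h₂ : ∀ j : Fin (dim ms), facetForm (m :: ms) (Sum.inr f) (Fin.natAdd (m + 1) j)
        = facetForm ms f j := fun j => Fin.append_right (fun _ : Fin (m + 1) => 0) _ j
    rw [Finset.sum_eq_zero (s := Finset.univ)
      (f := fun j => facetForm (m :: ms) (Sum.inr f) (Fin.castAdd (dim ms) j) * _)
      fun j _ => by rw [h₁ j, zero_mul], zero_add, Finset.sum_congr rfl fun j _ => by rw [h₂ j]]
    exact sum_facetForm_chart ms f x' y'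

theorem facetPoint_vertexPoint : (ks : List ℕ) → (f : Facet ks) → (v : Vertex (facetShape ks f)) →
    facetPoint ks f (vertexPoint _ v) = vertexPoint ks (facetVertex ks f v)
  | 0 :: _, Sum.inl i, _ => Prod.ext (stdSimplex.map_vertex (S := ℝ) i.succAbove 0) rfl
  | (_ + 1) :: _, Sum.inl i, (p, _) => Prod.ext (stdSimplex.map_vertex (S := ℝ) i.succAbove p) rfl
  | _ :: ms, Sum.inr f, (_, v) => Prod.ext rfl (facetPoint_vertexPoint ms f v)

theorem vertex_apply {n : ℕ} (p i : Fin n) :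
    (stdSimplex.vertex p : Simp n) i = if i = p then 1 else 0 := by
  rw [stdSimplex.vertex]
  exact Pi.single_apply p (1 : ℝ) i

theorem chart_baseVertex : (ks : List ℕ) → (r : Fin (dim ks)) →
    chart ks (vertexPoint ks (baseVertex ks)) r = 0
  | m :: ms, r => by
    refine Fin.addCases (m := m + 1) (n := dim ms) (fun i => ?_) (fun i => ?_) r
    · exact (chart_castAdd m ms _ _ i).trans
        ((vertex_apply _ _).trans (if_neg (Fin.succ_ne_zero i)))
    · exact (chart_natAdd m ms _ _ i).trans (chart_baseVertex ms i)

theorem frameVertex_castAdd (m : ℕ) (ms : List ℕ) (c : Fin (m + 1)) :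
    frameVertex (m :: ms) (Fin.castAdd (dim ms) c) = (c.succ, baseVertex ms) :=
  Fin.append_left (m := m + 1) (fun i => ((i.succ, baseVertex ms) : Fin (m + 2) × Vertex ms))
    (fun i => (0, frameVertex ms i)) c

theorem frameVertex_natAdd (m : ℕ) (ms : List ℕ) (c : Fin (dim ms)) :
    frameVertex (m :: ms) (Fin.natAdd (m + 1) c) = (0, frameVertex ms c) :=
  Fin.append_right (m := m + 1) (fun i => ((i.succ, baseVertex ms) : Fin (m + 2) × Vertex ms))
    (fun i => (0, frameVertex ms i)) c

/-- The coordinate of a vertex in the first block. -/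
theorem chart_vertex_castAdd (m : ℕ) (ms : List ℕ) (p : Fin (m + 2)) (v : Vertex ms)
    (r : Fin (m + 1)) : chart (m :: ms) (vertexPoint (m :: ms) (p, v)) (Fin.castAdd (dim ms) r)
      = if (r : ℕ) + 1 = p then 1 else 0 := by
  refine (chart_castAdd m ms _ _ r).trans ((vertex_apply _ _).trans ?_)
  simp only [Fin.ext_iff, Fin.val_succ]

theorem chart_vertex_natAdd (m : ℕ) (ms : List ℕ) (p : Fin (m + 2)) (v : Vertex ms)
    (r : Fin (dim ms)) : chart (m :: ms) (vertexPoint (m :: ms) (p, v)) (Fin.natAdd (m + 1) r)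
      = chart ms (vertexPoint ms v) r := chart_natAdd m ms _ _ r

theorem chart_frameVertex : (ks : List ℕ) → (c r : Fin (dim ks)) →
    chart ks (vertexPoint ks (frameVertex ks c)) r = if (r : ℕ) = c then 1 else 0
  | m :: ms, c, r => by
    refine Fin.addCases (m := m + 1) (n := dim ms) (fun c => ?_) (fun c => ?_) c
    · have e := congrArg (fun v => chart (m :: ms) (vertexPoint (m :: ms) v) r)
        (frameVertex_castAdd m ms c)
      refine e.trans ?_
      refine Fin.addCases (m := m + 1) (n := dim ms) (fun r => ?_) (fun r => ?_) r
      · refine (chart_vertex_castAdd m ms _ _ r).trans (if_congr ?_ rfl rfl)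
        simp only [Fin.val_succ, Fin.val_castAdd]
        omega
      · refine (chart_vertex_natAdd m ms _ _ r).trans ((chart_baseVertex ms r).trans ?_)
        rw [if_neg]
        simp only [Fin.val_natAdd, Fin.val_castAdd]
        omega
    · have e := congrArg (fun v => chart (m :: ms) (vertexPoint (m :: ms) v) r)
        (frameVertex_natAdd m ms c)
      refine e.trans ?_
      refine Fin.addCases (m := m + 1) (n := dim ms) (fun r => ?_) (fun r => ?_) r
      · refine (chart_vertex_castAdd m ms _ _ r).trans ?_
        rw [if_neg (by simp), if_neg]
        simp only [Fin.val_natAdd, Fin.val_castAdd]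
        omega
      · refine (chart_vertex_natAdd m ms _ _ r).trans ((chart_frameVertex ms c r).trans
          (if_congr ?_ rfl rfl))
        simp only [Fin.val_natAdd]
        omega

/-- The vectors of the standard frame of a facet. -/
noncomputable def facetFrame (ks : List ℕ) (f : Facet ks) (c : Fin (dim (facetShape ks f)))
    (r : Fin (dim ks)) : ℝ :=
  chart ks (vertexPoint ks (facetVertex ks f (frameVertex _ c))) r
    - chart ks (vertexPoint ks (facetVertex ks f (baseVertex _))) r

theorem val_pivot_inl (m : ℕ) (ms : List ℕ) (i : Fin (m + 2)) :
    (pivot (m :: ms) (Sum.inl i) : ℕ) = i - 1 := by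
  refine Fin.cases ?_ (fun i => ?_) i
  · rfl
  · simp [pivot]

/-- Away from the pivot, the standard frame of a facet consists of coordinate vectors. -/
theorem facetFrame_apply : (ks : List ℕ) → (f : Facet ks) → (c : Fin (dim (facetShape ks f))) →
    (r : Fin (dim ks)) → (r : ℕ) ≠ pivot ks f →
    facetFrame ks f c r = if (r : ℕ) = skip (pivot ks f) c then 1 else 0
  | 0 :: ms, Sum.inl i, c, r, hr => by
    rw [val_pivot_inl, show (i : ℕ) - 1 = 0 by omega] at hr ⊢
    revert hr
    refine Fin.addCases (m := 0 + 1) (n := dim ms) (fun r => ?_) (fun r => ?_) r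
    · intro hr
      exact absurd (by simp) hr
    · intro _
      have h₁ := (chart_vertex_natAdd 0 ms (i.succAbove 0) (frameVertex ms c) r).trans
        (chart_frameVertex ms c r)
      have h₂ := (chart_vertex_natAdd 0 ms (i.succAbove 0) (baseVertex ms) r).trans
        (chart_baseVertex ms r)
      refine (congrArg₂ (· - ·) h₁ h₂).trans ((sub_zero _).trans (if_congr ?_ rfl rfl))
      simp only [Fin.val_natAdd, skip]
      change (r : ℕ) = (c : ℕ) ↔ 0 + 1 + (r : ℕ) = if (c : ℕ) < 0 then (c : ℕ) else c + 1
      rw [if_neg (Nat.not_lt_zero _)]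
      omega
  | (m + 1) :: ms, Sum.inl i, c, r, hr => by
    rw [val_pivot_inl] at hr ⊢
    revert hr
    refine Fin.addCases (m := m + 1) (n := dim ms) (fun c => ?_) (fun c => ?_) c
    · have e := congrArg (headFacetVertex (m + 1) ms i) (frameVertex_castAdd m ms c)
      refine Fin.addCases (m := m + 1 + 1) (n := dim ms) (fun r => ?_) (fun r => ?_) r
      · intro hr
        have h₁ := (congrArg (fun v => chart _ (vertexPoint ((m + 1) :: ms) v)
          (Fin.castAdd (dim ms) r)) e).trans (chart_vertex_castAdd (m + 1) ms
            (i.succAbove c.succ) (baseVertex ms) r)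
        have h₂ := chart_vertex_castAdd (m + 1) ms (i.succAbove 0) (baseVertex ms) r
        have h₃ : ¬ ((r : ℕ) + 1 = (i.succAbove (0 : Fin (m + 2)) : ℕ)) := by
          rw [val_succAbove_eq_skip, Fin.val_zero]
          simp only [Fin.val_castAdd] at hr
          rcases Nat.eq_zero_or_pos (i : ℕ) with hi | hi
          · rw [skip, if_neg (by omega)]
            omega
          · rw [skip, if_pos hi]
            exact Nat.succ_ne_zero _
        refine (congrArg₂ (· - ·) h₁ (h₂.trans (if_neg h₃))).trans
          ((sub_zero _).trans (if_congr ?_ rfl rfl))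
        rw [val_succAbove_eq_skip]
        simp only [Fin.val_castAdd, Fin.val_succ, skip] at hr ⊢
        split_ifs <;> omega
      · intro _
        have h₁ := (congrArg (fun v => chart _ (vertexPoint ((m + 1) :: ms) v)
          (Fin.natAdd (m + 1 + 1) r)) e).trans (chart_vertex_natAdd (m + 1) ms
            (i.succAbove c.succ) (baseVertex ms) r)
        have h₂ := chart_vertex_natAdd (m + 1) ms (i.succAbove 0) (baseVertex ms) r
        refine (congrArg₂ (· - ·) h₁ h₂).trans ((sub_self _).trans (if_neg ?_).symm)
        simp only [Fin.val_natAdd, Fin.val_castAdd, skip]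
        split_ifs <;> omega
    · have e := congrArg (headFacetVertex (m + 1) ms i) (frameVertex_natAdd m ms c)
      refine Fin.addCases (m := m + 1 + 1) (n := dim ms) (fun r => ?_) (fun r => ?_) r
      · intro hr
        have h₁ := (congrArg (fun v => chart _ (vertexPoint ((m + 1) :: ms) v)
          (Fin.castAdd (dim ms) r)) e).trans (chart_vertex_castAdd (m + 1) ms
            (i.succAbove 0) (frameVertex ms c) r)
        have h₂ := chart_vertex_castAdd (m + 1) ms (i.succAbove 0) (baseVertex ms) r
        refine (congrArg₂ (· - ·) h₁ h₂).trans ((sub_self _).trans (if_neg ?_).symm)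
        simp only [Fin.val_natAdd, Fin.val_castAdd, skip]
        split_ifs <;> omega
      · intro _
        have h₁ := (congrArg (fun v => chart _ (vertexPoint ((m + 1) :: ms) v)
          (Fin.natAdd (m + 1 + 1) r)) e).trans ((chart_vertex_natAdd (m + 1) ms
            (i.succAbove 0) (frameVertex ms c) r).trans (chart_frameVertex ms c r))
        have h₂ := (chart_vertex_natAdd (m + 1) ms (i.succAbove 0) (baseVertex ms) r).trans
          (chart_baseVertex ms r)
        refine (congrArg₂ (· - ·) h₁ h₂).trans ((sub_zero _).trans (if_congr ?_ rfl rfl))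
        simp only [Fin.val_natAdd, skip]
        split_ifs <;> omega
  | m :: ms, Sum.inr f, c, r, hr => by
    have hp : (pivot (m :: ms) (Sum.inr f) : ℕ) = m + 1 + pivot ms f := rfl
    rw [hp] at hr ⊢
    revert hr
    refine Fin.addCases (m := m + 1) (n := dim (facetShape ms f)) (fun c => ?_) (fun c => ?_) c
    · have e := congrArg (facetVertex (m :: ms) (Sum.inr f))
        (frameVertex_castAdd m (facetShape ms f) c)
      refine Fin.addCases (m := m + 1) (n := dim ms) (fun r => ?_) (fun r => ?_) r
      · intro hr
        have h₁ := (congrArg (fun v => chart _ (vertexPoint (m :: ms) v)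
          (Fin.castAdd (dim ms) r)) e).trans (chart_vertex_castAdd m ms c.succ _ r)
        have h₂ := (chart_vertex_castAdd m ms 0 (facetVertex ms f (baseVertex _)) r).trans
          (if_neg (by simp))
        refine (congrArg₂ (· - ·) h₁ h₂).trans ((sub_zero _).trans (if_congr ?_ rfl rfl))
        simp only [Fin.val_castAdd, Fin.val_succ, skip]
        split_ifs <;> omega
      · intro _
        have h₁ := (congrArg (fun v => chart _ (vertexPoint (m :: ms) v)
          (Fin.natAdd (m + 1) r)) e).trans (chart_vertex_natAdd m ms c.succ _ r)
        have h₂ := chart_vertex_natAdd m ms 0 (facetVertex ms f (baseVertex _)) r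
        refine (congrArg₂ (· - ·) h₁ h₂).trans ((sub_self _).trans (if_neg ?_).symm)
        simp only [Fin.val_natAdd, Fin.val_castAdd, skip]
        split_ifs <;> omega
    · have e := congrArg (facetVertex (m :: ms) (Sum.inr f))
        (frameVertex_natAdd m (facetShape ms f) c)
      refine Fin.addCases (m := m + 1) (n := dim ms) (fun r => ?_) (fun r => ?_) r
      · intro hr
        have h₁ := (congrArg (fun v => chart _ (vertexPoint (m :: ms) v)
          (Fin.castAdd (dim ms) r)) e).trans (chart_vertex_castAdd m ms 0 _ r)
        have h₂ := chart_vertex_castAdd m ms 0 (facetVertex ms f (baseVertex _)) r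
        refine (congrArg₂ (· - ·) h₁ h₂).trans ((sub_self _).trans (if_neg ?_).symm)
        simp only [Fin.val_natAdd, Fin.val_castAdd, skip]
        split_ifs <;> omega
      · intro hr
        have h₁ := (congrArg (fun v => chart _ (vertexPoint (m :: ms) v)
          (Fin.natAdd (m + 1) r)) e).trans (chart_vertex_natAdd m ms 0 _ r)
        have h₂ := chart_vertex_natAdd m ms 0 (facetVertex ms f (baseVertex _)) r
        refine (congrArg₂ (· - ·) h₁ h₂).trans ((facetFrame_apply ms f c r ?_).trans
          (if_congr ?_ rfl rfl))
        · simp only [Fin.val_natAdd] at hr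
          omega
        · simp only [Fin.val_natAdd, skip]
          split_ifs <;> omega

/-- The position of the pivot and the coefficient of the form there account for the sign of the
facet. -/
theorem neg_one_pow_pivot_mul : (ks : List ℕ) → (f : Facet ks) →
    (-1 : ℝ) ^ (pivot ks f : ℕ) * facetForm ks f (pivot ks f) = -(-1) ^ facetExponent ks f
  | m :: ms, Sum.inl i => by
    have h₁ : facetForm (m :: ms) (Sum.inl i) (pivot (m :: ms) (Sum.inl i))
        = (Fin.cases (fun _ => -1) (fun i => Pi.single i 1) i : Fin (m + 1) → ℝ)
          (Fin.cases (0 : Fin (m + 1)) id i) := Fin.append_left _ _ _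
    rw [h₁, val_pivot_inl]
    change _ = -(-1 : ℝ) ^ (i : ℕ)
    refine Fin.cases ?_ (fun i => ?_) i
    · simp
    · simp [pow_succ]
  | m :: ms, Sum.inr f => by
    have h₁ : facetForm (m :: ms) (Sum.inr f) (pivot (m :: ms) (Sum.inr f))
        = facetForm ms f (pivot ms f) :=
      Fin.append_right (fun _ : Fin (m + 1) => 0) (facetForm ms f) _
    rw [h₁]
    change (-1 : ℝ) ^ (m + 1 + (pivot ms f : ℕ)) * _ = -(-1) ^ (m + 1 + facetExponent ms f)
    rw [pow_add, mul_assoc, neg_one_pow_pivot_mul ms f, pow_add]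
    ring

/-- The boundary orientation of a facet is computed by expanding the determinant of the outward
vector and the standard frame of the facet along the pivot row, after replacing this row by the
combination of all rows given by the linear form of the facet: the form vanishes on the frame and
is negative on the outward vector. -/
theorem facetSign_eq (ks : List ℕ) (f : Facet ks) :
    ((facetSign ks f : SignType) : ℤ) = (-1) ^ facetExponent ks f := by
  set h := dim_facetShape_add_one ks f
  set A : Matrix (Fin (dim (facetShape ks f) + 1)) (Fin (dim (facetShape ks f) + 1)) ℝ :=
    Matrix.of (fun (row col : Fin (dim (facetShape ks f) + 1)) =>
      (Fin.cons (α := fun _ => Fin (dim ks) → ℝ)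
        (chart ks (facetPoint ks f (center (facetShape ks f))) - chart ks (center ks))
        (fun c : Fin (dim (facetShape ks f)) =>
          chart ks (facetPoint ks f (vertexPoint _ (frameVertex (facetShape ks f) c)))
            - chart ks (facetPoint ks f (vertexPoint _ (baseVertex (facetShape ks f)))))
        col) (Fin.cast h row)) with hA
  change ((SignType.sign A.det : SignType) : ℤ) = _
  let l : Fin (dim (facetShape ks f) + 1) → ℝ := fun r => facetForm ks f (Fin.cast h r)
  let a : Fin (dim (facetShape ks f) + 1) := Fin.cast h.symm (pivot ks f)
  have hsum : ∀ v : Fin (dim ks) → ℝ, ∑ r, v (Fin.cast h r) = ∑ r, v r := fun v =>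
    (finCongr h).sum_comp v
  have hA₁ : ∀ r c, A r (Fin.succ c) = facetFrame ks f c (Fin.cast h r) := fun r c => by
    rw [facetFrame, ← facetPoint_vertexPoint, ← facetPoint_vertexPoint]
    rfl
  have key := mul_det_of_form A a l (fun c => by
    have e := sum_facetForm_chart ks f
      (facetPoint ks f (vertexPoint _ (frameVertex (facetShape ks f) c)))
      (facetPoint ks f (vertexPoint _ (baseVertex (facetShape ks f))))
    rw [coord_facetPoint_self, coord_facetPoint_self, sub_self] at e
    rw [← e]
    exact hsum (fun r => facetForm ks f r * (chart ks _ r - chart ks _ r))) (fun r c => by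
    rw [hA₁, facetFrame_apply]
    · refine if_congr ?_ rfl rfl
      rw [Fin.val_cast, val_succAbove_eq_skip]
      change skip (pivot ks f) r = skip (pivot ks f) c ↔ r = c
      rw [Fin.ext_iff]
      unfold skip
      split_ifs <;> omega
    · intro he
      exact Fin.succAbove_ne a r (Fin.ext he))
  have hu : ∑ r, l r * A r 0 = - coord ks (center ks) f := by
    have e := sum_facetForm_chart ks f (facetPoint ks f (center (facetShape ks f))) (center ks)
    rw [coord_facetPoint_self, zero_sub] at e
    rw [← e]
    exact hsum (fun r => facetForm ks f r * (chart ks _ r - chart ks _ r))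
  have hpos := coord_center_pos ks f
  have hp : (-1 : ℝ) ^ (pivot ks f : ℕ) * l a = -(-1) ^ facetExponent ks f :=
    neg_one_pow_pivot_mul ks f
  -- `coord ks (center ks) f` is positive, and so only the sign matters
  have hdet : A.det = (-1) ^ facetExponent ks f * coord ks (center ks) f := by
    have h₁ : ((-1 : ℝ) ^ (pivot ks f : ℕ) * l a) * A.det = - coord ks (center ks) f := by
      rw [mul_assoc, key, hu, ← mul_assoc, ← pow_add]
      change (-1 : ℝ) ^ ((pivot ks f : ℕ) + (pivot ks f : ℕ)) * _ = _
      rw [Even.neg_one_pow ⟨_, rfl⟩, one_mul]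
    rw [hp] at h₁
    rcases neg_one_pow_eq_or ℝ (facetExponent ks f) with hs | hs <;> rw [hs] at h₁ ⊢ <;> linarith
  rw [hdet]
  rcases neg_one_pow_eq_or ℤ (facetExponent ks f) with hs | hs
  · have hs' : (-1 : ℝ) ^ facetExponent ks f = 1 := by
      exact_mod_cast congrArg (Int.cast (R := ℝ)) hs
    rw [hs, hs', one_mul, sign_pos hpos]
    rfl
  · have hs' : (-1 : ℝ) ^ facetExponent ks f = -1 := by
      exact_mod_cast congrArg (Int.cast (R := ℝ)) hs
    rw [hs, hs', neg_one_mul, sign_neg (neg_lt_zero.2 hpos)]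
    rfl

end Prismatic

theorem mainTheorem1 (G : Type u) [Shalgebra G] :
    -- the boundary of a good-labeled prism, with signs and labels
    (∀ (ks : List ℕ) (g : Prismatic.Label G ks),
      (Prismatic.boundary ks =
        ⋃ f : Prismatic.Facet ks, Set.range (Prismatic.facetPoint ks f)) ∧
      ∀ f : Prismatic.Facet ks,
        ((Prismatic.facetSign ks f : SignType) : ℤ) = (-1) ^ Prismatic.facetExponent ks f ∧
        Prismatic.goodLabeling ks g ∘ Prismatic.facetEdge ks f =
          Prismatic.goodLabeling (Prismatic.facetShape ks f) (Prismatic.face ks f g)) ∧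
    -- the gluing is well defined: the labeled prism to which a facet is glued is unique, and
    -- every point of the glued space lies in exactly one open cell
    (∀ (ks : List ℕ) (g : Prismatic.Label G ks) (f : Prismatic.Facet ks),
      ∃! g' : Prismatic.Label G (Prismatic.facetShape ks f),
        Prismatic.goodLabeling ks g ∘ Prismatic.facetEdge ks f =
          Prismatic.goodLabeling (Prismatic.facetShape ks f) g') ∧
    (∀ b : Prismatic.BG G, ∃! q : Prismatic.PrismSpace G,
      q.2 ∉ Prismatic.boundary q.1.1 ∧ Quot.mk (Prismatic.Glue G) q = b) ∧
    -- the prismatic complex is a complex, and its homology is that of the classifying space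
    (∀ n : ℕ, Prismatic.differential G n ∘ₗ Prismatic.differential G (n + 1) = 0) ∧
    (∀ n : ℕ, 1 ≤ n →
      Nonempty (Prismatic.Homology G n ≃ₗ[ℤ] Prismatic.singularHomology n (Prismatic.BG G))) ∧
    (Subsingleton (Prismatic.Homology G 0) ∧
      Nonempty (Prismatic.singularHomology 0 (Prismatic.BG G) ≃ₗ[ℤ] ℤ)) := by
  refine ⟨fun ks g => ⟨Prismatic.boundary_eq_iUnion_range ks, fun f => ⟨Prismatic.facetSign_eq ks f,
    Prismatic.goodLabeling_comp_facetEdge ks f g⟩⟩, fun ks g f => ⟨Prismatic.face ks f g,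
    Prismatic.goodLabeling_comp_facetEdge ks f g, fun g' hg' => ?_⟩, fun b => ?_,
    Prismatic.differential_comp_differential, fun n hn => Prismatic.nonempty_homology_equiv hn,
    Prismatic.subsingleton_homology_zero, Prismatic.nonempty_singularHomology_zero_equiv⟩
  · exact Prismatic.goodLabeling_injective _
      (hg'.symm.trans (Prismatic.goodLabeling_comp_facetEdge ks f g))
  · simp only [Prismatic.boundary_eq_facetUnion]
    exact Prismatic.existsUnique_interior_rep b
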